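/- **Model.** For each $n\ge 1$ let $\mathbf w^{(n)}=(w^{(n)}_1,\dots,w^{(n)}_n)$ be a random (possibly deterministic) vector of nonnegative real numbers, and let $p^{(n)}_i=w^{(n)}_i/\sum_{j}w^{(n)}_j$ (with $0/0:=0$). Objects $1,\dots,n$ are kept in a list; at time $0$ object $i$ is at position $i$. Conditionally on $\mathbf w^{(n)}$, the objects are requested at the instants of independent Poisson processes, of rate $p^{(n)}_i$ for object $i$, and each requested object is instantaneously moved to the front of the list, the relative order of the others being unchanged. The search-cost $S^{(n)}(t)$ is the position in the list, just before its request, of the first object requested in $[t,\infty)$ (and $0$ if no object is ever requested, that is, if $\mathbf w^{(n)}=0$). Put $S^{(n)}_{\mathbf o}(t)=S^{(n)}(t)$ if this object has not been requested in $[0,t)$, and $S^{(n)}_{\mathbf o}(t)=0$ otherwise. **Assumptions.** Condition LLN-$P$: $P$ is a Borel probability measure on $[0,\infty)$ with finite mean $\mu=\int x\,P(dx)\neq 0$, and there are positive random variables $Z_n$ such that the random measures $\frac1n\sum_{i=1}^n\delta_{Z_nw^{(n)}_i}$ converge in law (for the weak topology on probability measures on $[0,\infty)$) to $P$, and the means $\frac1n\sum_{i=1}^nZ_nw^{(n)}_i$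 converge in law to $\mu$. Condition LLN-$P^-$ (respectively LLN-$P^+$): LLN-$P$ holds and, for each $n$, almost surely $w^{(n)}_1\ge\dots\ge w^{(n)}_n$ (respectively $w^{(n)}_1\le\dots\le w^{(n)}_n$). **Notation.** Let $\phi(t)=\int e^{-zt}P(dz)$, $t\ge0$, with inverse $\phi^{-1}:(P(\{0\}),1]\to[0,\infty)$, let $\phi'$ and $\phi''$ be its derivatives ($\phi'(0)$ is the right derivative), and let $S^{(\infty)}$ be a random variable with density $$f_{S^{(\infty)}}(x)=-\frac1\mu\,\frac{\phi''(\phi^{-1}(1-x))}{\phi'(\phi^{-1}(1-x))}\,\mathbf 1_{[0,1-P(\{0\})]}(x).$$ For a nondecreasing right-continuous $h$ on $[0,\infty)$ write $h^{-1}(u)=\inf\{y\ge0: h(y)\ge u\}$. For $t\ge0$ put $$g_t(y)=\int_{[0,y]}e^{-zt}P(dz),\quad \tilde g_t(y)=g_t^{-1}(1-y)\qquad\text{under LLN-}P^-,$$ $$g_t(y)=\int_{(y,\infty)}e^{-zt}P(dz),\quad \tilde g_t(y)=(1-g_t)^{-1}(y)\qquad\text{under LLN-}P^+.$$ **Statement.**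 Assume LLN-$P^-$ or LLN-$P^+$. The function $f_{S^{(\infty)}}$ and, for every $t\ge0$, the function $$f_{S(t)}(x)=\mathbf 1_{[0,1-\phi(t)]}(x)\,f_{S^{(\infty)}}(x)+\mathbf 1_{[1-\phi(t),1]}(x)\,\frac1\mu\,\tilde g_t(x)$$ are probability densities; let $S(t)$ be a random variable with density $f_{S(t)}$. Then for every $t>0$, as $n\to\infty$, $$\frac{S^{(n)}(n\mu t)}{n}\longrightarrow S(t)\quad\text{in distribution},$$ $$\mathbb P\bigl(S^{(n)}_{\mathbf o}(n\mu t)>0\bigr)\longrightarrow\mathbb P\bigl(S(t)>1-\phi(t)\bigr)=\mathbb P\bigl(S^{(\infty)}>1-\phi(t)\bigr)=\frac{|\phi'(t)|}{\mu},$$ and for every $t\ge0$ $$\bigl\|\operatorname{law}(S(t))-\operatorname{law}(S^{(\infty)})\bigr\|_{\mathrm{TV}}\le 2\,\frac{|\phi'(t)|}{\mu},$$ where $\|\cdot\|_{\mathrm{TV}}$ is the total mass of the variation of a signed measure (so that the distance of two laws with densities $f,h$ is $\int|f-h|\,dx$). -/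

import Mathlib

open MeasureTheory ProbabilityTheory Filter Set
open scoped Topology NNReal ENNReal BoundedContinuousFunction

noncomputable section

namespace MtF

/-! ### The move-to-front list -/

/-- Effect of a request of object `i` on the positions (counted from `1`) of the objects:
`i` goes to position `1`, the objects that stood in front of it move back by one. -/
def moveToFront {n : ℕ} (pos : Fin n → ℕ) (i : Fin n) : Fin n → ℕ :=
  fun j => if j = i then 1 else if pos j < pos i then pos j + 1 else pos j

/-- The request instants of an object with counting process `c` are the jump times of `c`. -/
def jumpTimes (c : ℝ≥0 → ℕ) : Set ℝ≥0 :=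
  {s | 0 < s ∧ ∀ r < s, c r < c s}

/-- All requests (instant, object) in the time interval `[0, t)`, where `A i` is the set of request
instants of object `i`; the order is the chronological one. -/
def requestsBefore {n : ℕ} (A : Fin n → Set ℝ≥0) (t : ℝ≥0) : Set (ℝ≥0 ×ₗ Fin n) :=
  {q | (ofLex q).1 ∈ A (ofLex q).2 ∧ (ofLex q).1 < t}

open Classical in
/-- The objects requested in `[0, t)`, listed in chronological order. (For locally finite sets
of request instants, which is almost surely the case below, the first alternative applies.) -/
def requestLog {n : ℕ} (A : Fin n → Set ℝ≥0) (t : ℝ≥0) : List (Fin n) :=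
  if h : (requestsBefore A t).Finite then
    (h.toFinset.sort (fun a b => a ≤ b)).map (fun q => (ofLex q).2)
  else []

/-- Position of object `i` in the list at time `t` (before a possible request at time `t` itself),
if `π` is the initial permutation: object `i` starts at the position of rank `π i`. -/
def position {n : ℕ} (π : Equiv.Perm (Fin n)) (A : Fin n → Set ℝ≥0) (t : ℝ≥0) : Fin n → ℕ :=
  (requestLog A t).foldl moveToFront (fun i => (π i : ℕ) + 1)

/-- `i` is the first object requested in the time interval `[t, ∞)`. -/
def IsNextRequested {n : ℕ} (A : Fin n → Set ℝ≥0) (t : ℝ≥0) (i : Fin n) : Prop :=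
  ∃ s ∈ A i, t ≤ s ∧ ∀ j, ∀ r ∈ A j, t ≤ r → s ≤ r

/-- The set of the objects requested at least once in `[0, t)`. -/
def requestedBefore {n : ℕ} (A : Fin n → Set ℝ≥0) (t : ℝ≥0) : Set (Fin n) :=
  {i | ∃ s ∈ A i, s < t}

open Classical in
/-- The search-cost at time `t`: the position of the next requested object. -/
def searchCost {n : ℕ} (π : Equiv.Perm (Fin n)) (A : Fin n → Set ℝ≥0) (t : ℝ≥0) : ℕ :=
  ∑ i, if IsNextRequested A t i then position π A t i else 0

open Classical in
/-- The out-of-equilibrium part of the search-cost: the search-cost if the next requested object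
has not been requested in `[0, t)`, and `0` otherwise. -/
def searchCostOut {n : ℕ} (π : Equiv.Perm (Fin n)) (A : Fin n → Set ℝ≥0) (t : ℝ≥0) : ℕ :=
  if ∃ i, IsNextRequested A t i ∧ i ∉ requestedBefore A t then searchCost π A t else 0

/-! ### The request processes -/

/-- `N` is a standard (unit rate) Poisson process. -/
structure IsStandardPoissonProcess {Ω : Type*} [MeasurableSpace Ω] (N : ℝ≥0 → Ω → ℕ)
    (Pr : Measure Ω) : Prop where
  measurable : ∀ t, Measurable (N t)
  paths : ∀ᵐ ω ∂Pr, N 0 ω = 0 ∧ Monotone (fun t => N t ω) ∧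
    ∀ t, ContinuousWithinAt (fun s => N s ω) (Ici t) t
  indep_increments : HasIndepIncrements N Pr
  increments_law : ∀ s t : ℝ≥0, s ≤ t →
    HasLaw (fun ω => N t ω - N s ω) (poissonMeasure (t - s)) Pr

/-- The random inputs of a list of `n` objects: a random (possibly deterministic) vector `w` of
nonnegative numbers and, independently of it, `n` independent standard Poisson processes. -/
structure IsRequestModel {Ω : Type*} [MeasurableSpace Ω] {n : ℕ} (w : Ω → Fin n → ℝ≥0)
    (N : Fin n → ℝ≥0 → Ω → ℕ) (Pr : Measure Ω) : Prop where
  measurable_weights : Measurable w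
  poisson : ∀ i, IsStandardPoissonProcess (N i) Pr
  indep : iIndepFun (fun i ω s => N i s ω) Pr
  indep_weights : IndepFun w (fun ω i s => N i s ω) Pr

/-- The popularities `p i = w i / ∑ j, w j` (with `0 / 0 = 0`). -/
def popularity {n : ℕ} (w : Fin n → ℝ≥0) (i : Fin n) : ℝ≥0 := w i / ∑ j, w j

/-- The request instants of the objects, in the time scale in which the total request rate is `1`:
given `w`, the requests of object `i` form a Poisson process of rate `popularity w i`, independent
of the requests of the other objects. (In the original time scale object `i` is requested at
the jumps of `s ↦ N i (w i * s)`; time is then slowed down by the factor `∑ j, w j`.) -/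
def requestTimes {Ω : Type*} {n : ℕ} (w : Ω → Fin n → ℝ≥0) (N : Fin n → ℝ≥0 → Ω → ℕ) (ω : Ω) :
    Fin n → Set ℝ≥0 :=
  fun i => jumpTimes (fun s => N i (popularity (w ω) i * s) ω)

/-! ### The law of large numbers conditions -/

/-- The empirical measure `(1/n) ∑ i, δ_{v i}`. -/
def empiricalMeasure {n : ℕ+} (v : Fin n → ℝ≥0) : ProbabilityMeasure ℝ≥0 :=
  ⟨((n : ℕ) : ℝ≥0∞)⁻¹ • ∑ i, Measure.dirac (v i), ⟨by
    simp [ENNReal.inv_mul_cancel]⟩⟩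

/-- The mean of a probability measure on `[0, ∞)`, if it is finite. -/
def mean (P : ProbabilityMeasure ℝ≥0) : ℝ≥0 := (∫⁻ x, (x : ℝ≥0∞) ∂(P : Measure ℝ≥0)).toNNReal

section LLN

variable {Ω : ℕ+ → Type*} [∀ n, MeasurableSpace (Ω n)]

/-- Convergence in law of random probability measures on `[0, ∞)` to the deterministic limit `P`,
with respect to the weak topology: convergence of the expectations of all bounded continuous
functionals. -/
def TendstoInLawMeasures (Pr : ∀ n, Measure (Ω n)) (ν : ∀ n, Ω n → ProbabilityMeasure ℝ≥0)
    (P : ProbabilityMeasure ℝ≥0) : Prop :=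
  ∀ Ψ : ProbabilityMeasure ℝ≥0 →ᵇ ℝ,
    Tendsto (fun n => ∫ ω, Ψ (ν n ω) ∂(Pr n)) atTop (𝓝 (Ψ P))

/-- The vectors `w n` satisfy a law of large numbers with limiting law `P`. -/
structure LLN (Pr : ∀ n, Measure (Ω n)) [∀ n, IsProbabilityMeasure (Pr n)]
    (w : ∀ n : ℕ+, Ω n → Fin n → ℝ≥0) (P : ProbabilityMeasure ℝ≥0) : Prop where
  mean_finite : ∫⁻ x, (x : ℝ≥0∞) ∂(P : Measure ℝ≥0) ≠ ∞
  mean_ne_zero : mean P ≠ 0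
  exists_scaling : ∃ Z : ∀ n, Ω n → ℝ≥0, (∀ n, Measurable (Z n)) ∧ (∀ n, ∀ᵐ ω ∂(Pr n), 0 < Z n ω) ∧
    TendstoInLawMeasures Pr (fun n ω => empiricalMeasure (fun i => Z n ω * w n ω i)) P ∧
    TendstoInDistribution (fun (n : ℕ+) ω => (∑ i, Z n ω * w n ω i) / ((n : ℕ) : ℝ≥0)) atTop
      (fun _ : Unit => mean P) Pr (Measure.dirac ())

/-- The law of large numbers holds and the vectors are almost surely decreasing. -/
def LLNMinus (Pr : ∀ n, Measure (Ω n)) [∀ n, IsProbabilityMeasure (Pr n)]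
    (w : ∀ n : ℕ+, Ω n → Fin n → ℝ≥0) (P : ProbabilityMeasure ℝ≥0) : Prop :=
  LLN Pr w P ∧ ∀ n, ∀ᵐ ω ∂(Pr n), Antitone (w n ω)

/-- The law of large numbers holds and the vectors are almost surely increasing. -/
def LLNPlus (Pr : ∀ n, Measure (Ω n)) [∀ n, IsProbabilityMeasure (Pr n)]
    (w : ∀ n : ℕ+, Ω n → Fin n → ℝ≥0) (P : ProbabilityMeasure ℝ≥0) : Prop :=
  LLN Pr w P ∧ ∀ n, ∀ᵐ ω ∂(Pr n), Monotone (w n ω)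

end LLN

/-! ### The limiting densities -/

/-- The Laplace transform `φ` of `P`, considered on `[0, ∞)`. -/
def laplace (P : ProbabilityMeasure ℝ≥0) (t : ℝ) : ℝ :=
  ∫ z : ℝ≥0, Real.exp (-(z * t)) ∂(P : Measure ℝ≥0)

/-- The derivative `φ'` on `[0, ∞)` (one-sided at `0`). -/
def laplaceDeriv (P : ProbabilityMeasure ℝ≥0) (t : ℝ) : ℝ :=
  derivWithin (laplace P) (Ici 0) t

/-- The second derivative `φ''` on `(0, ∞)`. -/
def laplaceDeriv₂ (P : ProbabilityMeasure ℝ≥0) (t : ℝ) : ℝ :=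
  derivWithin (laplaceDeriv P) (Ici 0) t

/-- The inverse `φ⁻¹` of `φ : [0, ∞) → (P {0}, 1]`. -/
def laplaceInv (P : ProbabilityMeasure ℝ≥0) (y : ℝ) : ℝ :=
  Function.invFunOn (laplace P) (Ici 0) y

/-- The density of the limiting stationary search-cost. -/
def stationaryDensity (P : ProbabilityMeasure ℝ≥0) : ℝ → ℝ :=
  (Icc 0 (1 - (P : Measure ℝ≥0).real {0})).indicator fun x =>
    -(1 / (mean P : ℝ)) *
      (laplaceDeriv₂ P (laplaceInv P (1 - x)) / laplaceDeriv P (laplaceInv P (1 - x)))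

/-- The generalized inverse of a nondecreasing right-continuous function on `[0, ∞)`. -/
def genInv (g : ℝ≥0 → ℝ) (u : ℝ) : ℝ≥0 := sInf {y | u ≤ g y}

/-- `g_t (y) = ∫_{[0, y]} e^{-zt} P(dz)`. -/
def gMinus (P : ProbabilityMeasure ℝ≥0) (t : ℝ≥0) (y : ℝ≥0) : ℝ :=
  ∫ z in Iic y, Real.exp (-((z : ℝ) * t)) ∂(P : Measure ℝ≥0)

/-- `g_t (y) = ∫_{(y, ∞)} e^{-zt} P(dz)`. -/
def gPlus (P : ProbabilityMeasure ℝ≥0) (t : ℝ≥0) (y : ℝ≥0) : ℝ :=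
  ∫ z in Ioi y, Real.exp (-((z : ℝ) * t)) ∂(P : Measure ℝ≥0)

/-- The function `y ↦ g_t⁻¹ (1 - y)` of the decreasing case. -/
def gTildeMinus (P : ProbabilityMeasure ℝ≥0) (t : ℝ≥0) (y : ℝ) : ℝ :=
  genInv (gMinus P t) (1 - y)

/-- The function `y ↦ (1 - g_t)⁻¹ (y)` of the increasing case. -/
def gTildePlus (P : ProbabilityMeasure ℝ≥0) (t : ℝ≥0) (y : ℝ) : ℝ :=
  genInv (fun z => 1 - gPlus P t z) y

/-- The density of the limiting transient search-cost, where `g` stands for one of the two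
functions above. -/
def transientDensity (P : ProbabilityMeasure ℝ≥0) (g : ℝ≥0 → ℝ → ℝ) (t : ℝ≥0) (x : ℝ) : ℝ :=
  (Icc 0 (1 - laplace P t)).indicator (stationaryDensity P) x +
    (Icc (1 - laplace P t) 1).indicator (fun x => 1 / (mean P : ℝ) * g t x) x

/-- The probability law `Q` on the real line has the (Lebesgue) density `f`. -/
structure HasDensity (Q : ProbabilityMeasure ℝ) (f : ℝ → ℝ) : Prop where
  aemeasurable : AEMeasurable f volume
  nonneg : ∀ᵐ x, 0 ≤ f x
  eq_withDensity : (Q : Measure ℝ) = volume.withDensity (fun x => ENNReal.ofReal (f x))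

/-- The total variation distance `‖Q - Q'‖_TV`: the total mass of the variation of the signed
measure `Q - Q'` (it is `∫ |f - f'|` if there are densities, with maximal value `2`). -/
def tvDist (Q Q' : ProbabilityMeasure ℝ) : ℝ≥0∞ :=
  ((Q : Measure ℝ).toSignedMeasure - (Q' : Measure ℝ).toSignedMeasure).totalVariation univ

end MtF

end

/-! One combinatorial identity carries the theorem. Fix `a ≤ T` and let V be the number of objects
not requested in `[a, T)`. The objects requested in `[a, T)` fill exactly the first n - V places, so
the search-cost S at T exceeds n - V iff the next requested object is one of the V others. For `a =
0` this can be refined: objects never requested keep their initial order at the end of the list, so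
if V counts only the unrequested objects of index at least k, then S > n - V iff the next object is
unrequested and of index at least k. This is `lt_card_add_searchCost_iff`.

The next object is i with probability p_i, independently of the past, so the event on the right has
probability ∑ p_i e^{-p_i (T-a)} (`measureReal_exists_isOnlyNextRequested`). By Chebyshev, V/n is
close to (1/n) ∑ e^{-p_i (T-a)}. Hence one chooses a or k so that the latter average tends to 1 - x,
and P(S > xn) has the same limit as the former sum (`tendsto_measureReal_searchCost_gt`).

Normalise the weights to have mean μ exactly. After time nμu the exponents are w_i u, and the two
sums are integrals of e^{-zu} and z e^{-zu}/μ against the empirical measure. For x < 1 - φ(t) take T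
- a = nμu with φ(u) = 1 - x: the limiting tail is |φ'(u)|/μ, which does not depend on t and is the
tail of the stationary density. For x > 1 - φ(t) take a = 0 and vary k; here the order of the
weights matters. By the layer-cake formula the sum of w_j e^{-w_j t} over j ≥ k is the integral over
y of the mass of {j ≥ k, w_j > y}. Both conditions cut out segments, so this mass is an explicit
function Θ of the masses of the two segments and of the whole. The same Θ gives the Lebesgue measure
of {x > x₀ : g̃_t(x) > y}. `IsProfile` records this coincidence and lets both orderings share one
proof.

Random weights are conditioned upon. The functionals of the weights are scale invariant, and their
convergence is uniform on neighbourhoods of P and of its mean (`TendstoOfMeanEq.eventually`).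
Convergence in law to a constant puts the rescaled weights in these neighbourhoods with probability
tending to 1.

The total variation bound holds because the two densities agree below 1 - φ(t) and both have mass
|φ'(t)|/μ above it. -/

namespace MtF

/-! ### Positions in the move-to-front list -/

/-- The values of `pos` are a ranking of the objects by the numbers `1, …, n`. -/
def IsRanking {n : ℕ} (pos : Fin n → ℕ) : Prop :=
  Function.Injective pos ∧ ∀ i, 1 ≤ pos i ∧ pos i ≤ n

lemma IsRanking.moveToFront {n : ℕ} {pos : Fin n → ℕ} (h : IsRanking pos) (i : Fin n) :
    IsRanking (MtF.moveToFront pos i) := by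
  obtain ⟨hinj, hb⟩ := h
  refine ⟨fun j k hjk => ?_, fun j => ?_⟩
  · have h1 : j ≠ i → pos j ≠ pos i := fun h h' => h (hinj h')
    have h2 : k ≠ i → pos k ≠ pos i := fun h h' => h (hinj h')
    have h3 : pos j = pos k → j = k := fun h => hinj h
    have := hb j
    have := hb k
    have := hb i
    simp only [MtF.moveToFront] at hjk
    split_ifs at hjk with a b <;> first | (subst a; subst b; rfl) | omega
  · have := hb j
    have := hb i
    simp only [MtF.moveToFront]
    split_ifs <;> omega

lemma IsRanking.foldl {n : ℕ} {pos : Fin n → ℕ} (h : IsRanking pos) (l : List (Fin n)) :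
    IsRanking (l.foldl MtF.moveToFront pos) := by
  induction l using List.reverseRecOn with
  | nil => exact h
  | append_singleton l a ih => simpa using ih.moveToFront a

/-- An injection of n objects into 1, …, n takes every value, so the positions below `pos i` are all
occupied. -/
lemma IsRanking.eq_card {n : ℕ} {pos : Fin n → ℕ} (h : IsRanking pos) (i : Fin n) :
    pos i = (Finset.univ.filter fun j => pos j < pos i).card + 1 := by
  obtain ⟨hinj, hb⟩ := h
  have himg : Finset.univ.image pos = Finset.Icc 1 n := by
    apply Finset.eq_of_subset_of_card_le
    · intro x hx
      obtain ⟨j, -, rfl⟩ := Finset.mem_image.1 hx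
      exact Finset.mem_Icc.2 (hb j)
    · rw [Finset.card_image_of_injective _ hinj]
      simp
  have hc : (Finset.univ.filter fun j => pos j < pos i).image pos = Finset.Ico 1 (pos i) := by
    ext x
    simp only [Finset.mem_image, Finset.mem_filter, Finset.mem_univ, true_and, Finset.mem_Ico]
    constructor
    · rintro ⟨j, hj, rfl⟩
      exact ⟨(hb j).1, hj⟩
    · rintro ⟨h1, h2⟩
      have : x ∈ Finset.univ.image pos := by
        rw [himg]
        exact Finset.mem_Icc.2 ⟨h1, h2.le.trans (hb i).2⟩
      obtain ⟨j, -, rfl⟩ := Finset.mem_image.1 this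
      exact ⟨j, h2, rfl⟩
  rw [← Finset.card_image_of_injective _ hinj, hc, Nat.card_Ico]
  have := (hb i).1
  omega

lemma isRanking_perm {n : ℕ} (π : Equiv.Perm (Fin n)) : IsRanking fun i => (π i : ℕ) + 1 := by
  refine ⟨fun i j h => π.injective (Fin.ext (by simpa using h)), fun i => ⟨Nat.succ_le_succ (Nat.zero_le _), (π i).2⟩⟩

/-- Induction on the last request: a request of `i` puts nobody in front of `i`, a request of `j`
puts `j` in front of everybody, and a request of a third object does not change the relative order
of `i` and `j`. -/
lemma foldl_moveToFront_lt_iff {n : ℕ} {pos : Fin n → ℕ} (h : IsRanking pos)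
    (l : List (ℝ≥0 ×ₗ Fin n)) (hl : l.Pairwise (· < ·)) (i j : Fin n) :
    (l.map fun q => (ofLex q).2).foldl moveToFront pos j <
        (l.map fun q => (ofLex q).2).foldl moveToFront pos i ↔
      (∃ q ∈ l, (ofLex q).2 = j ∧ ∀ r ∈ l, (ofLex r).2 = i → r < q) ∨
        ((∀ q ∈ l, (ofLex q).2 ≠ j) ∧ (∀ q ∈ l, (ofLex q).2 ≠ i) ∧ pos j < pos i) := by
  induction l using List.reverseRecOn with
  | nil => simp
  | append_singleton l x ih =>
    rw [List.pairwise_append] at hl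
    obtain ⟨hl1, -, hlx⟩ := hl
    replace hlx : ∀ r ∈ l, r < x := fun r hr => hlx r hr x (by simp)
    specialize ih hl1
    obtain ⟨hinj, hb⟩ := h.foldl (l.map fun q => (ofLex q).2)
    set p := (l.map fun q => (ofLex q).2).foldl moveToFront pos with hp
    have hfold : ((l ++ [x]).map fun q => (ofLex q).2).foldl moveToFront pos =
        moveToFront p (ofLex x).2 := by simp [hp]
    rw [hfold]
    by_cases hi : (ofLex x).2 = i
    · have hL : ¬ moveToFront p (ofLex x).2 j < moveToFront p (ofLex x).2 i := by
        have := hb j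
        simp only [moveToFront, hi, if_true]
        split_ifs <;> omega
      refine iff_of_false hL ?_
      rintro (⟨q, hq, -, hr⟩ | ⟨-, h2, -⟩)
      · have h3 := hr x (by simp) hi
        rcases List.mem_append.1 hq with hq | hq
        · exact lt_asymm h3 (hlx q hq)
        · rw [List.mem_singleton.1 hq] at h3
          exact lt_irrefl _ h3
      · exact h2 x (by simp) hi
    · by_cases hj : (ofLex x).2 = j
      · have hij : i ≠ j := fun h => hi (hj.trans h.symm)
        refine iff_of_true ?_ (Or.inl ⟨x, by simp, hj, fun r hr hri => ?_⟩)
        · have := hb j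
          have := hb i
          have : p i ≠ p j := fun h => hij (hinj h)
          simp only [moveToFront, hj, if_true, hij, if_false]
          split_ifs <;> omega
        · rcases List.mem_append.1 hr with hr | hr
          · exact hlx r hr
          · exact absurd (List.mem_singleton.1 hr ▸ hri) hi
      · have h1 : moveToFront p (ofLex x).2 j < moveToFront p (ofLex x).2 i ↔ p j < p i := by
          have a1 : p i ≠ p (ofLex x).2 := fun h => hi (hinj h).symm
          have a2 : p j ≠ p (ofLex x).2 := fun h => hj (hinj h).symm
          simp only [moveToFront, Ne.symm hi, Ne.symm hj, if_false]
          split_ifs <;> omega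
        rw [h1, ih]
        constructor
        · rintro (⟨q, hq, hqj, hr⟩ | ⟨h2, h3, h4⟩)
          · refine Or.inl ⟨q, by simp [hq], hqj, fun r hr' hri => ?_⟩
            rcases List.mem_append.1 hr' with hr' | hr'
            · exact hr r hr' hri
            · exact absurd (List.mem_singleton.1 hr' ▸ hri) hi
          · refine Or.inr ⟨fun q hq => ?_, fun q hq => ?_, h4⟩
            · rcases List.mem_append.1 hq with hq | hq
              · exact h2 q hq
              · rw [List.mem_singleton.1 hq]; exact hj
            · rcases List.mem_append.1 hq with hq | hq
              · exact h3 q hq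
              · rw [List.mem_singleton.1 hq]; exact hi
        · rintro (⟨q, hq, hqj, hr⟩ | ⟨h2, h3, h4⟩)
          · rcases List.mem_append.1 hq with hq | hq
            · exact Or.inl ⟨q, hq, hqj, fun r hr' => hr r (by simp [hr'])⟩
            · exact absurd (List.mem_singleton.1 hq ▸ hqj) hj
          · exact Or.inr ⟨fun q hq => h2 q (by simp [hq]), fun q hq => h3 q (by simp [hq]), h4⟩

lemma isRanking_position {n : ℕ} (π : Equiv.Perm (Fin n)) (A : Fin n → Set ℝ≥0) (t : ℝ≥0) :
    IsRanking (position π A t) :=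
  (isRanking_perm π).foldl _

/-- `j` stands in front of `i` iff `j` has been requested after the last request of `i`, or if
neither of them has been requested and `j` stood in front of `i` at the beginning. -/
def IsAhead {n : ℕ} (A : Fin n → Set ℝ≥0) (t : ℝ≥0) (j i : Fin n) : Prop :=
  (∃ s ∈ A j, s < t ∧ ∀ r ∈ A i, r < t → toLex (r, i) < toLex (s, j)) ∨
    (j ∉ requestedBefore A t ∧ i ∉ requestedBefore A t ∧ j < i)

lemma position_lt_position_iff {n : ℕ} {A : Fin n → Set ℝ≥0} {t : ℝ≥0}
    (hA : (requestsBefore A t).Finite) (i j : Fin n) :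
    position 1 A t j < position 1 A t i ↔ IsAhead A t j i := by
  have hmem : ∀ q : ℝ≥0 ×ₗ Fin n, q ∈ hA.toFinset.sort (fun a b => a ≤ b) ↔
      (ofLex q).1 ∈ A (ofLex q).2 ∧ (ofLex q).1 < t := by
    intro q
    rw [Finset.mem_sort, Set.Finite.mem_toFinset]
    rfl
  have := foldl_moveToFront_lt_iff (isRanking_perm (1 : Equiv.Perm (Fin n)))
    (hA.toFinset.sort (fun a b => a ≤ b)) (Finset.sortedLT_sort _).pairwise i j
  simp only [position, requestLog, dif_pos hA]
  rw [this]
  unfold IsAhead requestedBefore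
  simp only [hmem, Equiv.Perm.coe_one, id_eq, add_lt_add_iff_right, Fin.val_fin_lt,
    Set.mem_ofPred_eq, not_exists, not_and]
  refine or_congr ⟨?_, ?_⟩ (and_congr ⟨?_, ?_⟩ (and_congr ⟨?_, ?_⟩ Iff.rfl))
  · rintro ⟨q, ⟨h1, h2⟩, rfl, h3⟩
    exact ⟨(ofLex q).1, h1, h2, fun r hr hrt => h3 (toLex (r, i)) ⟨hr, hrt⟩ rfl⟩
  · rintro ⟨s, h1, h2, h3⟩
    refine ⟨toLex (s, j), ⟨h1, h2⟩, rfl, ?_⟩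
    rintro r ⟨hr, hrt⟩ rfl
    exact h3 (ofLex r).1 hr hrt
  · exact fun h s hs hst => h (toLex (s, j)) ⟨hs, hst⟩ rfl
  · rintro h q ⟨h1, h2⟩ rfl
    exact h _ h1 h2
  · exact fun h s hs hst => h (toLex (s, i)) ⟨hs, hst⟩ rfl
  · rintro h q ⟨h1, h2⟩ rfl
    exact h _ h1 h2

-- This replaces the sorted log by a counting formula, which is visibly measurable in the request
-- instants.
open Classical in
lemma position_eq_card {n : ℕ} {A : Fin n → Set ℝ≥0} {t : ℝ≥0}
    (hA : (requestsBefore A t).Finite) (i : Fin n) :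
    position 1 A t i = (Finset.univ.filter fun j => IsAhead A t j i).card + 1 := by
  rw [(isRanking_position 1 A t).eq_card i]
  simp only [position_lt_position_iff hA]

/-- The set of the objects requested at least once in `[a, t)`. -/
def requestedIn {n : ℕ} (A : Fin n → Set ℝ≥0) (a t : ℝ≥0) : Set (Fin n) :=
  {i | ∃ s ∈ A i, a ≤ s ∧ s < t}

lemma requestedIn_zero {n : ℕ} (A : Fin n → Set ℝ≥0) (t : ℝ≥0) :
    requestedIn A 0 t = requestedBefore A t := by
  simp [requestedIn, requestedBefore]

/-- Whoever stands in front of `i` was requested no earlier than the last request of `i`, hence in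
`[a, t)` too. The object `i` itself makes the inclusion strict, which absorbs the `+ 1`. -/
lemma position_le_of_mem_requestedIn {n : ℕ} {A : Fin n → Set ℝ≥0} {a t : ℝ≥0}
    (hA : (requestsBefore A t).Finite) {i : Fin n} (hi : i ∈ requestedIn A a t) :
    position 1 A t i ≤ (requestedIn A a t).ncard := by
  classical
  rw [position_eq_card hA, ← Set.ncard_coe_finset, Nat.succ_le_iff]
  apply Set.ncard_lt_ncard _ (Set.toFinite _)
  obtain ⟨r, hr, har, hrt⟩ := hi
  refine ⟨fun j hj => ?_, fun h => ?_⟩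
  · simp only [Finset.coe_filter, Finset.mem_univ, true_and, Set.mem_ofPred_eq] at hj
    rcases hj with ⟨s, hs, hst, h⟩ | ⟨-, h, -⟩
    · have := h r hr hrt
      rw [Prod.Lex.toLex_lt_toLex] at this
      refine ⟨s, hs, har.trans ?_, hst⟩
      rcases this with h | h
      · exact h.le
      · exact h.1.le
    · exact absurd ⟨r, hr, hrt⟩ h
  · have : i ∈ (↑(Finset.univ.filter fun j => IsAhead A t j i) : Set (Fin n)) :=
      h ⟨r, hr, har, hrt⟩
    simp only [Finset.coe_filter, Finset.mem_univ, true_and, Set.mem_ofPred_eq] at this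
    rw [← position_lt_position_iff hA] at this
    exact lt_irrefl _ this

/-- All requests of `i` before `t`, if any, precede `a`, so every object requested in `[a, t)` is in
front of `i`. -/
lemma lt_position_of_notMem_requestedIn {n : ℕ} {A : Fin n → Set ℝ≥0} {a t : ℝ≥0}
    (hA : (requestsBefore A t).Finite) {i : Fin n} (hi : i ∉ requestedIn A a t) :
    (requestedIn A a t).ncard < position 1 A t i := by
  classical
  rw [position_eq_card hA, ← Set.ncard_coe_finset, Nat.lt_succ_iff]
  apply Set.ncard_le_ncard _ (Set.toFinite _)
  rintro j ⟨s, hs, has, hst⟩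
  simp only [Finset.coe_filter, Finset.mem_univ, true_and, Set.mem_ofPred_eq]
  refine Or.inl ⟨s, hs, hst, fun r hr hrt => ?_⟩
  rw [Prod.Lex.toLex_lt_toLex]
  refine Or.inl (lt_of_lt_of_le (?_ : r < a) has)
  by_contra h
  exact hi ⟨r, hr, not_lt.1 h, hrt⟩

/-- The objects behind an unrequested `i` are exactly the unrequested objects that started behind
it. This is the only place where the initial order enters the position. -/
lemma position_add_ncard_of_notMem_requestedBefore {n : ℕ} {A : Fin n → Set ℝ≥0} {t : ℝ≥0}
    (hA : (requestsBefore A t).Finite) {i : Fin n} (hi : i ∉ requestedBefore A t) :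
    position 1 A t i + {j | i < j ∧ j ∉ requestedBefore A t}.ncard = n := by
  classical
  have h1 : ∀ j, IsAhead A t j i ↔ (j ∈ requestedBefore A t ∨ j < i) := by
    intro j
    by_cases hj : j ∈ requestedBefore A t
    · simp only [hj, true_or, iff_true]
      obtain ⟨s, hs, hst⟩ := hj
      exact Or.inl ⟨s, hs, hst, fun r hr hrt => absurd ⟨r, hr, hrt⟩ hi⟩
    · simp only [hj, false_or]
      constructor
      · rintro (⟨s, hs, hst, -⟩ | ⟨-, -, h⟩)
        · exact absurd ⟨s, hs, hst⟩ hj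
        · exact h
      · exact fun h => Or.inr ⟨hj, hi, h⟩
  have h2 : {j | i < j ∧ j ∉ requestedBefore A t}.ncard + 1 =
      (Finset.univ.filter fun j => ¬ IsAhead A t j i).card := by
    rw [← Set.ncard_coe_finset]
    have : (↑(Finset.univ.filter fun j => ¬ IsAhead A t j i) : Set (Fin n)) =
        insert i {j | i < j ∧ j ∉ requestedBefore A t} := by
      ext j
      simp only [h1, Finset.coe_filter, Finset.mem_univ, true_and, Set.mem_ofPred_eq,
        Set.mem_insert_iff, not_or, not_lt]
      constructor
      · rintro ⟨a, b⟩
        rcases b.eq_or_lt with b | b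
        · exact Or.inl b.symm
        · exact Or.inr ⟨b, a⟩
      · rintro (rfl | ⟨a, b⟩)
        · exact ⟨hi, le_rfl⟩
        · exact ⟨b, a.le⟩
    rw [this, Set.ncard_insert_of_notMem (by simp) (Set.toFinite _)]
  have h3 := Finset.card_filter_add_card_filter_not (s := (Finset.univ : Finset (Fin n)))
    (fun j => IsAhead A t j i)
  rw [position_eq_card hA, add_assoc, add_comm 1, h2, h3]
  simp

/-- `i` is the only object that is requested first in the time interval `[t, ∞)`. -/
def IsOnlyNextRequested {n : ℕ} (A : Fin n → Set ℝ≥0) (t : ℝ≥0) (i : Fin n) : Prop :=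
  IsNextRequested A t i ∧ ∀ j, IsNextRequested A t j → j = i

lemma IsOnlyNextRequested.searchCost_eq {n : ℕ} {A : Fin n → Set ℝ≥0} {t : ℝ≥0} {i : Fin n}
    (h : IsOnlyNextRequested A t i) (π : Equiv.Perm (Fin n)) :
    searchCost π A t = position π A t i := by
  unfold searchCost
  rw [Finset.sum_eq_single i, if_pos h.1]
  · exact fun j _ hj => if_neg fun hj' => hj (h.2 j hj')
  · simp

lemma searchCostOut_pos_iff {n : ℕ} (π : Equiv.Perm (Fin n)) (A : Fin n → Set ℝ≥0) (t : ℝ≥0) :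
    0 < searchCostOut π A t ↔ ∃ i, IsNextRequested A t i ∧ i ∉ requestedBefore A t := by
  classical
  unfold searchCostOut
  split_ifs with h
  · simp only [h, iff_true]
    obtain ⟨i, hi, -⟩ := h
    refine Finset.sum_pos' (fun _ _ => Nat.zero_le _) ⟨i, Finset.mem_univ _, ?_⟩
    rw [if_pos hi]
    exact ((isRanking_position π A t).2 i).1
  · simp [h]

/-! ### Request instants as functions of countably many random variables -/

/-- The paths of counting processes. -/
structure IsCountingPath (c : ℝ≥0 → ℕ) : Prop where
  zero : c 0 = 0
  mono : Monotone c
  rightCts : ∀ t, ContinuousWithinAt c (Ici t) t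

/-- The first instant at which `c` exceeds `k`. -/
noncomputable def passageTime (c : ℝ≥0 → ℕ) (k : ℕ) : ℝ≥0∞ :=
  ⨅ u : ℚ≥0, if k < c u then ((u : ℝ≥0) : ℝ≥0∞) else ∞

lemma measurable_passageTime (k : ℕ) : Measurable fun c : ℝ≥0 → ℕ => passageTime c k := by
  refine Measurable.iInf fun u => Measurable.ite ?_ measurable_const measurable_const
  exact measurableSet_lt measurable_const (measurable_pi_apply _)

lemma exists_nnrat_btwn {a b : ℝ≥0} (h : a < b) : ∃ u : ℚ≥0, a < u ∧ (u : ℝ≥0) < b := by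
  obtain ⟨q, h1, h2⟩ := exists_rat_btwn (NNReal.coe_lt_coe.2 h)
  have hq : 0 ≤ q := by
    have : (0 : ℝ) < q := lt_of_le_of_lt a.2 h1
    exact_mod_cast this.le
  refine ⟨⟨q, hq⟩, ?_, ?_⟩
  · rw [← NNReal.coe_lt_coe]
    exact h1
  · rw [← NNReal.coe_lt_coe]
    exact h2

/-- Right-continuity makes the infimum attained, and monotonicity allows it to run over rational
instants only, which keeps passage times measurable. -/
lemma IsCountingPath.passageTime_le_iff {c : ℝ≥0 → ℕ} (hc : IsCountingPath c) (k : ℕ) (s : ℝ≥0) :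
    passageTime c k ≤ s ↔ k < c s := by
  constructor
  · intro h
    by_contra hk
    have h1 : ∀ᶠ r in 𝓝[≥] s, c r = c s := by
      have := hc.rightCts s
      rw [ContinuousWithinAt, nhds_discrete, tendsto_pure] at this
      exact this
    -- A right-continuous function with values in a discrete space is constant on some `[s, b)`.
    obtain ⟨b, hb, hbs⟩ := (mem_nhdsGE_iff_exists_Ico_subset' (lt_add_one s)).1 h1
    have h2 : (b : ℝ≥0∞) ≤ passageTime c k := by
      refine le_iInf fun u => ?_
      split_ifs with hu
      · rw [ENNReal.coe_le_coe]
        by_contra hub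
        have hsu : s < u := by
          by_contra h'
          exact hk (hu.trans_le (hc.mono (not_lt.1 h')))
        have : c u = c s := hbs ⟨hsu.le, not_le.1 hub⟩
        exact hk (this ▸ hu)
      · exact le_top
    exact absurd (h2.trans h) (not_le.2 (ENNReal.coe_lt_coe.2 hb))
  · intro h
    refine le_of_forall_gt_imp_ge_of_dense fun b hb => ?_
    obtain ⟨r, hr, hrb⟩ := ENNReal.lt_iff_exists_nnreal_btwn.1 hb
    obtain ⟨u, hu, hur⟩ := exists_nnrat_btwn (ENNReal.coe_lt_coe.1 hr)
    refine le_trans (iInf_le _ u) ?_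
    rw [if_pos (h.trans_le (hc.mono hu.le))]
    exact (ENNReal.coe_le_coe.2 hur.le).trans hrb.le

/-- The case `p = 0` is covered because passage times are nonzero (`c 0 = 0`) and a nonzero number
divided by `0` is `∞`: an object of popularity zero is never requested. -/
lemma IsCountingPath.passageTime_div_le_iff {c : ℝ≥0 → ℕ} (hc : IsCountingPath c) (p : ℝ≥0)
    (k : ℕ) (s : ℝ≥0) : passageTime c k / p ≤ s ↔ k < c (p * s) := by
  rcases eq_or_ne p 0 with rfl | hp
  · have : passageTime c k ≠ 0 := by
      intro h
      have := (hc.passageTime_le_iff k 0).1 (by simp [h])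
      rw [hc.zero] at this
      omega
    simp [ENNReal.div_zero this, hc.zero]
  · rw [ENNReal.div_le_iff (by simpa using hp) (by simp), ← hc.passageTime_le_iff, mul_comm]
    simp

/-- The request instants if object `i` is requested at the positive finite instants among the
`σ i k`. -/
def timesOf {n : ℕ} (σ : Fin n → ℕ → ℝ≥0∞) (i : Fin n) : Set ℝ≥0 :=
  {s | 0 < s ∧ ∃ k, σ i k = s}

lemma IsCountingPath.jumpTimes_eq {c : ℝ≥0 → ℕ} (hc : IsCountingPath c) (p : ℝ≥0) :
    jumpTimes (fun s => c (p * s)) = {s : ℝ≥0 | 0 < s ∧ ∃ k, passageTime c k / p = s} := by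
  have hm : Monotone fun s => c (p * s) := fun a b hab => hc.mono (by gcongr)
  ext s
  refine and_congr_right fun hs => ⟨fun h => ?_, ?_⟩
  · have h0 : c (p * 0) < c (p * s) := h 0 hs
    have h3 : c (p * s) - 1 < c (p * s) := by omega
    -- A jump at `s` is the first passage above the level one below the value reached; jumps may be
    -- larger than one, and then several levels are passed together.
    refine ⟨c (p * s) - 1, le_antisymm ((hc.passageTime_div_le_iff p _ s).2 h3) ?_⟩
    by_contra hlt
    obtain ⟨r, hr, hrs⟩ := ENNReal.lt_iff_exists_nnreal_btwn.1 (not_le.1 hlt)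
    have h1 := (hc.passageTime_div_le_iff p _ r).1 hr.le
    have h2 : c (p * r) < c (p * s) := h r (ENNReal.coe_lt_coe.1 hrs)
    omega
  · rintro ⟨k, hk⟩ r hr
    have h1 := (hc.passageTime_div_le_iff p k s).1 hk.le
    have h2 : ¬ k < c (p * r) := by
      rw [← hc.passageTime_div_le_iff p k r, hk, not_le]
      exact ENNReal.coe_lt_coe.2 hr
    exact (not_lt.1 h2).trans_lt h1

/-- If the counting process increases on `(a, b]`, there is a first request after `a`. -/
lemma IsCountingPath.exists_first_jumpTime {c : ℝ≥0 → ℕ} (hc : IsCountingPath c) {p a b : ℝ≥0}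
    (h : c (p * a) < c (p * b)) : ∃ s ∈ jumpTimes (fun s => c (p * s)), a < s ∧ s ≤ b ∧
      ∀ r ∈ jumpTimes (fun s => c (p * s)), a < r → s ≤ r := by
  have h1 := (hc.passageTime_div_le_iff p _ b).2 h
  have h2 : ¬ passageTime c (c (p * a)) / p ≤ a := by
    rw [hc.passageTime_div_le_iff]
    exact lt_irrefl _
  have h3 : ∀ r ∈ jumpTimes (fun s => c (p * s)), a < r →
      passageTime c (c (p * a)) / p ≤ (r : ℝ≥0∞) :=
    fun r hr har => (hc.passageTime_div_le_iff p _ r).2 (hr.2 a har)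
  obtain ⟨s, hs⟩ : ∃ s : ℝ≥0, (s : ℝ≥0∞) = passageTime c (c (p * a)) / p :=
    ⟨_, ENNReal.coe_toNNReal (h1.trans_lt ENNReal.coe_lt_top).ne⟩
  rw [← hs] at h1 h2 h3
  have has : a < s := by simpa using h2
  refine ⟨s, ?_, has, by simpa using h1, fun r hr har => by simpa using h3 r hr har⟩
  rw [hc.jumpTimes_eq]
  exact ⟨bot_le.trans_lt has, _, hs.symm⟩

/-- There is a request in `(a, b]` iff the counting process increases. -/
lemma IsCountingPath.exists_mem_jumpTimes_iff {c : ℝ≥0 → ℕ} (hc : IsCountingPath c) (p a b : ℝ≥0) :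
    (∃ s ∈ jumpTimes (fun s => c (p * s)), a < s ∧ s ≤ b) ↔ c (p * a) < c (p * b) := by
  constructor
  · rintro ⟨s, hs, has, hsb⟩
    exact (hs.2 a has).trans_le (hc.mono (by gcongr))
  · intro h
    obtain ⟨s, hs, has, hsb, -⟩ := hc.exists_first_jumpTime h
    exact ⟨s, hs, has, hsb⟩

/-- A jump before `t` is the passage time of one of the finitely many levels below `c (p * t)`. -/
lemma IsCountingPath.finite_jumpTimes {c : ℝ≥0 → ℕ} (hc : IsCountingPath c) (p t : ℝ≥0) :
    {s ∈ jumpTimes (fun s => c (p * s)) | s < t}.Finite := by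
  refine ((Set.finite_Iio (c (p * t))).image fun k => (passageTime c k / p).toNNReal).subset ?_
  rintro s ⟨hs, hst⟩
  rw [hc.jumpTimes_eq] at hs
  obtain ⟨-, k, hk⟩ := hs
  refine ⟨k, ?_, by simp [hk]⟩
  rw [Set.mem_Iio, ← hc.passageTime_div_le_iff, hk]
  exact ENNReal.coe_le_coe.2 hst.le

/-! ### Measurability of the search-cost. -/

section Requests

variable {n : ℕ} {c : Fin n → ℝ≥0 → ℕ}

/-- The request instants belonging to the popularities `p` and to the counting paths `c`. -/
def pathTimes (p : Fin n → ℝ≥0) (c : Fin n → ℝ≥0 → ℕ) (i : Fin n) : Set ℝ≥0 :=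
  jumpTimes (fun s => c i (p i * s))

lemma finite_requestsBefore_pathTimes (hc : ∀ i, IsCountingPath (c i)) (p : Fin n → ℝ≥0) (t : ℝ≥0) :
    (requestsBefore (pathTimes p c) t).Finite := by
  have : requestsBefore (pathTimes p c) t ⊆
      ⋃ i, (fun s => toLex (s, i)) '' {s ∈ jumpTimes (fun s => c i (p i * s)) | s < t} := by
    rintro q ⟨h1, h2⟩
    exact Set.mem_iUnion.2 ⟨(ofLex q).2, (ofLex q).1, ⟨h1, h2⟩, rfl⟩
  exact (Set.finite_iUnion fun i => ((hc i).finite_jumpTimes (p i) t).image _).subset this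

lemma pathTimes_eq_timesOf (hc : ∀ i, IsCountingPath (c i)) (p : Fin n → ℝ≥0) :
    pathTimes p c = timesOf fun i k => passageTime (c i) k / p i := by
  ext i s
  rw [pathTimes, (hc i).jumpTimes_eq]
  rfl

/-- Turns a quantifier over real instants into one over the countable index `k`, so that
measurability becomes automatic. -/
lemma exists_mem_timesOf_iff (σ : Fin n → ℕ → ℝ≥0∞) (i : Fin n) (Φ : ℝ≥0 → Prop) :
    (∃ s ∈ timesOf σ i, Φ s) ↔ ∃ k, (0 < σ i k ∧ σ i k < ∞) ∧ Φ (σ i k).toNNReal := by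
  constructor
  · rintro ⟨s, ⟨hs, k, hk⟩, h⟩
    exact ⟨k, ⟨by rw [hk]; exact_mod_cast hs, by rw [hk]; exact ENNReal.coe_lt_top⟩, by simpa [hk]⟩
  · rintro ⟨k, ⟨h0, h1⟩, h⟩
    exact ⟨_, ⟨ENNReal.toNNReal_pos h0.ne' h1.ne, k, (ENNReal.coe_toNNReal h1.ne).symm⟩, h⟩

lemma forall_mem_timesOf_iff (σ : Fin n → ℕ → ℝ≥0∞) (i : Fin n) (Φ : ℝ≥0 → Prop) :
    (∀ s ∈ timesOf σ i, Φ s) ↔ ∀ k, (0 < σ i k ∧ σ i k < ∞) → Φ (σ i k).toNNReal := by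
  have := not_congr (exists_mem_timesOf_iff σ i (fun s => ¬ Φ s))
  simpa only [not_exists, not_and, not_not] using this

lemma measurable_valid (i : Fin n) (k : ℕ) :
    Measurable fun σ : Fin n → ℕ → ℝ≥0∞ => 0 < σ i k ∧ σ i k < ∞ := by
  have : Measurable fun σ : Fin n → ℕ → ℝ≥0∞ => σ i k := by fun_prop
  exact (measurableSet_setOfPred.1 (measurableSet_lt measurable_const this)).and
    (measurableSet_setOfPred.1 (measurableSet_lt this measurable_const))

lemma measurable_toNNReal_apply (i : Fin n) (k : ℕ) :
    Measurable fun σ : Fin n → ℕ → ℝ≥0∞ => (σ i k).toNNReal := by fun_prop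

lemma measurable_isNextRequested (t : ℝ≥0) (i : Fin n) :
    Measurable fun σ : Fin n → ℕ → ℝ≥0∞ => IsNextRequested (timesOf σ) t i := by
  simp only [IsNextRequested, exists_mem_timesOf_iff, forall_mem_timesOf_iff]
  refine Measurable.exists fun k => (measurable_valid i k).and (Measurable.and ?_ ?_)
  · exact measurableSet_setOfPred.1 (measurableSet_le measurable_const (measurable_toNNReal_apply i k))
  · refine Measurable.forall fun j => Measurable.forall fun l => (measurable_valid j l).imp
      (Measurable.imp ?_ ?_)
    · exact measurableSet_setOfPred.1
        (measurableSet_le measurable_const (measurable_toNNReal_apply j l))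
    · exact measurableSet_setOfPred.1
        (measurableSet_le (measurable_toNNReal_apply i k) (measurable_toNNReal_apply j l))

lemma measurable_mem_requestedBefore (t : ℝ≥0) (i : Fin n) :
    Measurable fun σ : Fin n → ℕ → ℝ≥0∞ => i ∈ requestedBefore (timesOf σ) t := by
  simp only [requestedBefore, Set.mem_ofPred_eq, exists_mem_timesOf_iff]
  refine Measurable.exists fun k => (measurable_valid i k).and ?_
  exact measurableSet_setOfPred.1 (measurableSet_lt (measurable_toNNReal_apply i k) measurable_const)

lemma measurable_isAhead (t : ℝ≥0) (j i : Fin n) :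
    Measurable fun σ : Fin n → ℕ → ℝ≥0∞ => IsAhead (timesOf σ) t j i := by
  simp only [IsAhead, exists_mem_timesOf_iff, forall_mem_timesOf_iff]
  refine Measurable.or ?_ ((measurable_mem_requestedBefore t j).not.and
    ((measurable_mem_requestedBefore t i).not.and measurable_const))
  refine Measurable.exists fun k => (measurable_valid j k).and (Measurable.and ?_ ?_)
  · exact measurableSet_setOfPred.1 (measurableSet_lt (measurable_toNNReal_apply j k) measurable_const)
  · refine Measurable.forall fun l => (measurable_valid i l).imp (Measurable.imp ?_ ?_)
    · exact measurableSet_setOfPred.1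
        (measurableSet_lt (measurable_toNNReal_apply i l) measurable_const)
    · simp only [Prod.Lex.toLex_lt_toLex]
      refine Measurable.or ?_ (Measurable.and ?_ measurable_const)
      · exact measurableSet_setOfPred.1
          (measurableSet_lt (measurable_toNNReal_apply i l) (measurable_toNNReal_apply j k))
      · exact measurableSet_setOfPred.1
          (measurableSet_eq_fun (measurable_toNNReal_apply i l) (measurable_toNNReal_apply j k))

open Classical in
/-- The search-cost as a measurable function of the request instants. -/
noncomputable def costOf (t : ℝ≥0) (σ : Fin n → ℕ → ℝ≥0∞) : ℕ :=
  ∑ i, if IsNextRequested (timesOf σ) t i then (∑ j, if IsAhead (timesOf σ) t j i then 1 else 0) + 1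
    else 0

lemma measurable_costOf (t : ℝ≥0) : Measurable (costOf (n := n) t) := by
  classical
  refine Finset.measurable_sum _ fun i _ => Measurable.ite
    (measurableSet_setOfPred.2 (measurable_isNextRequested t i)) (Measurable.add_const ?_ _)
    measurable_const
  exact Finset.measurable_sum _ fun j _ => Measurable.ite
    (measurableSet_setOfPred.2 (measurable_isAhead t j i)) measurable_const measurable_const

lemma searchCost_pathTimes (hc : ∀ i, IsCountingPath (c i)) (p : Fin n → ℝ≥0) (t : ℝ≥0) :
    searchCost 1 (pathTimes p c) t = costOf t fun i k => passageTime (c i) k / p i := by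
  classical
  have hfin := finite_requestsBefore_pathTimes hc p t
  unfold searchCost costOf
  rw [← pathTimes_eq_timesOf hc]
  refine Finset.sum_congr rfl fun i _ => ?_
  rw [position_eq_card hfin, Finset.card_filter]

lemma measurable_exists_out (t : ℝ≥0) : Measurable fun σ : Fin n → ℕ → ℝ≥0∞ =>
    ∃ i, IsNextRequested (timesOf σ) t i ∧ i ∉ requestedBefore (timesOf σ) t :=
  Measurable.exists fun i => (measurable_isNextRequested t i).and
    (measurable_mem_requestedBefore t i).not

end Requests

/-! ### Conditioning on the weights -/

section Model

variable {Ω : Type*} [MeasurableSpace Ω] {Pr : Measure Ω} {n : ℕ}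
  {w : Ω → Fin n → ℝ≥0} {N : Fin n → ℝ≥0 → Ω → ℕ}

lemma IsStandardPoissonProcess.isCountingPath {N : ℝ≥0 → Ω → ℕ}
    (h : IsStandardPoissonProcess N Pr) : ∀ᵐ ω ∂Pr, IsCountingPath fun s => N s ω := by
  filter_upwards [h.paths] with ω hω
  exact ⟨hω.1, hω.2.1, hω.2.2⟩

lemma IsRequestModel.isCountingPath (h : IsRequestModel w N Pr) :
    ∀ᵐ ω ∂Pr, ∀ i, IsCountingPath fun s => N i s ω :=
  ae_all_iff.2 fun i => (h.poisson i).isCountingPath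

/-- The passage times of the standard Poisson processes. -/
noncomputable def passageTimes (N : Fin n → ℝ≥0 → Ω → ℕ) (ω : Ω) : Fin n → ℕ → ℝ≥0∞ :=
  fun i k => passageTime (fun s => N i s ω) k

/-- The passage times in the time scale of the popularities. -/
noncomputable def scaledTimes (x : (Fin n → ℝ≥0) × (Fin n → ℕ → ℝ≥0∞)) : Fin n → ℕ → ℝ≥0∞ :=
  fun i k => x.2 i k / popularity x.1 i

lemma measurable_scaledTimes : Measurable (scaledTimes (n := n)) := by
  refine measurable_pi_lambda _ fun i => measurable_pi_lambda _ fun k => ?_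
  have h1 : Measurable fun x : (Fin n → ℝ≥0) × (Fin n → ℕ → ℝ≥0∞) => popularity x.1 i := by
    unfold popularity
    fun_prop
  have h2 : Measurable fun x : (Fin n → ℝ≥0) × (Fin n → ℕ → ℝ≥0∞) => x.2 i k := by fun_prop
  exact h2.div h1.coe_nnreal_ennreal

lemma IsRequestModel.measurable_passageTimes (h : IsRequestModel w N Pr) :
    Measurable (passageTimes N) := by
  refine measurable_pi_lambda _ fun i => measurable_pi_lambda _ fun k => ?_
  exact (measurable_passageTime k).comp (measurable_pi_lambda _ fun s => (h.poisson i).measurable s)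

lemma IsRequestModel.indepFun_passageTimes (h : IsRequestModel w N Pr) :
    IndepFun w (passageTimes N) Pr := by
  refine h.indep_weights.comp (φ := id)
    (ψ := fun (c : Fin n → ℝ≥0 → ℕ) i k => passageTime (c i) k) measurable_id ?_
  refine measurable_pi_lambda _ fun i => measurable_pi_lambda _ fun k => ?_
  exact (measurable_passageTime k).comp (measurable_pi_apply i)

/-- The probability that the request instants belong to `D`, if the weights are `v`. -/
noncomputable def condProb (Pr : Measure Ω) (N : Fin n → ℝ≥0 → Ω → ℕ) (D : Set (Fin n → ℕ → ℝ≥0∞))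
    (v : Fin n → ℝ≥0) : ℝ≥0∞ :=
  Pr {ω | scaledTimes (v, passageTimes N ω) ∈ D}

lemma IsRequestModel.measurable_condProb [IsProbabilityMeasure Pr] (h : IsRequestModel w N Pr)
    {D : Set (Fin n → ℕ → ℝ≥0∞)} (hD : MeasurableSet D) : Measurable (condProb Pr N D) := by
  have hm := h.measurable_passageTimes
  have : IsProbabilityMeasure (Pr.map (passageTimes N)) :=
    Measure.isProbabilityMeasure_map hm.aemeasurable
  have h1 := measurable_measure_prodMk_left (ν := Pr.map (passageTimes N))
    (measurable_scaledTimes hD)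
  convert h1 using 2 with v
  rw [Measure.map_apply hm (measurable_prodMk_left (measurable_scaledTimes hD))]
  rfl

/-- Fubini for the product law of the weights and the independent passage times: conditioning on the
weights means freezing them. -/
lemma IsRequestModel.measure_scaledTimes_mem [IsProbabilityMeasure Pr] (h : IsRequestModel w N Pr)
    {D : Set (Fin n → ℕ → ℝ≥0∞)} (hD : MeasurableSet D) :
    Pr {ω | scaledTimes (w ω, passageTimes N ω) ∈ D} = ∫⁻ ω, condProb Pr N D (w ω) ∂Pr := by
  have hm := h.measurable_passageTimes
  have hw := h.measurable_weights
  have : IsProbabilityMeasure (Pr.map (passageTimes N)) :=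
    Measure.isProbabilityMeasure_map hm.aemeasurable
  have h2 := (indepFun_iff_map_prod_eq_prod_map_map hw.aemeasurable hm.aemeasurable).1
    h.indepFun_passageTimes
  have h3 : Pr {ω | scaledTimes (w ω, passageTimes N ω) ∈ D} =
      (Pr.map fun ω => (w ω, passageTimes N ω)) (scaledTimes ⁻¹' D) := by
    rw [Measure.map_apply (hw.prodMk hm) (measurable_scaledTimes hD)]
    rfl
  rw [h3, h2, Measure.prod_apply (measurable_scaledTimes hD), lintegral_map
    (measurable_measure_prodMk_left (measurable_scaledTimes hD)) hw]
  refine lintegral_congr fun ω => ?_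
  rw [Measure.map_apply hm (measurable_prodMk_left (measurable_scaledTimes hD))]
  rfl

lemma IsRequestModel.requestTimes_ae_eq (h : IsRequestModel w N Pr) :
    ∀ᵐ ω ∂Pr, requestTimes w N ω = timesOf (scaledTimes (w ω, passageTimes N ω)) ∧
      ∀ t, searchCost 1 (requestTimes w N ω) t = costOf t (scaledTimes (w ω, passageTimes N ω)) := by
  filter_upwards [h.isCountingPath] with ω hω
  exact ⟨pathTimes_eq_timesOf hω _, fun t => searchCost_pathTimes hω _ t⟩

lemma IsRequestModel.aemeasurable_searchCost (h : IsRequestModel w N Pr) (t : ℝ≥0) :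
    AEMeasurable (fun ω => searchCost 1 (requestTimes w N ω) t) Pr := by
  refine ⟨fun ω => costOf t (scaledTimes (w ω, passageTimes N ω)), ?_, ?_⟩
  · exact (measurable_costOf t).comp (measurable_scaledTimes.comp
      (h.measurable_weights.prodMk h.measurable_passageTimes))
  · filter_upwards [h.requestTimes_ae_eq] with ω hω using hω.2 t

end Model

/-! ### Deterministic weights -/

section Poisson

variable {Ω : Type*} [MeasurableSpace Ω] {Pr : Measure Ω}

lemma IsStandardPoissonProcess.measureReal_eq {N : ℝ≥0 → Ω → ℕ}
    (h : IsStandardPoissonProcess N Pr) {s t : ℝ≥0} (hst : s ≤ t) :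
    Pr.real {ω | N s ω = N t ω} = Real.exp (-((t : ℝ) - s)) := by
  -- The truncated difference vanishes exactly on equality only because the paths are monotone.
  have h1 : {ω | N s ω = N t ω} =ᵐ[Pr] (fun ω => N t ω - N s ω) ⁻¹' {0} := by
    filter_upwards [h.isCountingPath] with ω hω
    have : N s ω ≤ N t ω := hω.mono hst
    refine propext ⟨fun h => ?_, fun h => ?_⟩
    · change N s ω = N t ω at h
      change N t ω - N s ω = 0
      omega
    · change N t ω - N s ω = 0 at h
      change N s ω = N t ω
      omega
  have h2 := h.increments_law s t hst
  rw [measureReal_congr h1, ← map_measureReal_apply_of_aemeasurable h2.aemeasurable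
    (measurableSet_singleton 0), h2.map_eq, poissonMeasure_real_singleton]
  simp [NNReal.coe_sub hst]

variable {n : ℕ} {N : Fin n → ℝ≥0 → Ω → ℕ} {p : Fin n → ℝ≥0}

/-- Object `i` is not requested in the time interval `(a, b]`. -/
def quiet (N : Fin n → ℝ≥0 → Ω → ℕ) (p : Fin n → ℝ≥0) (i : Fin n) (a b : ℝ≥0) : Set Ω :=
  {ω | N i (p i * a) ω = N i (p i * b) ω}

lemma measureReal_quiet (hN : ∀ i, IsStandardPoissonProcess (N i) Pr) (i : Fin n) {a b : ℝ≥0}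
    (hab : a ≤ b) : Pr.real (quiet N p i a b) = Real.exp (-(p i * ((b : ℝ) - a))) := by
  have h : p i * a ≤ p i * b := by gcongr
  rw [quiet, (hN i).measureReal_eq h]
  congr 1
  push_cast
  ring

/-- Measurability with respect to the σ-algebra generated by the single process `N i`, as needed to
multiply probabilities over independent objects. -/
lemma comap_measurableSet_quiet {Ω : Type*} {n : ℕ} (N : Fin n → ℝ≥0 → Ω → ℕ) (p : Fin n → ℝ≥0)
    (i : Fin n) (a b : ℝ≥0) :
    MeasurableSet[MeasurableSpace.comap (fun ω s => N i s ω) MeasurableSpace.pi]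
      (quiet N p i a b) :=
  ⟨{c | c (p i * a) = c (p i * b)},
    measurableSet_eq_fun (measurable_pi_apply _) (measurable_pi_apply _), rfl⟩

lemma measurableSet_quiet (hN : ∀ i, IsStandardPoissonProcess (N i) Pr) (i : Fin n) (a b : ℝ≥0) :
    MeasurableSet (quiet N p i a b) :=
  measurableSet_eq_fun ((hN i).measurable _) ((hN i).measurable _)

lemma isCountingPath_ae (hN : ∀ i, IsStandardPoissonProcess (N i) Pr) :
    ∀ᵐ ω ∂Pr, ∀ i, IsCountingPath fun s => N i s ω :=
  ae_all_iff.2 fun i => (hN i).isCountingPath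

/-- In a time grid with mesh `δ` starting in `T`, object `i` is the only one to be requested until
the end of the `k`-th cell, and this happens in the `k`-th cell only; moreover `i` is not requested
in `(a, T]`. -/
def cell (N : Fin n → ℝ≥0 → Ω → ℕ) (p : Fin n → ℝ≥0) (T δ a : ℝ≥0) (i : Fin n) (k : ℕ) : Set Ω :=
  ⋂ j, if j = i then quiet N p i a (T + k * δ) \ quiet N p i a (T + (k + 1) * δ)
    else quiet N p j T (T + (k + 1) * δ)

lemma measurableSet_cell (hN : ∀ i, IsStandardPoissonProcess (N i) Pr) (T δ a : ℝ≥0) (i : Fin n)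
    (k : ℕ) : MeasurableSet (cell N p T δ a i k) := by
  refine MeasurableSet.iInter fun j => ?_
  split_ifs
  · exact (measurableSet_quiet hN _ _ _).diff (measurableSet_quiet hN _ _ _)
  · exact measurableSet_quiet hN _ _ _

variable [IsProbabilityMeasure Pr]

/-- Almost surely there is no request at a fixed instant. -/
lemma notMem_pathTimes_ae (hN : ∀ i, IsStandardPoissonProcess (N i) Pr) (p : Fin n → ℝ≥0)
    (t : ℝ≥0) : ∀ᵐ ω ∂Pr, ∀ i, t ∉ pathTimes p (fun i s => N i s ω) i := by
  refine ae_all_iff.2 fun i => ?_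
  rcases eq_or_ne t 0 with rfl | ht
  · exact Filter.Eventually.of_forall fun ω h => lt_irrefl _ h.1
  -- A jump at `t` forces an increase on `(r, t]` for each `r < t`; the probability of such an
  -- increase vanishes as `r` tends to `t`.
  have h1 : ∀ r < t, Pr.real {ω | t ∈ pathTimes p (fun i s => N i s ω) i} ≤
      1 - Real.exp (-(p i * ((t : ℝ) - r))) := by
    intro r hr
    rw [← measureReal_quiet hN i hr.le, ← probReal_compl_eq_one_sub (measurableSet_quiet hN i r t)]
    exact measureReal_mono fun ω hω => (hω.2 r hr).ne
  have h2 : Tendsto (fun r : ℝ≥0 => 1 - Real.exp (-(p i * ((t : ℝ) - r)))) (𝓝[<] t) (𝓝 0) := by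
    have : Continuous fun r : ℝ≥0 => 1 - Real.exp (-(p i * ((t : ℝ) - r))) := by fun_prop
    have h := this.tendsto t
    simp only [sub_self, mul_zero, neg_zero, Real.exp_zero] at h
    exact h.mono_left nhdsWithin_le_nhds
  have : (𝓝[<] t).NeBot := nhdsLT_neBot_of_exists_lt ⟨0, pos_iff_ne_zero.2 ht⟩
  have h3 := ge_of_tendsto h2 (eventually_nhdsWithin_of_forall h1)
  rw [ae_iff]
  simp only [not_not]
  exact (measureReal_eq_zero_iff).1 (le_antisymm h3 measureReal_nonneg)

/-- By independence the factor for `i` is a difference of two exponentials. The other objects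
contribute `e^{-(1 - p i)(k + 1)δ}` because the popularities add up to `1`, and the powers of `e^{p
i δ}` combine so that only `e^{-δ}` depends on `k`. -/
lemma measureReal_cell (hN : ∀ i, IsStandardPoissonProcess (N i) Pr)
    (hind : iIndepFun (fun i ω s => N i s ω) Pr) (hp : ∑ i, p i = 1) {T δ a : ℝ≥0} (ha : a ≤ T)
    (i : Fin n) (k : ℕ) : Pr.real (cell N p T δ a i k) =
      Real.exp (-(p i * ((T : ℝ) - a))) * (Real.exp (p i * δ) - 1) * Real.exp (-δ) ^ (k + 1) := by
  have h1 : Pr (cell N p T δ a i k) = ∏ j, Pr (if j = i then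
      quiet N p i a (T + k * δ) \ quiet N p i a (T + (k + 1) * δ)
      else quiet N p j T (T + (k + 1) * δ)) := by
    refine hind.meas_iInter fun j => ?_
    split_ifs with h
    · subst h
      exact (comap_measurableSet_quiet N p j _ _).diff (comap_measurableSet_quiet N p j _ _)
    · exact comap_measurableSet_quiet N p j _ _
  have h2 : Pr.real (quiet N p i a (T + k * δ) \ quiet N p i a (T + (k + 1) * δ)) =
      Real.exp (-(p i * ((T : ℝ) + k * δ - a))) - Real.exp (-(p i * ((T : ℝ) + (k + 1) * δ - a))) := by
    have hak : a ≤ T + k * δ := ha.trans le_self_add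
    have hkk : T + k * δ ≤ T + (k + 1) * δ := by gcongr; exact le_self_add
    rw [measureReal_sdiff' (measurableSet_quiet hN _ _ _) (measure_ne_top _ _) (measure_ne_top _ _)]
    have : (quiet N p i a (T + k * δ) ∪ quiet N p i a (T + (k + 1) * δ) : Set Ω) =ᵐ[Pr]
        quiet N p i a (T + k * δ) := by
      filter_upwards [isCountingPath_ae hN] with ω hω
      refine propext ⟨fun h => ?_, Or.inl⟩
      rcases h with h | h
      · exact h
      · have h3 : N i (p i * a) ω ≤ N i (p i * (T + k * δ)) ω := (hω i).mono (by gcongr)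
        have h4 : N i (p i * (T + k * δ)) ω ≤ N i (p i * (T + (k + 1) * δ)) ω :=
          (hω i).mono (by gcongr)
        have h5 : N i (p i * a) ω = N i (p i * (T + (k + 1) * δ)) ω := h
        change N i (p i * a) ω = N i (p i * (T + k * δ)) ω
        omega
    rw [measureReal_congr this, measureReal_quiet hN i hak, measureReal_quiet hN i (hak.trans hkk)]
    push_cast
    rfl
  have h3 : ∏ j ∈ Finset.univ.erase i, Pr.real (quiet N p j T (T + (k + 1) * δ)) =
      Real.exp (-((1 - p i) * ((k + 1) * δ))) := by
    have : ∀ j, Pr.real (quiet N p j T (T + (k + 1) * δ)) = Real.exp (-(p j * ((k + 1) * δ))) := by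
      intro j
      rw [measureReal_quiet hN j le_self_add]
      push_cast
      congr 1
      ring
    rw [Finset.prod_congr rfl fun j _ => this j, ← Real.exp_sum]
    congr 1
    rw [Finset.sum_neg_distrib, ← Finset.sum_mul]
    have h4 : ∑ j ∈ Finset.univ.erase i, (p j : ℝ) = 1 - p i := by
      rw [eq_sub_iff_add_eq, Finset.sum_erase_add _ _ (Finset.mem_univ i)]
      exact_mod_cast hp
    rw [h4]
  rw [measureReal_def, h1, ENNReal.toReal_prod, ← Finset.mul_prod_erase _ _ (Finset.mem_univ i),
    if_pos rfl]
  have h5 : ∏ x ∈ Finset.univ.erase i, (Pr (if x = i then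
      quiet N p i a (T + k * δ) \ quiet N p i a (T + (k + 1) * δ)
      else quiet N p x T (T + (k + 1) * δ))).toReal =
      ∏ j ∈ Finset.univ.erase i, Pr.real (quiet N p j T (T + (k + 1) * δ)) := by
    refine Finset.prod_congr rfl fun j hj => ?_
    rw [if_neg (Finset.ne_of_mem_erase hj)]
    rfl
  have h6 : ∀ x y z : ℝ, Real.exp x * (Real.exp y - 1) * Real.exp z =
      Real.exp (x + y + z) - Real.exp (x + z) := by
    intro x y z
    rw [Real.exp_add, Real.exp_add, Real.exp_add]
    ring
  rw [h5, h3, ← measureReal_def, h2, ← Real.exp_nat_mul, h6, sub_mul, ← Real.exp_add,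
    ← Real.exp_add]
  push_cast
  congr 2 <;> ring

/-- The union of the cells. -/
def cells (N : Fin n → ℝ≥0 → Ω → ℕ) (p : Fin n → ℝ≥0) (T δ a : ℝ≥0) (i : Fin n) : Set Ω :=
  ⋃ k, cell N p T δ a i k

/-- Cells with different `k` are almost surely disjoint, and their probabilities form a geometric
series with sum `e^{-δ} / (1 - e^{-δ}) = 1 / (e^δ - 1)`. -/
lemma measureReal_cells (hN : ∀ i, IsStandardPoissonProcess (N i) Pr)
    (hind : iIndepFun (fun i ω s => N i s ω) Pr) (hp : ∑ i, p i = 1) {T δ a : ℝ≥0} (ha : a ≤ T)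
    (hδ : 0 < δ) (i : Fin n) : Pr.real (cells N p T δ a i) =
      Real.exp (-(p i * ((T : ℝ) - a))) * ((Real.exp (p i * δ) - 1) / (Real.exp δ - 1)) := by
  have hδ' : (0 : ℝ) < δ := hδ
  have hdisj : Pairwise (Function.onFun (AEDisjoint Pr) fun k => cell N p T δ a i k) := by
    have key : ∀ k l, k < l → AEDisjoint Pr (cell N p T δ a i k) (cell N p T δ a i l) := by
      intro k l hkl
      refine measure_mono_null (t := {ω | ¬ ∀ i, IsCountingPath fun s => N i s ω}) ?_
        (ae_iff.1 (isCountingPath_ae hN))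
      rintro ω ⟨hk, hl⟩ hω
      have h1 := Set.mem_iInter.1 hk i
      have h2 := Set.mem_iInter.1 hl i
      rw [if_pos rfl] at h1 h2
      have h3 : N i (p i * a) ω = N i (p i * (T + l * δ)) ω := h2.1
      have h4 : ¬ N i (p i * a) ω = N i (p i * (T + (k + 1) * δ)) ω := h1.2
      have h5 : N i (p i * (T + (k + 1) * δ)) ω ≤ N i (p i * (T + l * δ)) ω := by
        refine (hω i).mono ?_
        gcongr
        exact_mod_cast hkl
      have h6 : N i (p i * a) ω ≤ N i (p i * (T + (k + 1) * δ)) ω :=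
        (hω i).mono (by gcongr; exact ha.trans le_self_add)
      omega
    intro k l hkl
    rcases lt_or_gt_of_ne hkl with h | h
    · exact key k l h
    · exact (key l k h).symm
  have hx : Real.exp (-δ) < 1 := by simpa using hδ'
  have hsum := ((hasSum_geometric_of_lt_one (Real.exp_pos (-(δ : ℝ))).le hx).mul_right
    (Real.exp (-(δ : ℝ)))).mul_left
    (Real.exp (-(p i * ((T : ℝ) - a))) * (Real.exp (p i * δ) - 1))
  simp only [← pow_succ] at hsum
  have h1 : Pr (cells N p T δ a i) = ∑' k, Pr (cell N p T δ a i k) :=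
    measure_iUnion₀ hdisj fun k => (measurableSet_cell hN T δ a i k).nullMeasurableSet
  rw [measureReal_def, h1, ENNReal.tsum_toReal_eq fun k => measure_ne_top _ _]
  simp only [← measureReal_def, measureReal_cell hN hind hp ha]
  rw [hsum.tsum_eq, mul_assoc]
  congr 1
  rw [div_eq_mul_inv]
  congr 1
  rw [Real.exp_neg]
  have : Real.exp δ - 1 ≠ 0 := by
    have := Real.add_one_lt_exp hδ'.ne'
    linarith
  have := Real.exp_pos (δ : ℝ)
  field_simp

end Poisson

/-! ### Grid cells and the first request after a given time. -/

section Paths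

variable {Ω : Type*} {n : ℕ} {N : Fin n → ℝ≥0 → Ω → ℕ} {p : Fin n → ℝ≥0}

/-- Up to the end of the cell only `i` makes requests, so its first request after `T` precedes those
of the others. Excluding a request at `T` itself reconciles `(T, ∞)` with `[T, ∞)`. -/
lemma isOnlyNextRequested_of_mem_cells {ω : Ω} (hω : ∀ i, IsCountingPath fun s => N i s ω)
    {T δ a : ℝ≥0} (ha : a ≤ T) (hT : ∀ i, T ∉ pathTimes p (fun i s => N i s ω) i) {i : Fin n}
    (hi : ω ∈ cells N p T δ a i) :
    IsOnlyNextRequested (pathTimes p fun i s => N i s ω) T i ∧ ω ∈ quiet N p i a T := by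
  obtain ⟨k, hk⟩ := Set.mem_iUnion.1 hi
  have hmi := Set.mem_iInter.1 hk i
  rw [if_pos rfl] at hmi
  have h1 : N i (p i * a) ω = N i (p i * (T + k * δ)) ω := hmi.1
  have h2 : ¬ N i (p i * a) ω = N i (p i * (T + (k + 1) * δ)) ω := hmi.2
  have h3 : N i (p i * a) ω ≤ N i (p i * T) ω := (hω i).mono (by gcongr)
  have h4 : N i (p i * T) ω ≤ N i (p i * (T + k * δ)) ω :=
    (hω i).mono (by gcongr; exact le_self_add)
  have h5 : N i (p i * T) ω ≤ N i (p i * (T + (k + 1) * δ)) ω :=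
    (hω i).mono (by gcongr; exact le_self_add)
  have h6 : N i (p i * T) ω < N i (p i * (T + (k + 1) * δ)) ω := by omega
  obtain ⟨s, hs, hTs, hsb, hfirst⟩ := (hω i).exists_first_jumpTime h6
  have hlt : ∀ j, ∀ r ∈ pathTimes p (fun i s => N i s ω) j, T ≤ r → T < r :=
    fun j r hr hTr => lt_of_le_of_ne hTr fun h => hT j (h ▸ hr)
  have hother : ∀ j, j ≠ i → ∀ r ∈ pathTimes p (fun i s => N i s ω) j, T ≤ r → s < r := by
    intro j hj r hr hTr
    have hmj := Set.mem_iInter.1 hk j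
    rw [if_neg hj] at hmj
    have h7 : N j (p j * T) ω = N j (p j * (T + (k + 1) * δ)) ω := hmj
    refine hsb.trans_lt (not_le.1 fun hrb => ?_)
    exact ((hω j).exists_mem_jumpTimes_iff (p j) T (T + (k + 1) * δ)).1
      ⟨r, hr, hlt j r hr hTr, hrb⟩ |>.ne h7
  have hle : ∀ j, ∀ r ∈ pathTimes p (fun i s => N i s ω) j, T ≤ r → s ≤ r := by
    intro j r hr hTr
    by_cases hj : j = i
    · subst hj
      exact hfirst r hr (hlt j r hr hTr)
    · exact (hother j hj r hr hTr).le
  refine ⟨⟨⟨s, hs, hTs.le, hle⟩, ?_⟩, h3.antisymm (h4.trans h1.ge)⟩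
  rintro j ⟨r, hr, hTr, hmin⟩
  by_contra hj
  exact absurd (hmin i s hs hTs.le) (not_le.2 (hother j hj r hr hTr))

/-- Quietness refers to `(a, T]` and being requested to `[a, T)`; they are complementary once no
request falls on `a` or `T`. -/
lemma mem_quiet_iff {ω : Ω} (hω : ∀ i, IsCountingPath fun s => N i s ω) {T a : ℝ≥0}
    (ha : a ≤ T) (hT : ∀ i, T ∉ pathTimes p (fun i s => N i s ω) i)
    (hta : ∀ i, a ∉ pathTimes p (fun i s => N i s ω) i) (i : Fin n) :
    ω ∈ quiet N p i a T ↔ i ∉ requestedIn (pathTimes p fun i s => N i s ω) a T := by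
  have h1 : N i (p i * a) ω ≤ N i (p i * T) ω := (hω i).mono (by gcongr)
  have h2 : i ∈ requestedIn (pathTimes p fun i s => N i s ω) a T ↔
      N i (p i * a) ω < N i (p i * T) ω := by
    rw [← (hω i).exists_mem_jumpTimes_iff (p i) a T]
    constructor
    · rintro ⟨s, hs, has, hst⟩
      exact ⟨s, hs, lt_of_le_of_ne has fun h => hta i (h ▸ hs), hst.le⟩
    · rintro ⟨s, hs, has, hst⟩
      exact ⟨s, hs, has.le, lt_of_le_of_ne hst fun h => hT i (h ▸ hs)⟩
  rw [h2, not_lt]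
  exact ⟨fun h => h.ge, fun h => h1.antisymm h⟩

lemma mem_cells_of_mem_quiet {ω : Ω} {T δ a : ℝ≥0} {i : Fin n} (hi : ω ∈ cells N p T δ T i) (hq : ω ∈ quiet N p i a T) :
    ω ∈ cells N p T δ a i := by
  obtain ⟨k, hk⟩ := Set.mem_iUnion.1 hi
  refine Set.mem_iUnion.2 ⟨k, Set.mem_iInter.2 fun j => ?_⟩
  have h := Set.mem_iInter.1 hk j
  split_ifs at h ⊢ with hj
  · have h1 : N i (p i * T) ω = N i (p i * (T + k * δ)) ω := h.1
    have h2 : ¬ N i (p i * T) ω = N i (p i * (T + (k + 1) * δ)) ω := h.2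
    have h3 : N i (p i * a) ω = N i (p i * T) ω := hq
    exact ⟨h3.trans h1, fun h4 => h2 (h3.symm.trans h4)⟩
  · exact h

lemma tendsto_exp_sub_one_div (x : ℝ) :
    Tendsto (fun δ : ℝ≥0 => (Real.exp (x * δ) - 1) / (Real.exp δ - 1)) (𝓝[>] 0) (𝓝 x) := by
  have key : ∀ y : ℝ, Tendsto (fun δ : ℝ => δ⁻¹ * (Real.exp (y * δ) - 1)) (𝓝[≠] 0) (𝓝 y) := by
    intro y
    have h : HasDerivAt (fun δ : ℝ => Real.exp (y * δ)) y 0 := by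
      have := ((hasDerivAt_id (0 : ℝ)).const_mul y).exp
      simpa using this
    have := hasDerivAt_iff_tendsto_slope.1 h
    simpa [slope_fun_def] using this
  have hcoe : Tendsto (fun δ : ℝ≥0 => (δ : ℝ)) (𝓝[>] 0) (𝓝[≠] 0) := by
    refine tendsto_nhdsWithin_iff.2 ⟨?_, ?_⟩
    · exact (NNReal.continuous_coe.tendsto 0).mono_left nhdsWithin_le_nhds
    · filter_upwards [self_mem_nhdsWithin] with δ hδ
      have : (0 : ℝ) < δ := hδ
      exact this.ne'
  have h := ((key x).comp hcoe).div ((key 1).comp hcoe) one_ne_zero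
  rw [div_one] at h
  refine h.congr' ?_
  filter_upwards [self_mem_nhdsWithin] with δ hδ
  have hδ' : (δ : ℝ) ≠ 0 := (show (0 : ℝ) < δ from hδ).ne'
  simp only [Pi.div_apply, Function.comp_apply, one_mul]
  rw [mul_div_mul_left _ _ (inv_ne_zero hδ')]

end Paths

/-! ### The law of the next request and the number of unrequested objects. -/

section Poisson

variable {Ω : Type*} [MeasurableSpace Ω] {Pr : Measure Ω} [IsProbabilityMeasure Pr]
  {n : ℕ} {N : Fin n → ℝ≥0 → Ω → ℕ} {p : Fin n → ℝ≥0}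

/-- The first object to be requested after `T` is `i` with probability `p i`, independently of the
past. -/
lemma measureReal_exists_isOnlyNextRequested (hN : ∀ i, IsStandardPoissonProcess (N i) Pr)
    (hind : iIndepFun (fun i ω s => N i s ω) Pr) (hp : ∑ i, p i = 1) {T a : ℝ≥0} (ha : a ≤ T)
    (κ : Finset (Fin n)) :
    Pr.real {ω | ∃ i ∈ κ, IsOnlyNextRequested (pathTimes p fun i s => N i s ω) T i ∧
      i ∉ requestedIn (pathTimes p fun i s => N i s ω) a T} =
      ∑ i ∈ κ, p i * Real.exp (-(p i * ((T : ℝ) - a))) := by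
  set E := {ω | ∃ i ∈ κ, IsOnlyNextRequested (pathTimes p fun i s => N i s ω) T i ∧
      i ∉ requestedIn (pathTimes p fun i s => N i s ω) a T} with hE
  have hmeas : ∀ δ b i, MeasurableSet (cells N p T δ b i) :=
    fun δ b i => MeasurableSet.iUnion fun k => measurableSet_cell hN T δ b i k
  have hdisj : ∀ δ b, b ≤ T → ∀ κ : Finset (Fin n),
      Pr.real (⋃ i ∈ κ, cells N p T δ b i) = ∑ i ∈ κ, Pr.real (cells N p T δ b i) := by
    intro δ b hb κ
    refine measureReal_biUnion_finset₀ ?_ fun i _ => (hmeas δ b i).nullMeasurableSet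
    intro i _ j _ hij
    refine measure_mono_null (t := {ω | ¬ ((∀ i, IsCountingPath fun s => N i s ω) ∧
      ∀ i, T ∉ pathTimes p (fun i s => N i s ω) i)}) ?_
      (ae_iff.1 ((isCountingPath_ae hN).and (notMem_pathTimes_ae hN p T)))
    rintro ω ⟨hi, hj⟩ ⟨hω, hT⟩
    exact hij ((isOnlyNextRequested_of_mem_cells hω hb hT hj).1.2 i
      (isOnlyNextRequested_of_mem_cells hω hb hT hi).1.1)
  -- Lower bound for every mesh: membership in a cell decides who comes next.
  have hlow : ∀ δ, Pr.real (⋃ i ∈ κ, cells N p T δ a i) ≤ Pr.real E := by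
    intro δ
    refine ENNReal.toReal_mono (measure_ne_top _ _) (measure_mono_ae ?_)
    filter_upwards [isCountingPath_ae hN, notMem_pathTimes_ae hN p T, notMem_pathTimes_ae hN p a]
      with ω hω hT hta hmem
    obtain ⟨i, hi, hmem⟩ := Set.mem_iUnion₂.1 hmem
    have h := isOnlyNextRequested_of_mem_cells hω ha hT hmem
    exact ⟨i, hi, h.1, (mem_quiet_iff hω ha hT hta i).1 h.2⟩
  -- Upper bound: the event can escape the cells only if no object has a cell to itself after `T`.
  -- The cells started at `a = T` have total probability tending to `∑ p i = 1`, so the error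
  -- vanishes with the mesh.
  have hup : ∀ δ, Pr.real E ≤ Pr.real (⋃ i ∈ κ, cells N p T δ a i) +
      (1 - Pr.real (⋃ i ∈ (Finset.univ : Finset (Fin n)), cells N p T δ T i)) := by
    intro δ
    rw [← probReal_compl_eq_one_sub (Finset.measurableSet_biUnion _ fun i _ => hmeas δ T i)]
    refine le_trans (ENNReal.toReal_mono (measure_ne_top _ _) (measure_mono_ae ?_))
      (measureReal_union_le _ _)
    filter_upwards [isCountingPath_ae hN, notMem_pathTimes_ae hN p T, notMem_pathTimes_ae hN p a]
      with ω hω hT hta hmem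
    obtain ⟨i, hi, honly, hreq⟩ := hmem
    by_cases h : ω ∈ ⋃ i ∈ (Finset.univ : Finset (Fin n)), cells N p T δ T i
    · obtain ⟨j, -, hj⟩ := Set.mem_iUnion₂.1 h
      have h1 := (isOnlyNextRequested_of_mem_cells hω le_rfl hT hj).1
      obtain rfl := honly.2 j h1.1
      exact Or.inl (Set.mem_iUnion₂.2 ⟨j, hi, mem_cells_of_mem_quiet hj
        ((mem_quiet_iff hω ha hT hta j).2 hreq)⟩)
    · exact Or.inr h
  have hlim : ∀ b ≤ T, ∀ κ : Finset (Fin n),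
      Tendsto (fun δ : ℝ≥0 => Pr.real (⋃ i ∈ κ, cells N p T δ b i)) (𝓝[>] 0)
        (𝓝 (∑ i ∈ κ, Real.exp (-(p i * ((T : ℝ) - b))) * p i)) := by
    intro b hb κ
    have : Tendsto (fun δ : ℝ≥0 => ∑ i ∈ κ, Real.exp (-(p i * ((T : ℝ) - b))) *
        ((Real.exp (p i * δ) - 1) / (Real.exp δ - 1))) (𝓝[>] 0)
        (𝓝 (∑ i ∈ κ, Real.exp (-(p i * ((T : ℝ) - b))) * p i)) :=
      tendsto_finsetSum _ fun i _ => (tendsto_exp_sub_one_div (p i)).const_mul _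
    refine this.congr' ?_
    filter_upwards [self_mem_nhdsWithin] with δ hδ
    rw [hdisj δ b hb κ]
    exact Finset.sum_congr rfl fun i _ => (measureReal_cells hN hind hp hb hδ i).symm
  have h1 := hlim a ha κ
  have h2 : Tendsto (fun δ : ℝ≥0 => Pr.real (⋃ i ∈ κ, cells N p T δ a i) +
      (1 - Pr.real (⋃ i ∈ (Finset.univ : Finset (Fin n)), cells N p T δ T i))) (𝓝[>] 0)
        (𝓝 (∑ i ∈ κ, Real.exp (-(p i * ((T : ℝ) - a))) * p i)) := by
    have h3 := h1.add ((hlim T le_rfl Finset.univ).const_sub 1)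
    have h4 : ∑ i, (p i : ℝ) = 1 := by exact_mod_cast hp
    simpa [h4] using h3
  have : (𝓝[>] (0 : ℝ≥0)).NeBot := nhdsGT_neBot 0
  rw [Finset.sum_congr rfl fun i _ => mul_comm (p i : ℝ) _]
  exact le_antisymm (ge_of_tendsto' h2 hup) (le_of_tendsto' h1 hlow)

/-- The case `a = T` of the previous formula: nothing is requested in the empty interval, and the
popularities add up to `1`. -/
lemma exists_isOnlyNextRequested_ae (hN : ∀ i, IsStandardPoissonProcess (N i) Pr)
    (hind : iIndepFun (fun i ω s => N i s ω) Pr) (hp : ∑ i, p i = 1) (T : ℝ≥0) :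
    Pr.real {ω | ∃ i, IsOnlyNextRequested (pathTimes p fun i s => N i s ω) T i} = 1 := by
  have h := measureReal_exists_isOnlyNextRequested hN hind hp (le_refl T) Finset.univ
  have h0 : ∀ A : Fin n → Set ℝ≥0, requestedIn A T T = ∅ := by
    refine fun A => Set.eq_empty_of_forall_notMem ?_
    rintro i ⟨s, -, h1, h2⟩
    exact not_lt.2 h1 h2
  have h4 : ∑ i, (p i : ℝ) = 1 := by exact_mod_cast hp
  simpa [h0, h4] using h

open Classical in
/-- Law of large numbers for the number of the objects in `κ` that are not requested in `[a, T)`. -/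
lemma measureReal_abs_card_sub_ge_le (hN : ∀ i, IsStandardPoissonProcess (N i) Pr)
    (hind : iIndepFun (fun i ω s => N i s ω) Pr) {T a : ℝ≥0} (ha : a ≤ T)
    (κ : Finset (Fin n)) {ε : ℝ} (hε : 0 < ε) (hn : 0 < n) :
    Pr.real {ω | ε * n ≤ |({j ∈ κ | j ∉ requestedIn (pathTimes p fun i s => N i s ω) a T}.card : ℝ) -
      ∑ i ∈ κ, Real.exp (-(p i * ((T : ℝ) - a)))|} ≤ 1 / (ε ^ 2 * n) := by
  have hn' : (0 : ℝ) < n := by exact_mod_cast hn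
  set X : Fin n → Ω → ℝ := fun i => (quiet N p i a T).indicator fun _ => 1 with hX
  have hXm : ∀ i, Measurable (X i) := fun i =>
    measurable_const.indicator (measurableSet_quiet hN i a T)
  have hX01 : ∀ i ω, X i ω ∈ Icc (0 : ℝ) 1 := by
    intro i ω
    simp only [hX, Set.indicator_apply]
    split_ifs <;> simp
  have hXL : ∀ i, MemLp (X i) 2 Pr := fun i =>
    memLp_of_bounded (Filter.Eventually.of_forall (hX01 i)) (hXm i).aestronglyMeasurable 2
  have hXind : iIndepFun X Pr := by
    refine hind.comp (fun i (c : ℝ≥0 → ℕ) => {c : ℝ≥0 → ℕ | c (p i * a) = c (p i * T)}.indicator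
      (fun _ => (1 : ℝ)) c) fun i => ?_
    exact measurable_const.indicator
      (measurableSet_eq_fun (measurable_pi_apply _) (measurable_pi_apply _))
  have hE : ∀ i, ∫ ω, X i ω ∂Pr = Real.exp (-(p i * ((T : ℝ) - a))) := by
    intro i
    rw [hX, integral_indicator_const _ (measurableSet_quiet hN i a T), measureReal_quiet hN i ha]
    simp
  have hEs : ∫ ω, (∑ i ∈ κ, X i) ω ∂Pr = ∑ i ∈ κ, Real.exp (-(p i * ((T : ℝ) - a))) := by
    simp only [Finset.sum_apply]
    rw [integral_finsetSum _ fun i _ => (hXL i).integrable (by norm_num)]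
    exact Finset.sum_congr rfl fun i _ => hE i
  -- Independent variables with values in `[0, 1]` each have variance at most `1`; the crude bound
  -- suffices for Chebyshev.
  have hvar : variance (∑ i ∈ κ, X i) Pr ≤ n := by
    rw [IndepFun.variance_sum (fun i _ => hXL i) fun i _ j _ hij => hXind.indepFun hij]
    have h1 : ∀ i ∈ κ, variance (X i) Pr ≤ 1 := by
      intro i _
      have := variance_le_sq_of_bounded (μ := Pr) (Filter.Eventually.of_forall (hX01 i)) (hXm i).aemeasurable
      refine this.trans ?_
      norm_num
    refine (Finset.sum_le_card_nsmul _ _ _ h1).trans ?_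
    rw [nsmul_eq_mul, mul_one]
    exact_mod_cast (Finset.card_le_univ κ).trans_eq (Fintype.card_fin n)
  have hcheb := meas_ge_le_variance_div_sq (memLp_finsetSum' κ fun i _ => hXL i)
    (mul_pos hε hn')
  rw [hEs] at hcheb
  have hle : Pr.real {ω | ε * n ≤ |({j ∈ κ | j ∉ requestedIn
      (pathTimes p fun i s => N i s ω) a T}.card : ℝ) -
      ∑ i ∈ κ, Real.exp (-(p i * ((T : ℝ) - a)))|} ≤
      Pr.real {ω | ε * n ≤ |(∑ i ∈ κ, X i) ω - ∑ i ∈ κ, Real.exp (-(p i * ((T : ℝ) - a)))|} := by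
    refine ENNReal.toReal_mono (measure_ne_top _ _) (measure_mono_ae ?_)
    filter_upwards [isCountingPath_ae hN, notMem_pathTimes_ae hN p T, notMem_pathTimes_ae hN p a]
      with ω hω hT hta hmem
    have : (∑ i ∈ κ, X i) ω =
        ({j ∈ κ | j ∉ requestedIn (pathTimes p fun i s => N i s ω) a T}.card : ℝ) := by
      rw [Finset.card_filter, Finset.sum_apply]
      push_cast
      refine Finset.sum_congr rfl fun i _ => ?_
      simp only [hX, Set.indicator_apply, mem_quiet_iff hω ha hT hta i]
    change ε * n ≤ |(∑ i ∈ κ, X i) ω - _|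
    rw [this]
    exact hmem
  refine hle.trans ?_
  have h3 : Pr.real {ω | ε * n ≤ |(∑ i ∈ κ, X i) ω - ∑ i ∈ κ, Real.exp (-(p i * ((T : ℝ) - a)))|} ≤
      variance (∑ i ∈ κ, X i) Pr / (ε * n) ^ 2 :=
    ENNReal.toReal_le_of_le_ofReal (div_nonneg (variance_nonneg _ _) (sq_nonneg _)) hcheb
  refine h3.trans ?_
  rw [div_le_div_iff₀ (by positivity) (by positivity)]
  have : 0 < ε ^ 2 * n := by positivity
  nlinarith

end Poisson

/-! ### The Laplace transform -/

section Laplace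

variable {P : ProbabilityMeasure ℝ≥0}

/-- The integrals `∫ z ^ k e^{-zt} P(dz)`. -/
noncomputable def laplaceMoment (P : ProbabilityMeasure ℝ≥0) (k : ℕ) (t : ℝ) : ℝ :=
  ∫ z : ℝ≥0, (z : ℝ) ^ k * Real.exp (-(z * t)) ∂(P : Measure ℝ≥0)

lemma laplaceMoment_zero (P : ProbabilityMeasure ℝ≥0) : laplaceMoment P 0 = laplace P := by
  funext t
  simp [laplaceMoment, laplace]

/-- From `x ^ k / k! ≤ e^x` at `x = z c`. This gives bounded integrands for every `k` without any
moment assumption on `P`. -/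
lemma pow_mul_exp_le (k : ℕ) {c : ℝ} (hc : 0 < c) (z : ℝ≥0) :
    (z : ℝ) ^ k * Real.exp (-(z * c)) ≤ k.factorial / c ^ k := by
  have h := Real.pow_div_factorial_le_exp (z * c) (by positivity) k
  rw [Real.exp_neg, ← div_eq_mul_inv, div_le_div_iff₀ (Real.exp_pos _) (by positivity), ← mul_pow]
  rw [div_le_iff₀ (by positivity)] at h
  linarith

lemma integrable_coe (hfin : ∫⁻ x, (x : ℝ≥0∞) ∂(P : Measure ℝ≥0) ≠ ∞) :
    Integrable (fun z : ℝ≥0 => (z : ℝ)) (P : Measure ℝ≥0) := by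
  refine ⟨by fun_prop, ?_⟩
  rw [hasFiniteIntegral_iff_enorm]
  simpa using hfin.lt_top

lemma integral_coe :
    ∫ z : ℝ≥0, (z : ℝ) ∂(P : Measure ℝ≥0) = mean P := by
  rw [integral_eq_lintegral_of_nonneg_ae (Filter.Eventually.of_forall fun z => z.2) (by fun_prop),
    mean]
  simp [ENNReal.coe_toNNReal_eq_toReal]

lemma integrable_pow_mul_exp (k : ℕ) {t : ℝ} (ht : 0 < t) :
    Integrable (fun z : ℝ≥0 => (z : ℝ) ^ k * Real.exp (-(z * t))) (P : Measure ℝ≥0) := by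
  refine Integrable.of_bound (by fun_prop) (k.factorial / t ^ k)
    (Filter.Eventually.of_forall fun z => ?_)
  rw [Real.norm_of_nonneg (by positivity)]
  exact pow_mul_exp_le k ht z

lemma exp_neg_mul_le_one (z : ℝ≥0) {t : ℝ} (ht : 0 ≤ t) : Real.exp (-(z * t)) ≤ 1 := by
  rw [Real.exp_le_one_iff]
  have : (0 : ℝ) ≤ z * t := by positivity
  linarith

lemma integrable_exp {t : ℝ} (ht : 0 ≤ t) :
    Integrable (fun z : ℝ≥0 => Real.exp (-(z * t))) (P : Measure ℝ≥0) := by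
  refine Integrable.of_bound (by fun_prop) 1 (Filter.Eventually.of_forall fun z => ?_)
  rw [Real.norm_of_nonneg (by positivity)]
  exact exp_neg_mul_le_one z ht

lemma hasDerivAt_exp_neg_mul (a t : ℝ) :
    HasDerivAt (fun t : ℝ => Real.exp (-(a * t))) (-(a * Real.exp (-(a * t)))) t := by
  have h : HasDerivAt (fun t : ℝ => -(a * t)) (-a) t := by
    simpa using ((hasDerivAt_id t).const_mul a).fun_neg
  have h2 := h.exp
  rwa [mul_neg, mul_comm] at h2

/-- Differentiation under the integral sign, dominated on `(t / 2, ∞)` by a constant. -/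
lemma hasDerivAt_laplaceMoment (k : ℕ) {t : ℝ} (ht : 0 < t) :
    HasDerivAt (laplaceMoment P k) (-laplaceMoment P (k + 1) t) t := by
  have h := hasDerivAt_integral_of_dominated_loc_of_deriv_le (μ := (P : Measure ℝ≥0))
    (F := fun (s : ℝ) (z : ℝ≥0) => (z : ℝ) ^ k * Real.exp (-(z * s)))
    (F' := fun (s : ℝ) (z : ℝ≥0) => -((z : ℝ) ^ (k + 1) * Real.exp (-(z * s))))
    (bound := fun _ => (k + 1).factorial / (t / 2) ^ (k + 1)) (x₀ := t) (s := Ioi (t / 2))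
    (Ioi_mem_nhds (by linarith)) (Filter.Eventually.of_forall fun s => by fun_prop)
    (integrable_pow_mul_exp k ht) (by fun_prop)
    (Filter.Eventually.of_forall fun z s hs => ?_) (integrable_const _)
    (Filter.Eventually.of_forall fun z s _ => ?_)
  · have := h.2
    rw [integral_neg] at this
    exact this
  · rw [norm_neg, Real.norm_of_nonneg (by positivity)]
    refine le_trans ?_ (pow_mul_exp_le (k + 1) (half_pos ht) z)
    gcongr
    exact (Set.mem_Ioi.1 hs).le
  · have := (hasDerivAt_exp_neg_mul z s).const_mul ((z : ℝ) ^ k)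
    rwa [show (z : ℝ) ^ k * -(z * Real.exp (-(z * s))) =
      -((z : ℝ) ^ (k + 1) * Real.exp (-(z * s))) by ring] at this

/-- Includes the one-sided derivative at `0`: the difference quotients of `e^{-zs}` are bounded by
`z`, which is integrable because the mean is finite. -/
lemma hasDerivWithinAt_laplace (hfin : ∫⁻ x, (x : ℝ≥0∞) ∂(P : Measure ℝ≥0) ≠ ∞) {t : ℝ}
    (ht : 0 ≤ t) : HasDerivWithinAt (laplace P) (-laplaceMoment P 1 t) (Ici 0) t := by
  rw [hasDerivWithinAt_iff_tendsto_slope]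
  have h1 : Tendsto (fun s => ∫ z : ℝ≥0, slope (fun s : ℝ => Real.exp (-(z * s))) t s
      ∂(P : Measure ℝ≥0)) (𝓝[Ici 0 \ {t}] t) (𝓝 (∫ z : ℝ≥0, -((z : ℝ) * Real.exp (-(z * t)))
      ∂(P : Measure ℝ≥0))) := by
    refine tendsto_integral_filter_of_dominated_convergence (fun z : ℝ≥0 => (z : ℝ))
      (Filter.Eventually.of_forall fun s => ?_) ?_ (integrable_coe hfin)
      (Filter.Eventually.of_forall fun z => ?_)
    · simp only [slope_def_field]
      fun_prop
    · filter_upwards [self_mem_nhdsWithin] with s hs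
      refine Filter.Eventually.of_forall fun z => ?_
      have hs0 : 0 ≤ s := hs.1
      have hst : s - t ≠ 0 := sub_ne_zero.2 hs.2
      rw [slope_def_field, norm_div, div_le_iff₀ (norm_pos_iff.2 hst)]
      have := Convex.norm_image_sub_le_of_norm_hasDerivWithin_le (s := Ici (0 : ℝ))
        (f := fun s : ℝ => Real.exp (-(z * s))) (C := z)
        (fun x _ => (hasDerivAt_exp_neg_mul z x).hasDerivWithinAt) (fun x hx => ?_)
        (convex_Ici 0) ht hs0
      · exact this
      · rw [norm_neg, Real.norm_of_nonneg (by positivity)]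
        exact mul_le_of_le_one_right z.2 (exp_neg_mul_le_one z hx)
    · have := hasDerivWithinAt_iff_tendsto_slope.1
        ((hasDerivAt_exp_neg_mul z t).hasDerivWithinAt (s := Ici 0))
      exact this
  rw [integral_neg] at h1
  simp only [laplaceMoment, pow_one]
  refine h1.congr' ?_
  filter_upwards [self_mem_nhdsWithin] with s hs
  simp only [slope_def_field, laplace]
  rw [integral_div, integral_sub (integrable_exp hs.1) (integrable_exp ht)]

lemma laplaceDeriv_eq (hfin : ∫⁻ x, (x : ℝ≥0∞) ∂(P : Measure ℝ≥0) ≠ ∞) {t : ℝ} (ht : 0 ≤ t) :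
    laplaceDeriv P t = -laplaceMoment P 1 t :=
  (hasDerivWithinAt_laplace hfin ht).derivWithin (uniqueDiffOn_Ici 0 t ht)

/-- The point `0` is left out since the second moment of `P` may be infinite. -/
lemma laplaceDeriv₂_eq (hfin : ∫⁻ x, (x : ℝ≥0∞) ∂(P : Measure ℝ≥0) ≠ ∞) {t : ℝ} (ht : 0 < t) :
    laplaceDeriv₂ P t = laplaceMoment P 2 t := by
  have h1 : HasDerivWithinAt (laplaceDeriv P) (laplaceMoment P 2 t) (Ici 0) t := by
    have h2 := ((hasDerivAt_laplaceMoment (P := P) 1 ht).neg.hasDerivWithinAt (s := Ici 0))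
    rw [neg_neg] at h2
    exact h2.congr (fun s hs => laplaceDeriv_eq hfin hs) (laplaceDeriv_eq hfin ht.le)
  exact h1.derivWithin (uniqueDiffOn_Ici 0 t ht.le)

lemma integrable_mul_exp (hfin : ∫⁻ x, (x : ℝ≥0∞) ∂(P : Measure ℝ≥0) ≠ ∞) {t : ℝ} (ht : 0 ≤ t) :
    Integrable (fun z : ℝ≥0 => (z : ℝ) * Real.exp (-(z * t))) (P : Measure ℝ≥0) := by
  refine (integrable_coe hfin).mono' (by fun_prop) (Filter.Eventually.of_forall fun z => ?_)
  rw [Real.norm_of_nonneg (by positivity)]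
  exact mul_le_of_le_one_right z.2 (exp_neg_mul_le_one z ht)

lemma laplaceMoment_nonneg (k : ℕ) (t : ℝ) : 0 ≤ laplaceMoment P k t :=
  integral_nonneg fun z => by positivity

lemma laplaceMoment_one_pos (hfin : ∫⁻ x, (x : ℝ≥0∞) ∂(P : Measure ℝ≥0) ≠ ∞) (hmean : mean P ≠ 0)
    {t : ℝ} (ht : 0 ≤ t) : 0 < laplaceMoment P 1 t := by
  refine lt_of_le_of_ne (laplaceMoment_nonneg 1 t) fun h => hmean ?_
  simp only [laplaceMoment, pow_one] at h
  have h1 := (integral_eq_zero_iff_of_nonneg (fun z : ℝ≥0 => by positivity)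
    (integrable_mul_exp hfin ht)).1 h.symm
  have h2 : ∫ z : ℝ≥0, (z : ℝ) ∂(P : Measure ℝ≥0) = 0 := by
    rw [integral_eq_zero_of_ae]
    filter_upwards [h1] with z hz
    simpa [(Real.exp_pos _).ne'] using hz
  rw [integral_coe] at h2
  exact_mod_cast h2

lemma laplaceMoment_antitoneOn (k : ℕ) : AntitoneOn (laplaceMoment P k) (Ioi 0) := by
  intro s hs t ht hst
  refine integral_mono (integrable_pow_mul_exp k ht) (integrable_pow_mul_exp k hs) fun z => ?_
  dsimp only
  gcongr

lemma laplaceMoment_one_zero :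
    laplaceMoment P 1 0 = mean P := by
  simp [laplaceMoment, integral_coe]

lemma continuousOn_laplaceMoment_one (hfin : ∫⁻ x, (x : ℝ≥0∞) ∂(P : Measure ℝ≥0) ≠ ∞) :
    ContinuousOn (laplaceMoment P 1) (Ici 0) := by
  refine continuousOn_of_dominated (bound := fun z : ℝ≥0 => (z : ℝ)) (fun s _ => by fun_prop)
    (fun s hs => Filter.Eventually.of_forall fun z => ?_) (integrable_coe hfin)
    (Filter.Eventually.of_forall fun z => by fun_prop)
  rw [Real.norm_of_nonneg (by positivity), pow_one]
  exact mul_le_of_le_one_right z.2 (exp_neg_mul_le_one z hs)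

lemma tendsto_laplaceMoment_one (hfin : ∫⁻ x, (x : ℝ≥0∞) ∂(P : Measure ℝ≥0) ≠ ∞) :
    Tendsto (laplaceMoment P 1) atTop (𝓝 0) := by
  have : (0 : ℝ) = ∫ _ : ℝ≥0, (0 : ℝ) ∂(P : Measure ℝ≥0) := by simp
  rw [this]
  refine tendsto_integral_filter_of_dominated_convergence (fun z : ℝ≥0 => (z : ℝ))
      (Filter.Eventually.of_forall fun s => by fun_prop) ?_ (integrable_coe hfin)
      (Filter.Eventually.of_forall fun z => ?_)
  · filter_upwards [eventually_ge_atTop 0] with s hs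
    refine Filter.Eventually.of_forall fun z => ?_
    rw [Real.norm_of_nonneg (by positivity), pow_one]
    exact mul_le_of_le_one_right z.2 (exp_neg_mul_le_one z hs)
  · rcases eq_or_ne z 0 with rfl | hz
    · simp
    · have hz' : (0 : ℝ) < z := NNReal.coe_pos.2 (pos_iff_ne_zero.2 hz)
      have h := (Real.tendsto_exp_neg_atTop_nhds_zero.comp
        (tendsto_id.const_mul_atTop hz')).const_mul ((z : ℝ) ^ 1)
      rw [mul_zero] at h
      exact h

lemma tendsto_laplace (P : ProbabilityMeasure ℝ≥0) :
    Tendsto (laplace P) atTop (𝓝 ((P : Measure ℝ≥0).real {0})) := by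
  have : (P : Measure ℝ≥0).real {0} =
      ∫ z : ℝ≥0, ({0} : Set ℝ≥0).indicator (fun _ => (1 : ℝ)) z ∂(P : Measure ℝ≥0) := by
    rw [integral_indicator_const _ (measurableSet_singleton 0)]
    simp
  rw [this]
  refine tendsto_integral_filter_of_dominated_convergence (fun _ : ℝ≥0 => (1 : ℝ))
      (Filter.Eventually.of_forall fun s => by fun_prop) ?_ (integrable_const _)
      (Filter.Eventually.of_forall fun z => ?_)
  · filter_upwards [eventually_ge_atTop 0] with s hs
    refine Filter.Eventually.of_forall fun z => ?_
    rw [Real.norm_of_nonneg (by positivity)]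
    exact exp_neg_mul_le_one z hs
  · rcases eq_or_ne z 0 with rfl | hz
    · simp
    · have hz' : (0 : ℝ) < z := NNReal.coe_pos.2 (pos_iff_ne_zero.2 hz)
      rw [Set.indicator_of_notMem (by simpa using hz)]
      exact Real.tendsto_exp_neg_atTop_nhds_zero.comp (tendsto_id.const_mul_atTop hz')

lemma laplace_zero (P : ProbabilityMeasure ℝ≥0) : laplace P 0 = 1 := by
  simp [laplace]

lemma continuousOn_laplace (hfin : ∫⁻ x, (x : ℝ≥0∞) ∂(P : Measure ℝ≥0) ≠ ∞) :
    ContinuousOn (laplace P) (Ici 0) :=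
  fun _ ht => (hasDerivWithinAt_laplace hfin ht).continuousWithinAt

lemma strictAntiOn_laplace (hfin : ∫⁻ x, (x : ℝ≥0∞) ∂(P : Measure ℝ≥0) ≠ ∞) (hmean : mean P ≠ 0) :
    StrictAntiOn (laplace P) (Ici 0) := by
  refine strictAntiOn_of_deriv_neg (convex_Ici 0) (continuousOn_laplace hfin) fun t ht => ?_
  rw [interior_Ici] at ht
  rw [← laplaceMoment_zero, (hasDerivAt_laplaceMoment 0 ht).deriv, neg_lt_zero]
  exact laplaceMoment_one_pos hfin hmean (le_of_lt ht)

lemma real_singleton_zero_lt_laplace (hfin : ∫⁻ x, (x : ℝ≥0∞) ∂(P : Measure ℝ≥0) ≠ ∞)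
    (hmean : mean P ≠ 0) {t : ℝ} (ht : 0 ≤ t) : (P : Measure ℝ≥0).real {0} < laplace P t := by
  have hanti := strictAntiOn_laplace hfin hmean
  have ht1 : (0 : ℝ) ≤ t + 1 := by linarith
  refine lt_of_le_of_lt ?_ (hanti ht ht1 (lt_add_one t))
  refine le_of_tendsto (tendsto_laplace P) ?_
  filter_upwards [eventually_ge_atTop (t + 1)] with s hs
  exact hanti.antitoneOn ht1 (ht1.trans hs) hs

lemma image_one_sub_laplace (hfin : ∫⁻ x, (x : ℝ≥0∞) ∂(P : Measure ℝ≥0) ≠ ∞) (hmean : mean P ≠ 0)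
    {u : ℝ} (hu : 0 ≤ u) : (fun s => 1 - laplace P s) '' Ioi u =
      Ioo (1 - laplace P u) (1 - (P : Measure ℝ≥0).real {0}) := by
  have hanti := strictAntiOn_laplace hfin hmean
  apply Set.Subset.antisymm
  · rintro _ ⟨s, hs, rfl⟩
    have hs0 : 0 ≤ s := hu.trans (le_of_lt hs)
    have h1 := hanti hu hs0 hs
    have h2 := real_singleton_zero_lt_laplace hfin hmean hs0
    constructor <;> dsimp only <;> linarith
  · rintro x ⟨hx1, hx2⟩
    have h1 : ∀ᶠ s in atTop, laplace P s < 1 - x :=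
      (tendsto_laplace P).eventually_lt_const (by linarith)
    obtain ⟨s, hs, hus⟩ := (h1.and (eventually_ge_atTop u)).exists
    have h2 := intermediate_value_Icc' hus
      ((continuousOn_laplace hfin).mono fun r hr => hu.trans hr.1)
    obtain ⟨r, hr, hrx⟩ := h2 (⟨hs.le, by linarith⟩ : 1 - x ∈ Icc (laplace P s) (laplace P u))
    refine ⟨r, lt_of_le_of_ne hr.1 ?_, by dsimp only; linarith⟩
    rintro rfl
    linarith

lemma laplaceInv_laplace (hfin : ∫⁻ x, (x : ℝ≥0∞) ∂(P : Measure ℝ≥0) ≠ ∞) (hmean : mean P ≠ 0)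
    {s : ℝ} (hs : 0 ≤ s) : laplaceInv P (laplace P s) = s :=
  (strictAntiOn_laplace hfin hmean).injOn.leftInvOn_invFunOn hs

lemma exists_laplaceInv_eq (hfin : ∫⁻ x, (x : ℝ≥0∞) ∂(P : Measure ℝ≥0) ≠ ∞) (hmean : mean P ≠ 0)
    {x : ℝ} (hx : x ∈ Ioo 0 (1 - (P : Measure ℝ≥0).real {0})) :
    ∃ s, 0 < s ∧ laplaceInv P (1 - x) = s ∧ x = 1 - laplace P s := by
  have h := image_one_sub_laplace hfin hmean le_rfl
  rw [laplace_zero, sub_self] at h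
  rw [← h] at hx
  obtain ⟨s, hs, rfl⟩ := hx
  refine ⟨s, hs, ?_, rfl⟩
  rw [sub_sub_cancel, laplaceInv_laplace hfin hmean (le_of_lt hs)]

/-! ### The stationary law -/

lemma monotoneOn_laplaceInv (hfin : ∫⁻ x, (x : ℝ≥0∞) ∂(P : Measure ℝ≥0) ≠ ∞) (hmean : mean P ≠ 0) :
    MonotoneOn (fun x => laplaceInv P (1 - x)) (Ioo 0 (1 - (P : Measure ℝ≥0).real {0})) := by
  intro x hx y hy hxy
  obtain ⟨s, hs, h1, h2⟩ := exists_laplaceInv_eq hfin hmean hx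
  obtain ⟨r, hr, h3, h4⟩ := exists_laplaceInv_eq hfin hmean hy
  dsimp only
  rw [h1, h3]
  by_contra hlt
  have := strictAntiOn_laplace hfin hmean hr.le hs.le (not_le.1 hlt)
  linarith

/-- On the open interval both the numerator and the denominator are monotone in `x`; the end points
are a null set. -/
lemma aemeasurable_stationaryDensity (hfin : ∫⁻ x, (x : ℝ≥0∞) ∂(P : Measure ℝ≥0) ≠ ∞)
    (hmean : mean P ≠ 0) : AEMeasurable (stationaryDensity P) volume := by
  have hmono := monotoneOn_laplaceInv hfin hmean
  have hpos : MapsTo (fun x => laplaceInv P (1 - x)) (Ioo 0 (1 - (P : Measure ℝ≥0).real {0}))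
      (Ioi 0) := by
    intro x hx
    obtain ⟨s, hs, h1, -⟩ := exists_laplaceInv_eq hfin hmean hx
    change 0 < laplaceInv P (1 - x)
    rwa [h1]
  have h2 : AntitoneOn (fun x => laplaceDeriv₂ P (laplaceInv P (1 - x)))
      (Ioo 0 (1 - (P : Measure ℝ≥0).real {0})) := by
    intro x hx y hy hxy
    dsimp only
    rw [laplaceDeriv₂_eq hfin (hpos hx), laplaceDeriv₂_eq hfin (hpos hy)]
    exact laplaceMoment_antitoneOn 2 (hpos hx) (hpos hy) (hmono hx hy hxy)
  have h1 : MonotoneOn (fun x => laplaceDeriv P (laplaceInv P (1 - x)))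
      (Ioo 0 (1 - (P : Measure ℝ≥0).real {0})) := by
    intro x hx y hy hxy
    dsimp only
    rw [laplaceDeriv_eq hfin (le_of_lt (hpos hx)), laplaceDeriv_eq hfin (le_of_lt (hpos hy)),
      neg_le_neg_iff]
    exact laplaceMoment_antitoneOn 1 (hpos hx) (hpos hy) (hmono hx hy hxy)
  unfold stationaryDensity
  rw [aemeasurable_indicator_iff measurableSet_Icc, ← restrict_Ioo_eq_restrict_Icc]
  exact ((aemeasurable_restrict_of_antitoneOn measurableSet_Ioo h2).div
    (aemeasurable_restrict_of_monotoneOn measurableSet_Ioo h1)).const_mul _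

lemma stationaryDensity_one_sub_laplace (hfin : ∫⁻ x, (x : ℝ≥0∞) ∂(P : Measure ℝ≥0) ≠ ∞)
    (hmean : mean P ≠ 0) {s : ℝ} (hs : 0 < s) : stationaryDensity P (1 - laplace P s) =
      laplaceMoment P 2 s / (mean P * laplaceMoment P 1 s) := by
  have h := image_one_sub_laplace hfin hmean le_rfl
  rw [laplace_zero, sub_self] at h
  have hmem : 1 - laplace P s ∈ Ioo 0 (1 - (P : Measure ℝ≥0).real {0}) := h ▸ ⟨s, hs, rfl⟩
  have h1 := laplaceMoment_one_pos hfin hmean hs.le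
  have hm : (mean P : ℝ) ≠ 0 := by exact_mod_cast hmean
  rw [stationaryDensity, Set.indicator_of_mem (Ioo_subset_Icc_self hmem), sub_sub_cancel,
    laplaceInv_laplace hfin hmean hs.le, laplaceDeriv_eq hfin hs.le, laplaceDeriv₂_eq hfin hs]
  field_simp

lemma stationaryDensity_nonneg_ae (hfin : ∫⁻ x, (x : ℝ≥0∞) ∂(P : Measure ℝ≥0) ≠ ∞)
    (hmean : mean P ≠ 0) : ∀ᵐ x, 0 ≤ stationaryDensity P x := by
  have h0 : ∀ᵐ x : ℝ, x ≠ 0 := Measure.ae_ne volume 0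
  have h1 : ∀ᵐ x : ℝ, x ≠ 1 - (P : Measure ℝ≥0).real {0} := Measure.ae_ne volume _
  filter_upwards [h0, h1] with x h0 h1
  by_cases hx : x ∈ Icc 0 (1 - (P : Measure ℝ≥0).real {0})
  · obtain ⟨s, hs, -, rfl⟩ := exists_laplaceInv_eq hfin hmean
      ⟨lt_of_le_of_ne hx.1 (Ne.symm h0), lt_of_le_of_ne hx.2 h1⟩
    rw [stationaryDensity_one_sub_laplace hfin hmean hs]
    exact div_nonneg (laplaceMoment_nonneg _ _)
      (mul_nonneg (mean P).2 (laplaceMoment_nonneg _ _))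
  · rw [stationaryDensity, Set.indicator_of_notMem hx]

/-- Substitute `x = 1 - φ(s)`, `dx = M₁(s) ds`, where `M_k` is the `k`-th `laplaceMoment`. The
density becomes `M₂ / (μ M₁)`, so the integrand is `M₂ / μ`, the derivative of `-M₁ / μ`, which
vanishes at infinity. -/
lemma lintegral_stationaryDensity_Ioi (hfin : ∫⁻ x, (x : ℝ≥0∞) ∂(P : Measure ℝ≥0) ≠ ∞)
    (hmean : mean P ≠ 0) {u : ℝ} (hu : 0 ≤ u) :
    ∫⁻ x in Ioi (1 - laplace P u), ENNReal.ofReal (stationaryDensity P x) =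
      ENNReal.ofReal (laplaceMoment P 1 u / mean P) := by
  have hm : (mean P : ℝ) ≠ 0 := by exact_mod_cast hmean
  have hanti := strictAntiOn_laplace hfin hmean
  have h1 : ∫⁻ x in Ioi (1 - laplace P u), ENNReal.ofReal (stationaryDensity P x) =
      ∫⁻ x in Ioo (1 - laplace P u) (1 - (P : Measure ℝ≥0).real {0}),
        ENNReal.ofReal (stationaryDensity P x) := by
    rw [← lintegral_indicator measurableSet_Ioi, ← lintegral_indicator measurableSet_Ioo]
    refine lintegral_congr_ae ?_
    have h1 : ∀ᵐ x : ℝ, x ≠ 1 - (P : Measure ℝ≥0).real {0} := Measure.ae_ne volume _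
    filter_upwards [h1] with x h1
    by_cases hx : x ∈ Ioo (1 - laplace P u) (1 - (P : Measure ℝ≥0).real {0})
    · rw [Set.indicator_of_mem hx, Set.indicator_of_mem (Set.mem_Ioi.2 hx.1)]
    · rw [Set.indicator_of_notMem hx]
      by_cases hx' : x ∈ Ioi (1 - laplace P u)
      · have : x ∉ Icc 0 (1 - (P : Measure ℝ≥0).real {0}) :=
          fun h => hx ⟨hx', lt_of_le_of_ne h.2 h1⟩
        rw [Set.indicator_of_mem hx', stationaryDensity, Set.indicator_of_notMem this,
          ENNReal.ofReal_zero]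
      · rw [Set.indicator_of_notMem hx']
  have hinj : InjOn (fun s => 1 - laplace P s) (Ioi u) := by
    intro s hs r hr hsr
    exact hanti.injOn (hu.trans (le_of_lt hs)) (hu.trans (le_of_lt hr))
      (by simpa using hsr)
  rw [h1, ← image_one_sub_laplace hfin hmean hu, lintegral_image_eq_lintegral_abs_deriv_mul
    (f' := fun s => laplaceMoment P 1 s) measurableSet_Ioi (fun s hs => ?_) hinj]
  · have h2 : ∀ s ∈ Ioi u, ENNReal.ofReal |laplaceMoment P 1 s| *
        ENNReal.ofReal (stationaryDensity P (1 - laplace P s)) =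
        ENNReal.ofReal (laplaceMoment P 2 s / mean P) := by
      intro s hs
      have hs0 : 0 < s := lt_of_le_of_lt hu hs
      have h3 := laplaceMoment_one_pos hfin hmean hs0.le
      rw [← ENNReal.ofReal_mul (abs_nonneg _), stationaryDensity_one_sub_laplace hfin hmean hs0,
        abs_of_pos h3]
      congr 1
      field_simp
    rw [setLIntegral_congr_fun measurableSet_Ioi h2]
    have hderiv : ∀ s ∈ Ioi u, HasDerivAt (fun s => -laplaceMoment P 1 s / mean P)
        (laplaceMoment P 2 s / mean P) s := by
      intro s hs
      have := ((hasDerivAt_laplaceMoment (P := P) 1 (lt_of_le_of_lt hu hs)).neg).div_const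
        (mean P : ℝ)
      rw [neg_neg] at this
      exact this
    have hcont : ContinuousWithinAt (fun s => -laplaceMoment P 1 s / mean P) (Ici u) u :=
      ((((continuousOn_laplaceMoment_one hfin).neg).div_const _) u hu).mono
        (Ici_subset_Ici.2 hu)
    have hlim : Tendsto (fun s => -laplaceMoment P 1 s / mean P) atTop (𝓝 0) := by
      have := (tendsto_laplaceMoment_one hfin).neg.div_const (mean P : ℝ)
      simpa using this
    have hnn : ∀ s ∈ Ioi u, 0 ≤ laplaceMoment P 2 s / mean P :=
      fun s _ => div_nonneg (laplaceMoment_nonneg _ _) (mean P).2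
    rw [← ofReal_integral_eq_lintegral_ofReal
      (integrableOn_Ioi_deriv_of_nonneg hcont hderiv hnn hlim)
      ((ae_restrict_iff' measurableSet_Ioi).2 (Filter.Eventually.of_forall hnn)),
      integral_Ioi_of_hasDerivAt_of_nonneg hcont hderiv hnn hlim]
    congr 1
    ring
  · have hs0 : 0 < s := lt_of_le_of_lt hu hs
    have := (hasDerivAt_laplaceMoment (P := P) 0 hs0).const_sub 1
    rw [neg_neg, laplaceMoment_zero] at this
    exact this.hasDerivWithinAt

lemma lintegral_stationaryDensity_Iic_zero :
    ∫⁻ x in Iic 0, ENNReal.ofReal (stationaryDensity P x) = 0 := by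
  rw [← lintegral_indicator measurableSet_Iic]
  refine (lintegral_congr_ae ?_).trans lintegral_zero
  filter_upwards [Measure.ae_ne volume (0 : ℝ)] with x hx
  by_cases h : x ∈ Iic (0 : ℝ)
  · rw [Set.indicator_of_mem h, stationaryDensity, Set.indicator_of_notMem, ENNReal.ofReal_zero]
    exact fun h' => hx (le_antisymm h h'.1)
  · rw [Set.indicator_of_notMem h]

lemma lintegral_stationaryDensity (hfin : ∫⁻ x, (x : ℝ≥0∞) ∂(P : Measure ℝ≥0) ≠ ∞)
    (hmean : mean P ≠ 0) : ∫⁻ x, ENNReal.ofReal (stationaryDensity P x) = 1 := by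
  have hm : (mean P : ℝ) ≠ 0 := by exact_mod_cast hmean
  have h := lintegral_stationaryDensity_Ioi hfin hmean (le_refl 0)
  rw [laplace_zero, sub_self, laplaceMoment_one_zero, div_self hm, ENNReal.ofReal_one] at h
  rw [← lintegral_add_compl _ (measurableSet_Ioi (a := (0 : ℝ))), h, compl_Ioi,
    lintegral_stationaryDensity_Iic_zero, add_zero]

end Laplace

/-! ### The transient law -/

section Transient

variable {P : ProbabilityMeasure ℝ≥0}

/-- The Galois connection of the generalized inverse: right-continuity puts the infimum into the
set. Nonemptiness of the set rules out the default infimum `0`. -/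
lemma lt_genInv_iff {h : ℝ≥0 → ℝ} (hm : Monotone h) (hc : ∀ y, ContinuousWithinAt h (Ici y) y)
    {u : ℝ} (hu : ∃ y, u ≤ h y) (y : ℝ≥0) : y < genInv h u ↔ h y < u := by
  rw [← not_le, ← not_le, not_iff_not]
  constructor
  · intro hle
    have h1 : ∀ z, y < z → u ≤ h z := by
      intro z hz
      obtain ⟨x, hx, hxz⟩ := exists_lt_of_csInf_lt (s := {y | u ≤ h y}) hu (hle.trans_lt hz)
      exact le_trans hx (hm hxz.le)
    have h2 : Tendsto h (𝓝[>] y) (𝓝 (h y)) := (hc y).mono Ioi_subset_Ici_self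
    exact ge_of_tendsto h2 (eventually_nhdsWithin_of_forall h1)
  · exact fun hle => csInf_le (OrderBot.bddBelow _) hle

lemma genInv_mono {h : ℝ≥0 → ℝ} (hm : Monotone h) (hc : ∀ y, ContinuousWithinAt h (Ici y) y)
    {u u' : ℝ} (huu : u ≤ u') (hu : ∃ y, u' ≤ h y) : genInv h u ≤ genInv h u' := by
  by_contra hlt
  have h1 := (lt_genInv_iff hm hc (hu.imp fun y hy => huu.trans hy) _).1 (not_le.1 hlt)
  exact lt_irrefl _ ((lt_genInv_iff hm hc hu _).2 (h1.trans_le huu))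

lemma gPlus_eq_integral_indicator (t y : ℝ≥0) : gPlus P t y =
    ∫ z, (Ioi y).indicator (fun z : ℝ≥0 => Real.exp (-((z : ℝ) * t))) z ∂(P : Measure ℝ≥0) :=
  (integral_indicator measurableSet_Ioi).symm

lemma gPlus_nonneg (t y : ℝ≥0) : 0 ≤ gPlus P t y :=
  setIntegral_nonneg measurableSet_Ioi fun _ _ => (Real.exp_pos _).le

lemma gMinus_nonneg (t y : ℝ≥0) : 0 ≤ gMinus P t y :=
  setIntegral_nonneg measurableSet_Iic fun _ _ => (Real.exp_pos _).le

lemma gMinus_add_gPlus (t y : ℝ≥0) : gMinus P t y + gPlus P t y = laplace P t := by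
  rw [gMinus, gPlus, laplace, ← compl_Iic]
  exact integral_add_compl measurableSet_Iic (integrable_exp (NNReal.coe_nonneg t))

lemma gMinus_eq (t y : ℝ≥0) : gMinus P t y = laplace P t - gPlus P t y :=
  eq_sub_of_add_eq (gMinus_add_gPlus t y)

lemma gPlus_le_laplace (t y : ℝ≥0) : gPlus P t y ≤ laplace P t := by
  rw [← gMinus_add_gPlus t y]
  exact le_add_of_nonneg_left (gMinus_nonneg t y)

lemma norm_indicator_exp_le (s : Set ℝ≥0) (t z : ℝ≥0) :
    ‖s.indicator (fun z : ℝ≥0 => Real.exp (-((z : ℝ) * t))) z‖ ≤ 1 := by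
  refine (norm_indicator_le_norm_self _ _).trans ?_
  rw [Real.norm_of_nonneg (Real.exp_pos _).le]
  exact exp_neg_mul_le_one z (NNReal.coe_nonneg t)

lemma gPlus_antitone (t : ℝ≥0) : Antitone (gPlus P t) := by
  intro y y' hy
  exact setIntegral_mono_set (integrable_exp (NNReal.coe_nonneg t)).integrableOn
    (Filter.Eventually.of_forall fun z => (Real.exp_pos _).le)
    (Ioi_subset_Ioi hy).eventuallyLE

lemma gPlus_rightCts (t y : ℝ≥0) : ContinuousWithinAt (gPlus P t) (Ici y) y := by
  simp only [ContinuousWithinAt, funext (gPlus_eq_integral_indicator (P := P) t)]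
  refine tendsto_integral_filter_of_dominated_convergence (fun _ => (1 : ℝ))
    (Filter.Eventually.of_forall fun s => ?_)
    (Filter.Eventually.of_forall fun s => Filter.Eventually.of_forall fun z =>
      norm_indicator_exp_le _ t z) (integrable_const _) (Filter.Eventually.of_forall fun z => ?_)
  · exact (Measurable.indicator (by fun_prop) measurableSet_Ioi).aestronglyMeasurable
  · refine tendsto_const_nhds.congr' ?_
    rcases lt_or_ge y z with hz | hz
    · filter_upwards [mem_nhdsWithin_of_mem_nhds (Iio_mem_nhds hz)] with x hx
      rw [Set.indicator_of_mem (Set.mem_Ioi.2 hz), Set.indicator_of_mem (Set.mem_Ioi.2 hx)]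
    · filter_upwards [self_mem_nhdsWithin] with x hx
      have hx' : y ≤ x := hx
      rw [Set.indicator_of_notMem (by simpa using hz),
        Set.indicator_of_notMem (by simpa using hz.trans hx')]

lemma tendsto_gPlus (t : ℝ≥0) : Tendsto (gPlus P t) atTop (𝓝 0) := by
  have : (0 : ℝ) = ∫ _ : ℝ≥0, (0 : ℝ) ∂(P : Measure ℝ≥0) := by simp
  rw [this]
  simp only [funext (gPlus_eq_integral_indicator (P := P) t)]
  refine tendsto_integral_filter_of_dominated_convergence (fun _ => (1 : ℝ))
    (Filter.Eventually.of_forall fun s => ?_)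
    (Filter.Eventually.of_forall fun s => Filter.Eventually.of_forall fun z =>
      norm_indicator_exp_le _ t z) (integrable_const _) (Filter.Eventually.of_forall fun z => ?_)
  · exact (Measurable.indicator (by fun_prop) measurableSet_Ioi).aestronglyMeasurable
  · refine tendsto_const_nhds.congr' ?_
    filter_upwards [eventually_ge_atTop z] with x hx
    rw [Set.indicator_of_notMem (by simpa using hx)]

lemma gPlus_le_exp (t y : ℝ≥0) : gPlus P t y ≤ Real.exp (-(y * t)) := by
  have h : ∫ z in Ioi y, Real.exp (-((z : ℝ) * t)) ∂(P : Measure ℝ≥0) ≤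
      ∫ z in Ioi y, Real.exp (-(y * t)) ∂(P : Measure ℝ≥0) := by
    refine setIntegral_mono_on (integrable_exp (NNReal.coe_nonneg t)).integrableOn integrableOn_const
      measurableSet_Ioi fun z hz => ?_
    gcongr
    exact (Set.mem_Ioi.1 hz).le
  refine h.trans ?_
  rw [setIntegral_const, smul_eq_mul]
  exact mul_le_of_le_one_left (Real.exp_pos _).le measureReal_le_one

/-- Layer-cake formula for the function `z` and the measure `e^{-zt} P(dz)`. -/
lemma lintegral_gPlus (hfin : ∫⁻ x, (x : ℝ≥0∞) ∂(P : Measure ℝ≥0) ≠ ∞) (t : ℝ≥0) :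
    ∫⁻ y in Ioi (0 : ℝ), ENNReal.ofReal (gPlus P t y.toNNReal) =
      ENNReal.ofReal (laplaceMoment P 1 t) := by
  have hexp : Measurable fun z : ℝ≥0 => ENNReal.ofReal (Real.exp (-((z : ℝ) * t))) := by fun_prop
  have h1 := lintegral_eq_lintegral_meas_lt
    ((P : Measure ℝ≥0).withDensity fun z => ENNReal.ofReal (Real.exp (-((z : ℝ) * t))))
    (f := fun z : ℝ≥0 => (z : ℝ)) (Filter.Eventually.of_forall fun z => z.2) (by fun_prop)
  have h2 : ∫⁻ y in Ioi (0 : ℝ), ENNReal.ofReal (gPlus P t y.toNNReal) =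
      ∫⁻ y in Ioi (0 : ℝ), ((P : Measure ℝ≥0).withDensity
        fun z => ENNReal.ofReal (Real.exp (-((z : ℝ) * t)))) {z : ℝ≥0 | y < z} := by
    refine setLIntegral_congr_fun measurableSet_Ioi fun y hy => ?_
    have hset : {z : ℝ≥0 | y < z} = Ioi y.toNNReal := by
      ext z
      exact (Real.toNNReal_lt_iff_lt_coe (le_of_lt hy)).symm
    rw [hset, withDensity_apply _ measurableSet_Ioi, gPlus,
      ofReal_integral_eq_lintegral_ofReal (integrable_exp (NNReal.coe_nonneg t)).integrableOn
      (Filter.Eventually.of_forall fun z => (Real.exp_pos _).le)]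
  rw [h2, ← h1, lintegral_withDensity_eq_lintegral_mul _ hexp (by fun_prop), laplaceMoment,
    ofReal_integral_eq_lintegral_ofReal]
  · refine lintegral_congr fun z => ?_
    simp only [Pi.mul_apply, pow_one]
    rw [ENNReal.ofReal_mul (NNReal.coe_nonneg z), mul_comm]
  · simpa using integrable_mul_exp hfin (NNReal.coe_nonneg t)
  · exact Filter.Eventually.of_forall fun z => by positivity

/-- The relation between the tail of `g t` and the Laplace transform of `P` on half-lines, and its
counterpart for finite sequences that are ordered according to `R`. -/
structure IsProfile (P : ProbabilityMeasure ℝ≥0) (g : ℝ≥0 → ℝ → ℝ) (Θ : ℝ → ℝ → ℝ → ℝ)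
    (R : ∀ n, (Fin n → ℝ≥0) → Prop) : Prop where
  nonneg : ∀ t x, 0 ≤ g t x
  aemeasurable : ∀ t : ℝ≥0, AEMeasurable (g t) (volume.restrict (Ioo (1 - laplace P t) 1))
  volume_eq : ∀ (t : ℝ≥0) (x₀ : ℝ) (y : ℝ≥0), 1 - laplace P t ≤ x₀ → x₀ ≤ 1 →
    volume ({x | (y : ℝ) < g t x} ∩ Ioo x₀ 1) =
      ENNReal.ofReal (Θ (1 - x₀) (laplace P t) (gPlus P t y))
  continuous : Continuous fun q : ℝ × ℝ × ℝ => Θ q.1 q.2.1 q.2.2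
  self : ∀ φ γ, 0 ≤ γ → γ ≤ φ → Θ φ φ γ = γ
  bounds : ∀ c φ γ, 0 ≤ c → c ≤ φ → 0 ≤ γ → 0 ≤ Θ c φ γ ∧ Θ c φ γ ≤ γ
  smul : ∀ n v (c : ℝ≥0), R n v → R n fun i => c * v i
  sum_eq : ∀ n v, R n v → ∀ (e : Fin n → ℝ), (∀ i, 0 ≤ e i) → ∀ (k : ℕ) (y : ℝ≥0),
    ∑ j ∈ Finset.univ.filter fun j : Fin n => k ≤ (j : ℕ) ∧ y < v j, e j =
      Θ (∑ j ∈ Finset.univ.filter fun j : Fin n => k ≤ (j : ℕ), e j) (∑ j, e j)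
      (∑ j with y < v j, e j)

/-- Here `y < g̃_t(x)` means `x < 1 - gMinus y`, an interval cut from the right, of length `(1 - x₀)
- (φ - gPlus y)` if positive. For decreasing sequences, as soon as `{j ≥ k}` meets the initial
segment `{v j > y}`, it contains the whole complement `{v j ≤ y}`, whose mass is `φ - γ`; this gives
the same positive part. -/
lemma isProfile_gTildeMinus (P : ProbabilityMeasure ℝ≥0) : IsProfile P (fun t x => gTildeMinus P t x)
    (fun c φ γ => max 0 (c - φ + γ)) (fun _ v => Antitone v) := by
  have hm : ∀ t, Monotone (gMinus P t) := fun t y y' h => by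
    rw [gMinus_eq, gMinus_eq]
    linarith [gPlus_antitone (P := P) t h]
  have hc : ∀ t y, ContinuousWithinAt (gMinus P t) (Ici y) y := fun t y => by
    rw [funext (gMinus_eq (P := P) t)]
    exact continuousWithinAt_const.sub (gPlus_rightCts t y)
  have hne : ∀ (t : ℝ≥0) (x : ℝ), 1 - laplace P t < x → ∃ y, 1 - x ≤ gMinus P t y := by
    intro t x hx
    have h := (tendsto_gPlus (P := P) t).eventually_lt_const
      (show 0 < laplace P t - (1 - x) by linarith)
    obtain ⟨y, hy⟩ := h.exists
    exact ⟨y, by rw [gMinus_eq]; linarith⟩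
  refine ⟨fun t x => NNReal.coe_nonneg _, fun t => ?_, fun t x₀ y hx₀ hx₁ => ?_, by fun_prop, ?_, ?_,
    fun n v c hv i j hij => mul_le_mul_right (hv hij) _, ?_⟩
  · refine aemeasurable_restrict_of_antitoneOn measurableSet_Ioo fun x hx x' hx' hxx => ?_
    exact NNReal.coe_le_coe.2 (genInv_mono (hm t) (hc t) (by linarith) (hne t x hx.1))
  · have hset : {x : ℝ | (y : ℝ) < gTildeMinus P t x} ∩ Ioo x₀ 1 = Ioo x₀ (1 - gMinus P t y) := by
      ext x
      have h0 := gMinus_nonneg (P := P) t y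
      constructor
      · rintro ⟨h1, h2⟩
        have h3 := (lt_genInv_iff (hm t) (hc t) (hne t x (hx₀.trans_lt h2.1)) y).1
          (NNReal.coe_lt_coe.1 h1)
        exact ⟨h2.1, by linarith⟩
      · rintro ⟨h1, h2⟩
        refine ⟨NNReal.coe_lt_coe.2 ((lt_genInv_iff (hm t) (hc t) (hne t x (hx₀.trans_lt h1)) y).2
          (by linarith)), h1, by linarith⟩
    rw [hset, Real.volume_Ioo, gMinus_eq, ENNReal.ofReal_max, ENNReal.ofReal_zero, max_eq_right (zero_le)]
    congr 1
    ring
  · intro φ γ h0 _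
    simp [h0]
  · intro c φ γ _ h1 h2
    exact ⟨le_max_left _ _, max_le h2 (by linarith)⟩
  · intro n v hv e he k y
    have h1 := Finset.sum_filter_add_sum_filter_not Finset.univ (fun j => y < v j) e
    have h2 := Finset.sum_filter_add_sum_filter_not (Finset.univ.filter fun j : Fin n => k ≤ (j : ℕ))
      (fun j => y < v j) e
    rw [Finset.filter_filter, Finset.filter_filter] at h2
    by_cases h : ∃ j : Fin n, k ≤ (j : ℕ) ∧ y < v j
    · obtain ⟨j, hkj, hyj⟩ := h
      have h3 : (Finset.univ.filter fun i : Fin n => k ≤ (i : ℕ) ∧ ¬ y < v i) =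
          Finset.univ.filter fun i => ¬ y < v i := by
        ext i
        simp only [Finset.mem_filter, Finset.mem_univ, true_and, and_iff_right_iff_imp]
        intro hi
        by_contra hik
        have : i ≤ j := by
          rw [Fin.le_def]
          omega
        exact hi (hyj.trans_le (hv this))
      rw [h3] at h2
      have h4 : 0 ≤ ∑ j ∈ Finset.univ.filter fun j : Fin n => k ≤ (j : ℕ) ∧ y < v j, e j := Finset.sum_nonneg fun i _ => he i
      rw [max_eq_right] <;> linarith
    · push Not at h
      have h3 : (Finset.univ.filter fun i : Fin n => k ≤ (i : ℕ) ∧ y < v i) = ∅ := by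
        refine Finset.filter_eq_empty_iff.2 fun i _ hi => ?_
        exact not_lt.2 (h i hi.1) hi.2
      have h4 : ∑ j ∈ Finset.univ.filter fun j : Fin n => k ≤ (j : ℕ), e j ≤ ∑ j with ¬ y < v j, e j := by
        refine Finset.sum_le_sum_of_subset_of_nonneg (fun i hi => ?_) fun i _ _ => he i
        simp only [Finset.mem_filter, Finset.mem_univ, true_and] at hi ⊢
        exact not_lt.2 (h i hi)
      rw [h3, Finset.sum_empty, max_eq_left]
      linarith

/-- Here `y < g̃_t(x)` means `x > 1 - gPlus y`, so two intervals ending at `1` are intersected.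
Likewise `{j ≥ k}` and `{v j > y}` are both final segments of an increasing sequence, hence nested,
and the smaller mass counts. -/
lemma isProfile_gTildePlus (P : ProbabilityMeasure ℝ≥0) : IsProfile P (fun t x => gTildePlus P t x)
    (fun c _ γ => min c γ) (fun _ v => Monotone v) := by
  have hm : ∀ t, Monotone (fun z => 1 - gPlus P t z) := fun t y y' h => by
    dsimp only
    linarith [gPlus_antitone (P := P) t h]
  have hc : ∀ t y, ContinuousWithinAt (fun z => 1 - gPlus P t z) (Ici y) y := fun t y =>
    continuousWithinAt_const.sub (gPlus_rightCts t y)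
  have hne : ∀ (t : ℝ≥0) (x : ℝ), x < 1 → ∃ y, x ≤ 1 - gPlus P t y := by
    intro t x hx
    have h := (tendsto_gPlus (P := P) t).eventually_lt_const (show 0 < 1 - x by linarith)
    obtain ⟨y, hy⟩ := h.exists
    exact ⟨y, by linarith⟩
  refine ⟨fun t x => NNReal.coe_nonneg _, fun t => ?_, fun t x₀ y hx₀ hx₁ => ?_, by fun_prop, ?_, ?_,
    fun n v c hv i j hij => mul_le_mul_right (hv hij) _, ?_⟩
  · refine aemeasurable_restrict_of_monotoneOn measurableSet_Ioo fun x hx x' hx' hxx => ?_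
    exact NNReal.coe_le_coe.2 (genInv_mono (hm t) (hc t) hxx (hne t x' hx'.2))
  · have hset : {x : ℝ | (y : ℝ) < gTildePlus P t x} ∩ Ioo x₀ 1 =
        Ioo (max x₀ (1 - gPlus P t y)) 1 := by
      ext x
      constructor
      · rintro ⟨h1, h2⟩
        have h3 := (lt_genInv_iff (hm t) (hc t) (hne t x h2.2) y).1 (NNReal.coe_lt_coe.1 h1)
        exact ⟨max_lt h2.1 h3, h2.2⟩
      · rintro ⟨h1, h2⟩
        rw [max_lt_iff] at h1
        exact ⟨NNReal.coe_lt_coe.2 ((lt_genInv_iff (hm t) (hc t) (hne t x h2) y).2 h1.2),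
          h1.1, h2⟩
    rw [hset, Real.volume_Ioo, ← min_sub_sub_left, sub_sub_cancel]
  · intro φ γ _ h0
    simp [h0]
  · intro c φ γ h0 _ h2
    exact ⟨le_min h0 h2, min_le_right _ _⟩
  · intro n v hv e he k y
    by_cases h : ∀ j : Fin n, k ≤ (j : ℕ) → y < v j
    · have h3 : (Finset.univ.filter fun i : Fin n => k ≤ (i : ℕ) ∧ y < v i) =
          Finset.univ.filter fun i : Fin n => k ≤ (i : ℕ) :=
        Finset.filter_congr fun i _ => and_iff_left_of_imp (h i)
      rw [h3, min_eq_left]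
      refine Finset.sum_le_sum_of_subset_of_nonneg (fun i hi => ?_) fun i _ _ => he i
      simp only [Finset.mem_filter, Finset.mem_univ, true_and] at hi ⊢
      exact h i hi
    · push Not at h
      obtain ⟨j, hkj, hyj⟩ := h
      have h2 : ∀ i : Fin n, y < v i → k ≤ (i : ℕ) := by
        intro i hi
        by_contra hik
        have : i ≤ j := by
          rw [Fin.le_def]
          omega
        exact absurd (hi.trans_le (hv this)) (not_lt.2 hyj)
      have h3 : (Finset.univ.filter fun i : Fin n => k ≤ (i : ℕ) ∧ y < v i) =
          Finset.univ.filter fun i : Fin n => y < v i :=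
        Finset.filter_congr fun i _ => and_iff_right_of_imp (h2 i)
      rw [h3, min_eq_right]
      refine Finset.sum_le_sum_of_subset_of_nonneg (fun i hi => ?_) fun i _ _ => he i
      simp only [Finset.mem_filter, Finset.mem_univ, true_and] at hi ⊢
      exact h2 i hi

variable {g : ℝ≥0 → ℝ → ℝ} {Θ : ℝ → ℝ → ℝ → ℝ} {R : ∀ n, (Fin n → ℝ≥0) → Prop}

lemma aemeasurable_transientDensity (hfin : ∫⁻ x, (x : ℝ≥0∞) ∂(P : Measure ℝ≥0) ≠ ∞)
    (hmean : mean P ≠ 0) (hg : IsProfile P g Θ R) (t : ℝ≥0) :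
    AEMeasurable (transientDensity P g t) volume := by
  refine AEMeasurable.add ((aemeasurable_stationaryDensity hfin hmean).indicator measurableSet_Icc) ?_
  rw [aemeasurable_indicator_iff measurableSet_Icc, ← restrict_Ioo_eq_restrict_Icc]
  exact (hg.aemeasurable t).const_mul _

lemma transientDensity_nonneg_ae (hfin : ∫⁻ x, (x : ℝ≥0∞) ∂(P : Measure ℝ≥0) ≠ ∞)
    (hmean : mean P ≠ 0) (hg : IsProfile P g Θ R) (t : ℝ≥0) :
    ∀ᵐ x, 0 ≤ transientDensity P g t x := by
  filter_upwards [stationaryDensity_nonneg_ae hfin hmean] with x hx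
  refine add_nonneg (Set.indicator_apply_nonneg fun _ => hx) (Set.indicator_apply_nonneg fun _ => ?_)
  exact mul_nonneg (one_div_nonneg.2 (NNReal.coe_nonneg (mean P))) (hg.nonneg t x)

lemma laplace_le_one (P : ProbabilityMeasure ℝ≥0) {t : ℝ} (ht : 0 ≤ t) : laplace P t ≤ 1 := by
  have h := integral_mono (integrable_exp (P := P) ht) (integrable_const 1)
    fun z => exp_neg_mul_le_one z ht
  simpa [laplace] using h

lemma transientDensity_eq_stationaryDensity (P : ProbabilityMeasure ℝ≥0) (g : ℝ≥0 → ℝ → ℝ)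
    {t : ℝ≥0} {x : ℝ} (hx : x < 1 - laplace P t) :
    transientDensity P g t x = stationaryDensity P x := by
  rw [transientDensity, Set.indicator_of_notMem (s := Icc (1 - laplace P t) 1)
    fun h => not_lt.2 h.1 hx, add_zero]
  by_cases h0 : 0 ≤ x
  · rw [Set.indicator_of_mem (show x ∈ Icc 0 (1 - laplace P t) from ⟨h0, hx.le⟩)]
  · rw [Set.indicator_of_notMem fun h => h0 h.1, stationaryDensity,
      Set.indicator_of_notMem fun h => h0 h.1]

/-- Layer-cake formula for `g t` on `(x₀, 1)`, the level sets being measured by the profile. -/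
lemma lintegral_transientDensity_Ioi (hg : IsProfile P g Θ R) (t : ℝ≥0) {x₀ : ℝ}
    (hx₀ : 1 - laplace P t ≤ x₀) (hx₁ : x₀ ≤ 1) :
    ∫⁻ x in Ioi x₀, ENNReal.ofReal (transientDensity P g t x) = ENNReal.ofReal (1 / mean P) *
      ∫⁻ y in Ioi (0 : ℝ), ENNReal.ofReal (Θ (1 - x₀) (laplace P t) (gPlus P t y.toNNReal)) := by
  have hm : (0 : ℝ) ≤ 1 / mean P := one_div_nonneg.2 (NNReal.coe_nonneg (mean P))
  have h1 : ∫⁻ x in Ioi x₀, ENNReal.ofReal (transientDensity P g t x) =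
      ∫⁻ x in Ioo x₀ 1, ENNReal.ofReal (1 / mean P) * ENNReal.ofReal (g t x) := by
    rw [← lintegral_indicator measurableSet_Ioi, ← lintegral_indicator measurableSet_Ioo]
    refine lintegral_congr_ae ?_
    filter_upwards [Measure.ae_ne volume (1 : ℝ)] with x hx
    by_cases hx0 : x₀ < x
    · have hnot : x ∉ Icc 0 (1 - laplace P t) := fun h => by linarith [h.2]
      rw [Set.indicator_of_mem (Set.mem_Ioi.2 hx0), transientDensity,
        Set.indicator_of_notMem hnot, zero_add]
      by_cases hx1 : x < 1
      · rw [Set.indicator_of_mem (show x ∈ Ioo x₀ 1 from ⟨hx0, hx1⟩), Set.indicator_of_mem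
          (show x ∈ Icc (1 - laplace P t) 1 from ⟨by linarith, hx1.le⟩), ENNReal.ofReal_mul hm]
      · rw [Set.indicator_of_notMem (s := Ioo x₀ 1) fun h => hx1 h.2, Set.indicator_of_notMem
          (s := Icc (1 - laplace P t) 1) fun h => hx1 (lt_of_le_of_ne h.2 hx), ENNReal.ofReal_zero]
    · rw [Set.indicator_of_notMem (s := Ioo x₀ 1) fun h => hx0 h.1, Set.indicator_of_notMem
        (s := Ioi x₀) fun h => hx0 h]
  have hae : AEMeasurable (g t) (volume.restrict (Ioo x₀ 1)) :=
    (hg.aemeasurable t).mono_measure (Measure.restrict_mono (Ioo_subset_Ioo_left hx₀) le_rfl)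
  rw [h1, lintegral_const_mul'' _ hae.ennreal_ofReal, lintegral_eq_lintegral_meas_lt _
    (Filter.Eventually.of_forall fun x => hg.nonneg t x) hae]
  congr 1
  refine setLIntegral_congr_fun measurableSet_Ioi fun y hy => ?_
  rw [Measure.restrict_apply' measurableSet_Ioo, ← hg.volume_eq t x₀ _ hx₀ hx₁,
    Real.coe_toNNReal y (le_of_lt hy)]

/-- With nothing cut off, `Θ φ φ γ = γ` and the layers integrate to the first moment. This is the
mass of the stationary density on the same half-line, whatever the order of the weights. -/
lemma lintegral_transientDensity_Ioi_self (hfin : ∫⁻ x, (x : ℝ≥0∞) ∂(P : Measure ℝ≥0) ≠ ∞)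
    (hg : IsProfile P g Θ R) (t : ℝ≥0) :
    ∫⁻ x in Ioi (1 - laplace P t), ENNReal.ofReal (transientDensity P g t x) =
      ENNReal.ofReal (laplaceMoment P 1 t / mean P) := by
  have h0 : 0 ≤ laplace P t := (gPlus_nonneg t 0).trans (gPlus_le_laplace t 0)
  have hm : (0 : ℝ) ≤ 1 / mean P := one_div_nonneg.2 (NNReal.coe_nonneg (mean P))
  rw [lintegral_transientDensity_Ioi hg t le_rfl (by linarith), sub_sub_cancel,
    show laplaceMoment P 1 t / mean P = 1 / mean P * laplaceMoment P 1 t by ring, ENNReal.ofReal_mul hm, ← lintegral_gPlus hfin t]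
  congr 1
  refine lintegral_congr fun y => ?_
  rw [hg.self _ _ (gPlus_nonneg _ _) (gPlus_le_laplace _ _)]

/-- Both densities have the same mass beyond `1 - φ(t)` and agree before it. -/
lemma lintegral_transientDensity_Ioi_of_le (hfin : ∫⁻ x, (x : ℝ≥0∞) ∂(P : Measure ℝ≥0) ≠ ∞)
    (hmean : mean P ≠ 0) (hg : IsProfile P g Θ R) {t u : ℝ≥0} (hut : u ≤ t) :
    ∫⁻ x in Ioi (1 - laplace P u), ENNReal.ofReal (transientDensity P g t x) =
      ENNReal.ofReal (laplaceMoment P 1 u / mean P) := by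
  have hle : 1 - laplace P u ≤ 1 - laplace P t := by
    have := (strictAntiOn_laplace hfin hmean).antitoneOn (NNReal.coe_nonneg u) (NNReal.coe_nonneg t) (NNReal.coe_le_coe.2 hut)
    linarith
  have hcongr : ∫⁻ x in Ioc (1 - laplace P u) (1 - laplace P t),
      ENNReal.ofReal (transientDensity P g t x) =
      ∫⁻ x in Ioc (1 - laplace P u) (1 - laplace P t), ENNReal.ofReal (stationaryDensity P x) := by
    rw [← restrict_Ioo_eq_restrict_Ioc]
    refine setLIntegral_congr_fun measurableSet_Ioo fun x hx => ?_
    rw [transientDensity_eq_stationaryDensity P g hx.2]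
  have hst := lintegral_stationaryDensity_Ioi hfin hmean (NNReal.coe_nonneg t)
  have hsu := lintegral_stationaryDensity_Ioi hfin hmean (NNReal.coe_nonneg u)
  have hdisj : Disjoint (Ioc (1 - laplace P u) (1 - laplace P t)) (Ioi (1 - laplace P t)) :=
    Set.Ioc_disjoint_Ioi le_rfl
  rw [← hsu, ← Ioc_union_Ioi_eq_Ioi hle, lintegral_union measurableSet_Ioi hdisj,
    lintegral_union measurableSet_Ioi hdisj, hst, hcongr,
    lintegral_transientDensity_Ioi_self hfin hg t]

lemma lintegral_transientDensity (hfin : ∫⁻ x, (x : ℝ≥0∞) ∂(P : Measure ℝ≥0) ≠ ∞)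
    (hmean : mean P ≠ 0) (hg : IsProfile P g Θ R) (t : ℝ≥0) :
    ∫⁻ x, ENNReal.ofReal (transientDensity P g t x) = 1 := by
  have hm : (mean P : ℝ) ≠ 0 := by exact_mod_cast hmean
  have h := lintegral_transientDensity_Ioi_of_le hfin hmean hg (zero_le (a := t))
  rw [NNReal.coe_zero, laplace_zero, sub_self, laplaceMoment_one_zero, div_self hm,
    ENNReal.ofReal_one] at h
  have h1 : ∫⁻ x in Iic 0, ENNReal.ofReal (transientDensity P g t x) = 0 := by
    rw [← lintegral_stationaryDensity_Iic_zero (P := P), ← restrict_Iio_eq_restrict_Iic]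
    refine setLIntegral_congr_fun measurableSet_Iio fun x hx => ?_
    have := laplace_le_one P (NNReal.coe_nonneg t)
    rw [transientDensity_eq_stationaryDensity P g (by have : x < 0 := hx; linarith)]
  rw [← lintegral_add_compl _ (measurableSet_Ioi (a := (0 : ℝ))), h, compl_Ioi, h1, add_zero]

/-! ### The limiting probability laws -/

/-- The probability law with density `f`. -/
noncomputable def lawOfDensity (f : ℝ → ℝ) (hf : ∫⁻ x, ENNReal.ofReal (f x) = 1) : ProbabilityMeasure ℝ :=
  ⟨volume.withDensity fun x => ENNReal.ofReal (f x), ⟨by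
    rw [withDensity_apply _ MeasurableSet.univ, Measure.restrict_univ, hf]⟩⟩

lemma lawOfDensity_real {f : ℝ → ℝ} (hf : ∫⁻ x, ENNReal.ofReal (f x) = 1) {s : Set ℝ}
    (hs : MeasurableSet s) : (lawOfDensity f hf : Measure ℝ).real s =
      (∫⁻ x in s, ENNReal.ofReal (f x)).toReal := by
  rw [measureReal_def, lawOfDensity, ProbabilityMeasure.coe_mk, withDensity_apply _ hs]

/-- The Hahn decomposition: `i` carries the positive part and its complement the negative part. -/
lemma totalVariation_univ_eq {α : Type*} [MeasurableSpace α] (s : SignedMeasure α) :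
    ∃ i, MeasurableSet i ∧ s.totalVariation univ = ENNReal.ofReal (s i) + ENNReal.ofReal (-s iᶜ) := by
  obtain ⟨i, hi, h1, h2, h3, h4⟩ := s.toJordanDecomposition_spec
  refine ⟨i, hi, ?_⟩
  rw [SignedMeasure.totalVariation, Measure.add_apply, h3, h4,
    SignedMeasure.toMeasureOfZeroLE_apply _ _ hi MeasurableSet.univ,
    SignedMeasure.toMeasureOfLEZero_apply _ _ hi.compl MeasurableSet.univ]
  simp only [Set.inter_univ]
  congr 1
  · rw [ENNReal.ofReal_eq_coe_nnreal]
  · rw [ENNReal.ofReal_eq_coe_nnreal]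

/-- Two laws that coincide on the subsets of `B` are at most `Q Bᶜ + Q' Bᶜ` apart. -/
lemma tvDist_le {Q Q' : ProbabilityMeasure ℝ} {B : Set ℝ} (hB : MeasurableSet B)
    (h : ∀ s, MeasurableSet s → (Q : Measure ℝ).real (s ∩ B) = (Q' : Measure ℝ).real (s ∩ B)) :
    tvDist Q Q' ≤ ENNReal.ofReal ((Q : Measure ℝ).real Bᶜ + (Q' : Measure ℝ).real Bᶜ) := by
  obtain ⟨i, hi, htv⟩ := totalVariation_univ_eq
    ((Q : Measure ℝ).toSignedMeasure - (Q' : Measure ℝ).toSignedMeasure)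
  have hsplit : ∀ (Q : ProbabilityMeasure ℝ) s, (Q : Measure ℝ).real s =
      (Q : Measure ℝ).real (s ∩ B) + (Q : Measure ℝ).real (s \ B) :=
    fun Q s => (measureReal_inter_add_sdiff hB).symm
  have hle : ∀ (Q : ProbabilityMeasure ℝ) s, (Q : Measure ℝ).real (s \ B) ≤
      (Q : Measure ℝ).real Bᶜ := fun Q s => measureReal_mono fun x hx => hx.2
  rw [tvDist, htv, _root_.sub_apply, _root_.sub_apply,
    Measure.toSignedMeasure_apply_measurable hi, Measure.toSignedMeasure_apply_measurable hi,
    Measure.toSignedMeasure_apply_measurable hi.compl,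
    Measure.toSignedMeasure_apply_measurable hi.compl,
    ENNReal.ofReal_add measureReal_nonneg measureReal_nonneg]
  -- On each Hahn piece the contributions inside `B` cancel; what remains is bounded by the mass
  -- outside `B` of one law only.
  refine add_le_add (ENNReal.ofReal_le_ofReal ?_) (ENNReal.ofReal_le_ofReal ?_)
  · rw [hsplit Q i, hsplit Q' i, h i hi]
    have := hle Q i
    have : 0 ≤ (Q' : Measure ℝ).real (i \ B) := measureReal_nonneg
    linarith
  · rw [hsplit Q iᶜ, hsplit Q' iᶜ, h iᶜ hi.compl]
    have := hle Q' iᶜ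
    have : 0 ≤ (Q : Measure ℝ).real (iᶜ \ B) := measureReal_nonneg
    linarith

end Transient

/-! ### Limits along sequences of weights -/

section Limits

variable {P : ProbabilityMeasure ℝ≥0} {ι : Type*} {l : Filter ι} {ν : ι → ProbabilityMeasure ℝ≥0}

lemma tendsto_integral_of_bounded (hν : Tendsto ν l (𝓝 P)) {f : ℝ≥0 → ℝ} (hf : Continuous f) {C : ℝ}
    (h0 : ∀ z, 0 ≤ f z) (hC : ∀ z, f z ≤ C) :
    Tendsto (fun i => ∫ z, f z ∂(ν i : Measure ℝ≥0)) l (𝓝 (∫ z, f z ∂(P : Measure ℝ≥0))) :=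
  (ProbabilityMeasure.tendsto_iff_forall_integral_tendsto.1 hν)
    (BoundedContinuousFunction.ofNormedAddCommGroup f hf C fun z => by
      rw [Real.norm_of_nonneg (h0 z)]
      exact hC z)

lemma tendsto_laplace_of_tendsto (hν : Tendsto ν l (𝓝 P)) {u : ℝ} (hu : 0 ≤ u) :
    Tendsto (fun i => laplace (ν i) u) l (𝓝 (laplace P u)) :=
  tendsto_integral_of_bounded hν (by fun_prop) (fun z => (Real.exp_pos _).le)
    fun z => exp_neg_mul_le_one z hu

lemma tendsto_laplaceMoment_of_tendsto (hν : Tendsto ν l (𝓝 P)) (k : ℕ) {u : ℝ} (hu : 0 < u) :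
    Tendsto (fun i => laplaceMoment (ν i) k u) l (𝓝 (laplaceMoment P k u)) :=
  tendsto_integral_of_bounded hν (by fun_prop) (fun z => by positivity)
    fun z => pow_mul_exp_le k hu z

/-- A continuous function between the indicators of `(y, ∞)` and of `(y', ∞)`, times `e^{-zt}`. -/
noncomputable def rampExp (t : ℝ≥0) (y y' : ℝ≥0) (z : ℝ≥0) : ℝ :=
  min 1 (max 0 (((z : ℝ) - y) / (y' - y))) * Real.exp (-((z : ℝ) * t))

lemma continuous_rampExp (t y y' : ℝ≥0) : Continuous (rampExp t y y') := by
  unfold rampExp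
  fun_prop

lemma rampExp_nonneg (t y y' z : ℝ≥0) : 0 ≤ rampExp t y y' z :=
  mul_nonneg (le_min zero_le_one (le_max_left _ _)) (Real.exp_pos _).le

lemma rampExp_le_exp (t y y' z : ℝ≥0) : rampExp t y y' z ≤ Real.exp (-((z : ℝ) * t)) :=
  mul_le_of_le_one_left (Real.exp_pos _).le (min_le_left _ _)

lemma integrable_rampExp (t y y' : ℝ≥0) : Integrable (rampExp t y y') (P : Measure ℝ≥0) := by
  refine (integrable_exp (P := P) t.2).mono' (continuous_rampExp t y y').aestronglyMeasurable
    (Filter.Eventually.of_forall fun z => ?_)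
  rw [Real.norm_of_nonneg (rampExp_nonneg _ _ _ _)]
  exact rampExp_le_exp t y y' z

lemma integrable_indicator_exp (t y : ℝ≥0) : Integrable
    ((Ioi y).indicator (fun z : ℝ≥0 => Real.exp (-((z : ℝ) * t)))) (P : Measure ℝ≥0) :=
  (integrable_exp t.2).indicator measurableSet_Ioi

lemma integral_rampExp_le {t y y' : ℝ≥0} (hy : y < y') :
    ∫ z, rampExp t y y' z ∂(P : Measure ℝ≥0) ≤ gPlus P t y := by
  rw [gPlus_eq_integral_indicator]
  refine integral_mono (integrable_rampExp t y y') (integrable_indicator_exp t y) fun z => ?_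
  have hyy : (0 : ℝ) < y' - y := sub_pos.2 (NNReal.coe_lt_coe.2 hy)
  by_cases hz : y < z
  · rw [Set.indicator_of_mem (Set.mem_Ioi.2 hz)]
    exact rampExp_le_exp t y y' z
  · rw [Set.indicator_of_notMem (by simpa using hz), rampExp, max_eq_left]
    · simp
    · refine div_nonpos_of_nonpos_of_nonneg (sub_nonpos.2 ?_) hyy.le
      exact NNReal.coe_le_coe.2 (not_lt.1 hz)

lemma le_integral_rampExp {t y y' : ℝ≥0} (hy : y < y') :
    gPlus P t y' ≤ ∫ z, rampExp t y y' z ∂(P : Measure ℝ≥0) := by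
  rw [gPlus_eq_integral_indicator]
  refine integral_mono (integrable_indicator_exp t y') (integrable_rampExp t y y') fun z => ?_
  have hyy : (0 : ℝ) < y' - y := sub_pos.2 (NNReal.coe_lt_coe.2 hy)
  by_cases hz : y' < z
  · have hz' : (y' : ℝ) < z := NNReal.coe_lt_coe.2 hz
    rw [Set.indicator_of_mem (Set.mem_Ioi.2 hz), rampExp, min_eq_left, one_mul]
    refine le_max_of_le_right ((one_le_div hyy).2 ?_)
    linarith
  · rw [Set.indicator_of_notMem (by simpa using hz)]
    exact rampExp_nonneg _ _ _ _

/-- The discontinuous cutoff at `y` is squeezed between ramps on either side, to which weak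
convergence applies; continuity of the limit at `y` closes the gap. -/
lemma tendsto_gPlus_of_tendsto (hν : Tendsto ν l (𝓝 P)) (t : ℝ≥0) {y : ℝ≥0} (hy : 0 < y)
    (hc : ContinuousAt (gPlus P t) y) :
    Tendsto (fun i => gPlus (ν i) t y) l (𝓝 (gPlus P t y)) := by
  have hramp : ∀ a b, Tendsto (fun i => ∫ z, rampExp t a b z ∂(ν i : Measure ℝ≥0)) l
      (𝓝 (∫ z, rampExp t a b z ∂(P : Measure ℝ≥0))) := fun a b =>
    tendsto_integral_of_bounded hν (continuous_rampExp t a b) (rampExp_nonneg t a b)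
      fun z => (rampExp_le_exp t a b z).trans (exp_neg_mul_le_one z t.2)
  refine tendsto_order.2 ⟨fun b hb => ?_, fun b hb => ?_⟩
  · have : ∀ᶠ y' in 𝓝[>] y, b < gPlus P t y' :=
      (hc.eventually_const_lt hb).filter_mono nhdsWithin_le_nhds
    obtain ⟨y', hy', hyy⟩ := (this.and self_mem_nhdsWithin).exists
    filter_upwards [(hramp y y').eventually_const_lt (hy'.trans_le (le_integral_rampExp hyy))]
      with i hi
    exact hi.trans_le (integral_rampExp_le hyy)
  · have hne : (𝓝[<] y).NeBot := nhdsLT_neBot_of_exists_lt ⟨0, hy⟩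
    have : ∀ᶠ y' in 𝓝[<] y, gPlus P t y' < b :=
      (hc.eventually_lt_const hb).filter_mono nhdsWithin_le_nhds
    obtain ⟨y', hy', hyy⟩ := (this.and self_mem_nhdsWithin).exists
    filter_upwards [(hramp y' y).eventually_lt_const ((integral_rampExp_le hyy).trans_lt hy')]
      with i hi
    exact (le_integral_rampExp hyy).trans_lt hi

lemma ae_continuousAt_gPlus (P : ProbabilityMeasure ℝ≥0) (t : ℝ≥0) :
    ∀ᵐ y : ℝ, 0 < y → ContinuousAt (gPlus P t) y.toNNReal := by
  have h := ((gPlus_antitone (P := P) t).countable_not_continuousAt.image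
    (fun y : ℝ≥0 => (y : ℝ))).ae_notMem volume
  filter_upwards [h] with y hy hpos
  by_contra hc
  exact hy ⟨y.toNNReal, hc, Real.coe_toNNReal y hpos.le⟩

variable {g : ℝ≥0 → ℝ → ℝ} {Θ : ℝ → ℝ → ℝ → ℝ} {R : ∀ n, (Fin n → ℝ≥0) → Prop}

lemma integrableOn_exp_neg_mul {t : ℝ} (ht : 0 < t) :
    IntegrableOn (fun y : ℝ => Real.exp (-(y * t))) (Ioi 0) := by
  have := integrableOn_exp_mul_Ioi (neg_lt_zero.2 ht) 0
  simpa [mul_comm] using this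

lemma measurable_profile_gPlus (hg : IsProfile P g Θ R) (Q : ProbabilityMeasure ℝ≥0) (t : ℝ≥0)
    (c φ : ℝ) : Measurable fun y : ℝ => Θ c φ (gPlus Q t y.toNNReal) := by
  have h1 : Measurable fun y : ℝ => gPlus Q t y.toNNReal :=
    ((gPlus_antitone t).comp_monotone fun _ _ h => Real.toNNReal_mono h).measurable
  exact hg.continuous.measurable.comp (measurable_const.prodMk (measurable_const.prodMk h1))

lemma norm_profile_gPlus_le (hg : IsProfile P g Θ R) (Q : ProbabilityMeasure ℝ≥0) (t : ℝ≥0)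
    {c : ℝ} (hc0 : 0 ≤ c) (hc : c ≤ laplace Q t) {y : ℝ} (hy : 0 < y) :
    ‖Θ c (laplace Q t) (gPlus Q t y.toNNReal)‖ ≤ Real.exp (-(y * t)) := by
  obtain ⟨h1, h2⟩ := hg.bounds c (laplace Q t) (gPlus Q t y.toNNReal) hc0 hc (gPlus_nonneg _ _)
  rw [Real.norm_of_nonneg h1]
  refine h2.trans ((gPlus_le_exp t _).trans_eq ?_)
  rw [Real.coe_toNNReal y hy.le]

/-- Dominated convergence with bound `e^{-yt}`, integrable because `t > 0`; the monotone function
`gPlus P t` has only countably many discontinuities. -/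
lemma tendsto_integral_profile [l.IsCountablyGenerated] (hg : IsProfile P g Θ R)
    (hν : Tendsto ν l (𝓝 P)) {t : ℝ≥0} (ht : 0 < t) {c : ι → ℝ} {c₀ : ℝ}
    (hc : Tendsto c l (𝓝 c₀)) (hc0 : ∀ i, 0 ≤ c i) (hc1 : ∀ i, c i ≤ laplace (ν i) t) :
    Tendsto (fun i => ∫ y in Ioi (0 : ℝ), Θ (c i) (laplace (ν i) t) (gPlus (ν i) t y.toNNReal)) l
      (𝓝 (∫ y in Ioi (0 : ℝ), Θ c₀ (laplace P t) (gPlus P t y.toNNReal))) := by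
  refine tendsto_integral_filter_of_dominated_convergence (fun y : ℝ => Real.exp (-(y * t)))
    (Filter.Eventually.of_forall fun i =>
      (measurable_profile_gPlus hg _ _ _ _).aestronglyMeasurable)
    (Filter.Eventually.of_forall fun i => (ae_restrict_iff' measurableSet_Ioi).2
      (Filter.Eventually.of_forall fun y hy => norm_profile_gPlus_le hg _ _ (hc0 i) (hc1 i) hy))
    (integrableOn_exp_neg_mul ht) ?_
  rw [ae_restrict_iff' measurableSet_Ioi]
  filter_upwards [ae_continuousAt_gPlus P t] with y hy hpos
  have h := tendsto_gPlus_of_tendsto hν t (Real.toNNReal_pos.2 hpos) (hy hpos)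
  exact (hg.continuous.tendsto (c₀, laplace P t, gPlus P t y.toNNReal)).comp
    (hc.prodMk_nhds ((tendsto_laplace_of_tendsto hν t.2).prodMk_nhds h))

/-! ### Empirical measures -/

lemma integral_empiricalMeasure {n : ℕ+} (v : Fin n → ℝ≥0) (f : ℝ≥0 → ℝ) :
    ∫ z, f z ∂(empiricalMeasure v : Measure ℝ≥0) = ((n : ℕ) : ℝ)⁻¹ * ∑ j, f (v j) := by
  rw [empiricalMeasure, ProbabilityMeasure.coe_mk, integral_smul_measure,
    integral_finsetSum_measure fun j _ => integrable_dirac (by simp)]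
  simp

lemma gPlus_empiricalMeasure {n : ℕ+} (v : Fin n → ℝ≥0) (t y : ℝ≥0) :
    gPlus (empiricalMeasure v) t y =
      ∑ j ∈ Finset.univ.filter fun j => y < v j, ((n : ℕ) : ℝ)⁻¹ * Real.exp (-(v j * t)) := by
  rw [gPlus_eq_integral_indicator, integral_empiricalMeasure, Finset.mul_sum, Finset.sum_filter]
  refine Finset.sum_congr rfl fun j _ => ?_
  simp only [Set.indicator_apply, Set.mem_Ioi]
  split_ifs <;> simp

lemma laplace_empiricalMeasure {n : ℕ+} (v : Fin n → ℝ≥0) (t : ℝ) :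
    laplace (empiricalMeasure v) t = ∑ j, ((n : ℕ) : ℝ)⁻¹ * Real.exp (-(v j * t)) := by
  rw [laplace, integral_empiricalMeasure, Finset.mul_sum]

/-- Discrete layer-cake formula: `v j` is the length of `(0, v j)`, and for fixed `y` the sum over
`j ≥ k` with `v j > y` is a value of `Θ`. -/
lemma sum_tail_eq_integral (hg : IsProfile P g Θ R) {n : ℕ+} {v : Fin n → ℝ≥0} (hv : R n v)
    (t : ℝ≥0) (k : ℕ) :
    ∑ j ∈ Finset.univ.filter fun j : Fin n => k ≤ (j : ℕ),
        ((n : ℕ) : ℝ)⁻¹ * (v j * Real.exp (-(v j * t))) =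
      ∫ y in Ioi (0 : ℝ), Θ (∑ j ∈ Finset.univ.filter fun j : Fin n => k ≤ (j : ℕ),
        ((n : ℕ) : ℝ)⁻¹ * Real.exp (-(v j * t))) (laplace (empiricalMeasure v) t)
        (gPlus (empiricalMeasure v) t y.toNNReal) := by
  have h1 : ∀ (a : ℝ≥0) (e : ℝ), IntegrableOn ((Iio (a : ℝ)).indicator fun _ => e) (Ioi 0) := by
    intro a e
    refine (integrable_indicator_iff measurableSet_Iio).2 (integrableOn_const (C := e) ?_)
    rw [Measure.restrict_apply measurableSet_Iio, Set.inter_comm, Ioi_inter_Iio]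
    simp
  have h2 : ∀ (a : ℝ≥0) (e : ℝ), ∫ y in Ioi (0 : ℝ), (Iio (a : ℝ)).indicator (fun _ => e) y =
      a * e := by
    intro a e
    rw [integral_indicator_const _ measurableSet_Iio, measureReal_def,
      Measure.restrict_apply measurableSet_Iio, Set.inter_comm, Ioi_inter_Iio]
    simp
  have h3 : ∀ y ∈ Ioi (0 : ℝ), Θ (∑ j ∈ Finset.univ.filter fun j : Fin n => k ≤ (j : ℕ),
        ((n : ℕ) : ℝ)⁻¹ * Real.exp (-(v j * t))) (laplace (empiricalMeasure v) t)
        (gPlus (empiricalMeasure v) t y.toNNReal) =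
      ∑ j ∈ Finset.univ.filter fun j : Fin n => k ≤ (j : ℕ),
        (Iio (v j : ℝ)).indicator (fun _ => ((n : ℕ) : ℝ)⁻¹ * Real.exp (-(v j * t))) y := by
    intro y hy
    rw [gPlus_empiricalMeasure, laplace_empiricalMeasure, ← hg.sum_eq n v hv _
      (fun i => by positivity), ← Finset.filter_filter, Finset.sum_filter]
    refine Finset.sum_congr rfl fun j _ => ?_
    have : y.toNNReal < v j ↔ y < v j := Real.toNNReal_lt_iff_lt_coe (le_of_lt hy)
    simp only [Set.indicator_apply, Set.mem_Iio, this]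
  rw [setIntegral_congr_fun measurableSet_Ioi h3, integral_finsetSum _ fun j _ => h1 _ _]
  refine Finset.sum_congr rfl fun j _ => ?_
  rw [h2]
  ring

/-- A cutoff for which the sum over the tail is close to `c`. -/
lemma exists_cutoff {n : ℕ+} (e : Fin n → ℝ) (he0 : ∀ j, 0 ≤ e j) (he1 : ∀ j, e j ≤ 1)
    {c : ℝ} (hc0 : 0 ≤ c) (hc : c < ∑ j, ((n : ℕ) : ℝ)⁻¹ * e j) :
    ∃ k : ℕ, |∑ j ∈ Finset.univ.filter (fun j : Fin n => k ≤ (j : ℕ)), ((n : ℕ) : ℝ)⁻¹ * e j - c| ≤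
      ((n : ℕ) : ℝ)⁻¹ := by
  classical
  have hn : (0 : ℝ) ≤ ((n : ℕ) : ℝ)⁻¹ := by positivity
  set S : ℕ → ℝ := fun k =>
    ∑ j ∈ Finset.univ.filter (fun j : Fin n => k ≤ (j : ℕ)), ((n : ℕ) : ℝ)⁻¹ * e j with hS
  have hex : ∃ k, S k ≤ c := by
    refine ⟨n, ?_⟩
    have : Finset.univ.filter (fun j : Fin n => (n : ℕ) ≤ (j : ℕ)) = ∅ :=
      Finset.filter_eq_empty_iff.2 fun j _ => not_le.2 j.2
    simp only [hS, this, Finset.sum_empty]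
    exact hc0
  have hk := Nat.find_spec hex
  refine ⟨Nat.find hex, ?_⟩
  change |S (Nat.find hex) - c| ≤ _
  -- The least `k` whose tail sum is at most `c`. It is not `0`, since the full sum exceeds `c`; and
  -- going from `k` to `k + 1` loses at most `1 / n`.
  rcases hkk : Nat.find hex with _ | k
  · rw [hkk] at hk
    have : S 0 = ∑ j, ((n : ℕ) : ℝ)⁻¹ * e j := by simp [hS]
    linarith
  · rw [hkk] at hk
    have h1 : c < S k := by
      have := Nat.find_min hex (m := k) (by omega)
      exact not_le.1 this
    have h2 : S k ≤ S (k + 1) + ((n : ℕ) : ℝ)⁻¹ := by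
      by_cases hkn : k < n
      · have : Finset.univ.filter (fun j : Fin n => k ≤ (j : ℕ)) =
            insert ⟨k, hkn⟩ (Finset.univ.filter (fun j : Fin n => k + 1 ≤ (j : ℕ))) := by
          ext j
          simp only [Finset.mem_filter, Finset.mem_univ, true_and, Finset.mem_insert, Fin.ext_iff]
          omega
        simp only [hS]
        rw [this, Finset.sum_insert (by simp), add_comm]
        gcongr
        exact mul_le_of_le_one_right hn (he1 _)
      · have h3 : Finset.univ.filter (fun j : Fin n => k ≤ (j : ℕ)) = ∅ :=
          Finset.filter_eq_empty_iff.2 fun j _ h => hkn (lt_of_le_of_lt h j.2)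
        have h4 : 0 ≤ S (k + 1) := Finset.sum_nonneg fun j _ => mul_nonneg hn (he0 j)
        have h5 : S k = 0 := by simp only [hS, h3, Finset.sum_empty]
        linarith
    rw [abs_le]
    constructor <;> linarith

/-- The cutoff is chosen from the sum of the exponentials alone; the profile then forces the
weighted sum to converge as well. -/
lemma exists_cutoffs [l.IsCountablyGenerated] (hg : IsProfile P g Θ R) {n : ι → ℕ+}
    {v : ∀ i, Fin (n i) → ℝ≥0} (hn : Tendsto (fun i => (n i : ℕ)) l atTop)
    (hv : ∀ i, R (n i) (v i)) (hν : Tendsto (fun i => empiricalMeasure (v i)) l (𝓝 P))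
    {t : ℝ≥0} (ht : 0 < t) {c : ℝ} (hc0 : 0 ≤ c) (hc : c < laplace P t) :
    ∃ k : ι → ℕ, Tendsto (fun i => ∑ j ∈ Finset.univ.filter (fun j : Fin (n i) => k i ≤ (j : ℕ)),
        ((n i : ℕ) : ℝ)⁻¹ * Real.exp (-(v i j * t))) l (𝓝 c) ∧
      Tendsto (fun i => ∑ j ∈ Finset.univ.filter (fun j : Fin (n i) => k i ≤ (j : ℕ)),
        ((n i : ℕ) : ℝ)⁻¹ * (v i j * Real.exp (-(v i j * t)))) l
        (𝓝 (∫ y in Ioi (0 : ℝ), Θ c (laplace P t) (gPlus P t y.toNNReal))) := by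
  have hev : ∀ᶠ i in l, c < ∑ j, ((n i : ℕ) : ℝ)⁻¹ * Real.exp (-(v i j * t)) := by
    filter_upwards [(tendsto_laplace_of_tendsto hν t.2).eventually_const_lt hc] with i hi
    rwa [laplace_empiricalMeasure] at hi
  have hk : ∀ i, ∃ k : ℕ, c < ∑ j, ((n i : ℕ) : ℝ)⁻¹ * Real.exp (-(v i j * t)) →
      |∑ j ∈ Finset.univ.filter (fun j : Fin (n i) => k ≤ (j : ℕ)),
        ((n i : ℕ) : ℝ)⁻¹ * Real.exp (-(v i j * t)) - c| ≤ ((n i : ℕ) : ℝ)⁻¹ := by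
    intro i
    by_cases h : c < ∑ j, ((n i : ℕ) : ℝ)⁻¹ * Real.exp (-(v i j * t))
    · obtain ⟨k, hk⟩ := exists_cutoff _ (fun j => (Real.exp_pos _).le)
        (fun j => exp_neg_mul_le_one (v i j) t.2) hc0 h
      exact ⟨k, fun _ => hk⟩
    -- The default `0` is used only for indices outside an eventual set, where the choice does not
    -- matter.
    · exact ⟨0, fun h' => absurd h' h⟩
  choose k hk using hk
  have h1 : Tendsto (fun i => ∑ j ∈ Finset.univ.filter (fun j : Fin (n i) => k i ≤ (j : ℕ)),
      ((n i : ℕ) : ℝ)⁻¹ * Real.exp (-(v i j * t))) l (𝓝 c) := by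
    have hinv : Tendsto (fun i => ((n i : ℕ) : ℝ)⁻¹) l (𝓝 0) :=
      tendsto_inv_atTop_zero.comp (tendsto_natCast_atTop_atTop.comp hn)
    rw [tendsto_iff_norm_sub_tendsto_zero]
    refine squeeze_zero' (Filter.Eventually.of_forall fun i => norm_nonneg _) ?_ hinv
    filter_upwards [hev] with i hi using hk i hi
  refine ⟨k, h1, ?_⟩
  have h2 := tendsto_integral_profile hg hν ht h1
    (fun i => Finset.sum_nonneg fun j _ => by positivity) fun i => ?_
  · exact h2.congr fun i => (sum_tail_eq_integral hg (hv i) t (k i)).symm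
  · rw [laplace_empiricalMeasure]
    exact Finset.sum_le_sum_of_subset_of_nonneg (Finset.filter_subset _ _)
      fun j _ _ => by positivity

end Limits

/-! ### The search-cost for deterministic weights -/

/-- Either `κ` consists of all objects, or `a = 0` and `κ` is a final segment. -/
def IsAdmissible {n : ℕ} (κ : Finset (Fin n)) (a : ℝ≥0) : Prop :=
  κ = Finset.univ ∨ (a = 0 ∧ ∃ k : ℕ, κ = Finset.univ.filter fun j : Fin n => k ≤ (j : ℕ))

open Classical in
lemma ncard_requestedIn_add_card {n : ℕ} (A : Fin n → Set ℝ≥0) (a t : ℝ≥0) :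
    (requestedIn A a t).ncard + {j ∈ (Finset.univ : Finset (Fin n)) | j ∉ requestedIn A a t}.card =
      n := by
  have h := Finset.card_filter_add_card_filter_not (s := (Finset.univ : Finset (Fin n)))
    (fun j => j ∈ requestedIn A a t)
  rw [Finset.card_univ, Fintype.card_fin, ← Set.ncard_coe_finset] at h
  have h2 : (↑(Finset.univ.filter fun j => j ∈ requestedIn A a t) : Set (Fin n)) =
      requestedIn A a t := by
    ext j
    simp
  rwa [h2] at h

-- If the next object was requested in `[a, t)`, its position is at most the number of such objects.
-- Otherwise it lies behind all of them, which settles `κ = univ`. For `a = 0` and a final segment,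
-- the unrequested objects behind it are those of larger index, and comparing them with the
-- unrequested objects of index at least `k` tells whether its own index is at least `k`.
open Classical in
lemma lt_card_add_searchCost_iff {n : ℕ} {A : Fin n → Set ℝ≥0} {a t : ℝ≥0}
    (hA : (requestsBefore A t).Finite) {κ : Finset (Fin n)} (hκ : IsAdmissible κ a)
    (hex : ∃ i, IsOnlyNextRequested A t i) :
    n < {j ∈ κ | j ∉ requestedIn A a t}.card + searchCost 1 A t ↔
      ∃ i ∈ κ, IsOnlyNextRequested A t i ∧ i ∉ requestedIn A a t := by
  obtain ⟨i, hi⟩ := hex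
  have hS := hi.searchCost_eq 1
  have hn := ncard_requestedIn_add_card A a t
  have hR : (∃ i ∈ κ, IsOnlyNextRequested A t i ∧ i ∉ requestedIn A a t) ↔
      (i ∈ κ ∧ i ∉ requestedIn A a t) := by
    constructor
    · rintro ⟨j, hj, h1, h2⟩
      obtain rfl := hi.2 j h1.1
      exact ⟨hj, h2⟩
    · exact fun h => ⟨i, h.1, hi, h.2⟩
  rw [hR, hS]
  have hVle : {j ∈ κ | j ∉ requestedIn A a t}.card ≤
      {j ∈ (Finset.univ : Finset (Fin n)) | j ∉ requestedIn A a t}.card :=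
    Finset.card_le_card (Finset.filter_subset_filter _ (Finset.subset_univ κ))
  by_cases hreq : i ∈ requestedIn A a t
  · have := position_le_of_mem_requestedIn hA hreq
    simp only [hreq, not_true_eq_false, and_false, iff_false]
    omega
  · simp only [hreq, not_false_eq_true, and_true]
    rcases hκ with rfl | ⟨rfl, k, rfl⟩
    · have := lt_position_of_notMem_requestedIn hA hreq
      simp only [Finset.mem_univ, iff_true]
      omega
    · have hreq' := hreq
      rw [requestedIn_zero] at hreq' ⊢
      have hpos := position_add_ncard_of_notMem_requestedBefore hA hreq'
      have hset : {j | i < j ∧ j ∉ requestedBefore A t}.ncard =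
          (Finset.univ.filter fun j => i < j ∧ j ∉ requestedBefore A t).card := by
        rw [← Set.ncard_coe_finset]
        congr 1
        ext j
        simp
      rw [hset] at hpos
      rw [Finset.filter_filter]
      constructor
      · intro h
        by_contra hik
        have : (Finset.univ.filter fun j : Fin n => k ≤ (j : ℕ) ∧ j ∉ requestedBefore A t).card ≤
            (Finset.univ.filter fun j => i < j ∧ j ∉ requestedBefore A t).card := by
          refine Finset.card_le_card fun j hj => ?_
          simp only [Finset.mem_filter, Finset.mem_univ, true_and] at hj hik ⊢
          exact ⟨Fin.lt_def.2 (by omega), hj.2⟩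
        omega
      · intro hik
        have : (Finset.univ.filter fun j => i < j ∧ j ∉ requestedBefore A t).card <
            (Finset.univ.filter fun j : Fin n => k ≤ (j : ℕ) ∧ j ∉ requestedBefore A t).card := by
          refine Finset.card_lt_card ⟨fun j hj => ?_, fun h => ?_⟩
          · simp only [Finset.mem_filter, Finset.mem_univ, true_and] at hj hik ⊢
            exact ⟨by have := Fin.lt_def.1 hj.1; omega, hj.2⟩
          · have : i ∈ Finset.univ.filter fun j => i < j ∧ j ∉ requestedBefore A t :=
              h (Finset.mem_filter.2 ⟨Finset.mem_univ _, (Finset.mem_filter.1 hik).2, hreq'⟩)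
            simp at this
        omega

/-! ### Two-sided bounds for the tail of the search-cost. -/

section Poisson

variable {Ω : Type*} [MeasurableSpace Ω] {Pr : Measure Ω} [IsProbabilityMeasure Pr]
  {n : ℕ} {N : Fin n → ℝ≥0 → Ω → ℕ} {p : Fin n → ℝ≥0}

/-- Passing from probability one to almost every `ω` requires null-measurability, obtained by
rewriting the event through the passage times. -/
lemma ae_exists_isOnlyNextRequested (hN : ∀ i, IsStandardPoissonProcess (N i) Pr)
    (hind : iIndepFun (fun i ω s => N i s ω) Pr) (hp : ∑ i, p i = 1) (T : ℝ≥0) :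
    ∀ᵐ ω ∂Pr, ∃ i, IsOnlyNextRequested (pathTimes p fun i s => N i s ω) T i := by
  have h1 := exists_isOnlyNextRequested_ae hN hind hp T
  have hmeas : NullMeasurableSet
      {ω | ∃ i, IsOnlyNextRequested (pathTimes p fun i s => N i s ω) T i} Pr := by
    have hN' : Measurable fun ω => fun (i : Fin n) (k : ℕ) =>
        passageTime (fun s => N i s ω) k / (p i : ℝ≥0∞) := by
      refine measurable_pi_lambda _ fun i => measurable_pi_lambda _ fun k => ?_
      exact ((measurable_passageTime k).comp
        (measurable_pi_lambda _ fun s => (hN i).measurable s)).div measurable_const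
    have hm : Measurable fun σ : Fin n → ℕ → ℝ≥0∞ =>
        ∃ i, IsOnlyNextRequested (timesOf σ) T i :=
      Measurable.exists fun i => (measurable_isNextRequested T i).and
        (Measurable.forall fun j => (measurable_isNextRequested T j).imp measurable_const)
    refine NullMeasurableSet.congr
      (hN' (measurableSet_setOfPred.2 hm)).nullMeasurableSet ?_
    filter_upwards [isCountingPath_ae hN] with ω hω
    change (∃ i, IsOnlyNextRequested (timesOf _) T i) =
      (∃ i, IsOnlyNextRequested (pathTimes p fun i s => N i s ω) T i)
    rw [pathTimes_eq_timesOf hω]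
  refine (prob_compl_eq_zero_iff₀ hmeas).2 ?_
  rwa [measureReal_def, ENNReal.toReal_eq_one_iff] at h1

/-- If the next object is not an unrequested one of `κ`, then V + S ≤ n, so S > xn forces V < (1 -
x)n, a deviation of at least `ε n` below its mean. -/
lemma measureReal_searchCost_gt_le (hN : ∀ i, IsStandardPoissonProcess (N i) Pr)
    (hind : iIndepFun (fun i ω s => N i s ω) Pr) (hp : ∑ i, p i = 1) {T a : ℝ≥0} (ha : a ≤ T)
    {κ : Finset (Fin n)} (hκ : IsAdmissible κ a) {x ε : ℝ} (hε : 0 < ε) (hn : 0 < n)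
    (hx : (1 - x + ε) * n ≤ ∑ i ∈ κ, Real.exp (-(p i * ((T : ℝ) - a)))) :
    Pr.real {ω | x * n < searchCost 1 (pathTimes p fun i s => N i s ω) T} ≤
      ∑ i ∈ κ, p i * Real.exp (-(p i * ((T : ℝ) - a))) + 1 / (ε ^ 2 * n) := by
  classical
  rw [← measureReal_exists_isOnlyNextRequested hN hind hp ha κ]
  refine le_trans ?_ (add_le_add_right (measureReal_abs_card_sub_ge_le (p := p) hN hind ha κ hε hn) _)
  refine le_trans (ENNReal.toReal_mono (measure_ne_top _ _) (measure_mono_ae ?_))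
    (measureReal_union_le _ _)
  filter_upwards [isCountingPath_ae hN, ae_exists_isOnlyNextRequested hN hind hp T]
    with ω hω hex hS
  have hiff := lt_card_add_searchCost_iff (finite_requestsBefore_pathTimes hω p T) hκ hex
  by_cases h : ∃ i ∈ κ, IsOnlyNextRequested (pathTimes p fun i s => N i s ω) T i ∧
      i ∉ requestedIn (pathTimes p fun i s => N i s ω) a T
  · exact Or.inl h
  · rw [← hiff, not_lt] at h
    refine Or.inr ?_
    have h' : (({j ∈ κ | j ∉ requestedIn (pathTimes p fun i s => N i s ω) a T}.card : ℕ) : ℝ) +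
      searchCost 1 (pathTimes p fun i s => N i s ω) T ≤ n := by exact_mod_cast h
    have hS' : x * n < searchCost 1 (pathTimes p fun i s => N i s ω) T := hS
    change ε * n ≤ |_|
    refine le_trans ?_ (neg_le_abs _)
    linarith

/-- Conversely, if the next object is an unrequested one of `κ`, then V + S > n, so S ≤ xn forces V
≥ (1 - x)n, a deviation above its mean. -/
lemma le_measureReal_searchCost_gt (hN : ∀ i, IsStandardPoissonProcess (N i) Pr)
    (hind : iIndepFun (fun i ω s => N i s ω) Pr) (hp : ∑ i, p i = 1) {T a : ℝ≥0} (ha : a ≤ T)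
    {κ : Finset (Fin n)} (hκ : IsAdmissible κ a) {x ε : ℝ} (hε : 0 < ε) (hn : 0 < n)
    (hx : ∑ i ∈ κ, Real.exp (-(p i * ((T : ℝ) - a))) ≤ (1 - x - ε) * n) :
    ∑ i ∈ κ, p i * Real.exp (-(p i * ((T : ℝ) - a))) ≤
      Pr.real {ω | x * n < searchCost 1 (pathTimes p fun i s => N i s ω) T} +
        1 / (ε ^ 2 * n) := by
  classical
  rw [← measureReal_exists_isOnlyNextRequested hN hind hp ha κ]
  refine le_trans ?_ (add_le_add_right (measureReal_abs_card_sub_ge_le (p := p) hN hind ha κ hε hn) _)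
  refine le_trans (ENNReal.toReal_mono (measure_ne_top _ _) (measure_mono_ae ?_))
    (measureReal_union_le _ _)
  filter_upwards [isCountingPath_ae hN, ae_exists_isOnlyNextRequested hN hind hp T]
    with ω hω hex hJ
  have hlt := (lt_card_add_searchCost_iff (finite_requestsBefore_pathTimes hω p T) hκ hex).2 hJ
  have h' : (n : ℝ) < (({j ∈ κ | j ∉ requestedIn (pathTimes p fun i s => N i s ω) a T}.card : ℕ) : ℝ)
      + searchCost 1 (pathTimes p fun i s => N i s ω) T := by exact_mod_cast hlt
  by_cases h : x * n < searchCost 1 (pathTimes p fun i s => N i s ω) T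
  · exact Or.inl h
  · refine Or.inr ?_
    change ε * n ≤ |_|
    refine le_trans ?_ (le_abs_self _)
    linarith

end Poisson

/-! ### Tail functions in the limit of many objects. -/

section Limits

variable {P : ProbabilityMeasure ℝ≥0} {ι : Type*} {l : Filter ι} {n : ι → ℕ+}
  {Ω : ℕ+ → Type*} [∀ m, MeasurableSpace (Ω m)] {Pr : ∀ m, Measure (Ω m)}
  [∀ m, IsProbabilityMeasure (Pr m)] {N : ∀ m : ℕ+, Fin m → ℝ≥0 → Ω m → ℕ}
  {p : ∀ i, Fin (n i) → ℝ≥0}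

/-- If the tail function `F` is the limit of the out-of-equilibrium probabilities, it is the limit
of the tail functions of the search-costs. -/
lemma tendsto_measureReal_searchCost_gt (hN : ∀ m j, IsStandardPoissonProcess (N m j) (Pr m))
    (hind : ∀ m, iIndepFun (fun j ω s => N m j s ω) (Pr m)) (hp : ∀ i, ∑ j, p i j = 1)
    (hn : Tendsto (fun i => (n i : ℕ)) l atTop) {T : ι → ℝ≥0} {O : Set ℝ} (hO : IsOpen O)
    {F : ℝ → ℝ} (hF : ContinuousOn F O)
    (H : ∀ x ∈ O, ∃ (a : ι → ℝ≥0) (κ : ∀ i, Finset (Fin (n i))), (∀ i, a i ≤ T i) ∧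
      (∀ i, IsAdmissible (κ i) (a i)) ∧
      Tendsto (fun i => ((n i : ℕ) : ℝ)⁻¹ * ∑ j ∈ κ i, Real.exp (-(p i j * ((T i : ℝ) - a i)))) l
        (𝓝 (1 - x)) ∧
      Tendsto (fun i => ∑ j ∈ κ i, p i j * Real.exp (-(p i j * ((T i : ℝ) - a i)))) l (𝓝 (F x)))
    {x : ℝ} (hx : x ∈ O) :
    Tendsto (fun i => (Pr (n i)).real {ω | x * ((n i : ℕ) : ℝ) <
      searchCost 1 (pathTimes (p i) fun j s => N (n i) j s ω) (T i)}) l (𝓝 (F x)) := by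
  have hFx : ContinuousAt F x := hF.continuousAt (hO.mem_nhds hx)
  have hOx : ∀ᶠ x' in 𝓝 x, x' ∈ O := hO.mem_nhds hx
  have hsmall : ∀ ε : ℝ, Tendsto (fun i => 1 / (ε ^ 2 * ((n i : ℕ) : ℝ))) l (𝓝 0) := by
    intro ε
    have h := (tendsto_inv_atTop_zero.comp (tendsto_natCast_atTop_atTop (R := ℝ).comp hn)).const_mul
      (1 / ε ^ 2)
    rw [mul_zero] at h
    refine h.congr fun i => ?_
    simp only [Function.comp_apply]
    rw [one_div, one_div, mul_inv]
  refine tendsto_order.2 ⟨fun b hb => ?_, fun b hb => ?_⟩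
  · have h1 : ∀ᶠ x' in 𝓝[>] x, x' ∈ O ∧ b < F x' :=
      (hOx.and (hFx.eventually_const_lt hb)).filter_mono
        nhdsWithin_le_nhds
    obtain ⟨x', ⟨hx'O, hbx'⟩, hxx'⟩ := (h1.and self_mem_nhdsWithin).exists
    have hxx : x < x' := hxx'
    obtain ⟨a, κ, ha, hκ, hlim1, hlim2⟩ := H x' hx'O
    -- Half of the gap between `x` and the nearby point `x'` is spent on the fluctuations of the
    -- count, the other half on the convergence of its mean.
    set ε := (x' - x) / 2 with hε
    have hεpos : 0 < ε := by rw [hε]; linarith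
    have h2 := hlim2.sub (hsmall ε)
    rw [sub_zero] at h2
    filter_upwards [h2.eventually_const_lt hbx',
      hlim1.eventually_lt_const (show 1 - x' < 1 - x - ε by rw [hε]; linarith)] with i hi1 hi2
    have hni : (0 : ℝ) < ((n i : ℕ) : ℝ) := by exact_mod_cast (n i).pos
    have h3 := le_measureReal_searchCost_gt (hN (n i)) (hind (n i)) (hp i) (ha i) (hκ i) (x := x)
      hεpos (n i).pos (by
        rw [inv_mul_lt_iff₀ hni] at hi2
        linarith)
    linarith
  · have h1 : ∀ᶠ x' in 𝓝[<] x, x' ∈ O ∧ F x' < b :=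
      (hOx.and (hFx.eventually_lt_const hb)).filter_mono
        nhdsWithin_le_nhds
    obtain ⟨x', ⟨hx'O, hbx'⟩, hxx'⟩ := (h1.and self_mem_nhdsWithin).exists
    have hxx : x' < x := hxx'
    obtain ⟨a, κ, ha, hκ, hlim1, hlim2⟩ := H x' hx'O
    set ε := (x - x') / 2 with hε
    have hεpos : 0 < ε := by rw [hε]; linarith
    have h2 := hlim2.add (hsmall ε)
    rw [add_zero] at h2
    filter_upwards [h2.eventually_lt_const hbx',
      hlim1.eventually_const_lt (show 1 - x + ε < 1 - x' by rw [hε]; linarith)] with i hi1 hi2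
    have hni : (0 : ℝ) < ((n i : ℕ) : ℝ) := by exact_mod_cast (n i).pos
    have h3 := measureReal_searchCost_gt_le (hN (n i)) (hind (n i)) (hp i) (ha i) (hκ i) (x := x)
      hεpos (n i).pos (by
        rw [lt_inv_mul_iff₀ hni] at hi2
        linarith)
    linarith

end Limits

/-! ### Weights whose mean is the mean of the limiting law -/

/-- A law with a density has no atoms. -/
lemma continuous_lawOfDensity_Ioi {f : ℝ → ℝ} (hf : ∫⁻ x, ENNReal.ofReal (f x) = 1) :
    Continuous fun x => (lawOfDensity f hf : Measure ℝ).real (Ioi x) := by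
  set μ : Measure ℝ := (lawOfDensity f hf : Measure ℝ) with hμ
  have hna : NullSingletonClass μ := by
    rw [hμ, lawOfDensity, ProbabilityMeasure.coe_mk]
    infer_instance
  have h1 := (integrable_const (μ := μ) (1 : ℝ)).continuous_primitive 0
  have h2 : ∀ x, μ.real (Ioi x) = 1 - (μ.real (Iic 0) + ∫ _ in (0 : ℝ)..x, (1 : ℝ) ∂μ) := by
    intro x
    rw [← intervalIntegral.integral_Iic_sub_Iic (integrable_const _).integrableOn
      (integrable_const _).integrableOn, ← compl_Iic, measureReal_compl measurableSet_Iic]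
    simp
  simp only [h2]
  fun_prop

section Limits

variable {P : ProbabilityMeasure ℝ≥0} {ι : Type*} {l : Filter ι} {n : ι → ℕ+}
  {Ω : ℕ+ → Type*} [∀ m, MeasurableSpace (Ω m)] {Pr : ∀ m, Measure (Ω m)}
  [∀ m, IsProbabilityMeasure (Pr m)] {N : ∀ m : ℕ+, Fin m → ℝ≥0 → Ω m → ℕ}
  {v : ∀ i, Fin (n i) → ℝ≥0}
  {g : ℝ≥0 → ℝ → ℝ} {Θ : ℝ → ℝ → ℝ → ℝ} {R : ∀ n, (Fin n → ℝ≥0) → Prop}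

lemma sum_popularity {n : ℕ} {v : Fin n → ℝ≥0} (hv : ∑ j, v j ≠ 0) : ∑ j, popularity v j = 1 := by
  simp only [popularity]
  rw [← Finset.sum_div, div_self hv]

lemma coe_popularity {m : ℕ+} {v : Fin m → ℝ≥0} {μ : ℝ≥0}
    (hsum : ∑ j, v j = ((m : ℕ) : ℝ≥0) * μ) (j : Fin m) :
    (popularity v j : ℝ) = v j / (((m : ℕ) : ℝ) * μ) := by
  simp [popularity, hsum]

/-- The time scale of the theorem: at time nμu the Poisson exponent of an object is its weight times
`u`. -/
lemma popularity_mul {m : ℕ+} {v : Fin m → ℝ≥0} {μ : ℝ≥0} (hμ : μ ≠ 0)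
    (hsum : ∑ j, v j = ((m : ℕ) : ℝ≥0) * μ) (j : Fin m) (u : ℝ) :
    (popularity v j : ℝ) * (((m : ℕ) : ℝ) * μ * u) = v j * u := by
  have hm : ((m : ℕ) : ℝ) ≠ 0 := by exact_mod_cast m.ne_zero
  have hμ' : (μ : ℝ) ≠ 0 := by exact_mod_cast hμ
  rw [coe_popularity hsum]
  field_simp

lemma sum_popularity_mul_exp {m : ℕ+} {v : Fin m → ℝ≥0} {μ : ℝ≥0} (hμ : μ ≠ 0)
    (hsum : ∑ j, v j = ((m : ℕ) : ℝ≥0) * μ) (κ : Finset (Fin m)) (u : ℝ) :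
    ∑ j ∈ κ, (popularity v j : ℝ) * Real.exp (-(popularity v j * (((m : ℕ) : ℝ) * μ * u))) =
      1 / μ * ∑ j ∈ κ, ((m : ℕ) : ℝ)⁻¹ * (v j * Real.exp (-(v j * u))) := by
  have hm : ((m : ℕ) : ℝ) ≠ 0 := by exact_mod_cast m.ne_zero
  have hμ' : (μ : ℝ) ≠ 0 := by exact_mod_cast hμ
  rw [Finset.mul_sum]
  refine Finset.sum_congr rfl fun j _ => ?_
  rw [popularity_mul hμ hsum, coe_popularity hsum]
  field_simp

lemma laplaceMoment_one_empiricalMeasure {n : ℕ+} (v : Fin n → ℝ≥0) (t : ℝ) :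
    laplaceMoment (empiricalMeasure v) 1 t =
      ∑ j, ((n : ℕ) : ℝ)⁻¹ * (v j * Real.exp (-(v j * t))) := by
  rw [laplaceMoment, integral_empiricalMeasure, Finset.mul_sum]
  simp

/-- The point `1 - φ(t)` is left out because the admissible families differ on its two sides. -/
lemma tendsto_searchCost_gt (hfin : ∫⁻ x, (x : ℝ≥0∞) ∂(P : Measure ℝ≥0) ≠ ∞) (hmean : mean P ≠ 0)
    (hg : IsProfile P g Θ R) (hN : ∀ m j, IsStandardPoissonProcess (N m j) (Pr m))
    (hind : ∀ m, iIndepFun (fun j ω s => N m j s ω) (Pr m)) [l.IsCountablyGenerated]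
    (hn : Tendsto (fun i => (n i : ℕ)) l atTop) (hv : ∀ i, R (n i) (v i))
    (hsum : ∀ i, ∑ j, v i j = ((n i : ℕ) : ℝ≥0) * mean P)
    (hν : Tendsto (fun i => empiricalMeasure (v i)) l (𝓝 P)) {t : ℝ≥0} (ht : 0 < t)
    (hf : ∫⁻ x, ENNReal.ofReal (transientDensity P g t x) = 1) {x : ℝ}
    (hx : x ∈ Ioo 0 (1 - laplace P t) ∪ Ioo (1 - laplace P t) 1) :
    Tendsto (fun i => (Pr (n i)).real {ω | x * ((n i : ℕ) : ℝ) <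
      searchCost 1 (pathTimes (popularity (v i)) fun j s => N (n i) j s ω)
        (((n i : ℕ) : ℝ≥0) * mean P * t)}) l
      (𝓝 ((lawOfDensity (transientDensity P g t) hf : Measure ℝ).real (Ioi x))) := by
  have hs0 : ∀ i, ∑ j, v i j ≠ 0 := fun i => by
    rw [hsum]
    exact mul_ne_zero (by exact_mod_cast (n i).ne_zero) hmean
  refine tendsto_measureReal_searchCost_gt (O := Ioo 0 (1 - laplace P t) ∪ Ioo (1 - laplace P t) 1)
    hN hind (fun i => sum_popularity (hs0 i)) hn (isOpen_Ioo.union isOpen_Ioo)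
    (F := fun x => (lawOfDensity (transientDensity P g t) hf : Measure ℝ).real (Ioi x))
    (continuous_lawOfDensity_Ioi hf).continuousOn ?_ hx
  rintro x (hx | hx)
  -- Near the front of the list all objects count and the window is recent: `φ(u) = 1 - x`
  -- determines its length nμu.
  · obtain ⟨u, hu, hux⟩ := intermediate_value_Icc' (NNReal.coe_nonneg t)
      ((continuousOn_laplace hfin).mono Icc_subset_Ici_self)
      (show 1 - x ∈ Icc (laplace P t) (laplace P 0) by
        rw [laplace_zero]
        exact ⟨by linarith [hx.2], by linarith [hx.1]⟩)
    have hu0 : 0 < u := by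
      refine lt_of_le_of_ne hu.1 fun h => ?_
      rw [← h, laplace_zero] at hux
      linarith [hx.1]
    have hTa : ∀ i, (((((n i : ℕ) : ℝ≥0) * mean P * t : ℝ≥0) : ℝ) -
        ((((n i : ℕ) : ℝ≥0) * mean P * (t - u.toNNReal) : ℝ≥0) : ℝ)) =
        ((n i : ℕ) : ℝ) * mean P * u := by
      intro i
      have : u.toNNReal ≤ t := Real.toNNReal_le_iff_le_coe.2 hu.2
      push_cast [NNReal.coe_sub this, Real.coe_toNNReal u hu0.le]
      ring
    refine ⟨fun i => ((n i : ℕ) : ℝ≥0) * mean P * (t - u.toNNReal), fun i => Finset.univ,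
      fun i => mul_le_mul_right tsub_le_self _, fun i => Or.inl rfl, ?_, ?_⟩
    · rw [← hux]
      refine (tendsto_laplace_of_tendsto hν hu0.le).congr fun i => ?_
      rw [laplace_empiricalMeasure, ← Finset.mul_sum]
      simp only [hTa, popularity_mul hmean (hsum i)]
    · have hF : (lawOfDensity (transientDensity P g t) hf : Measure ℝ).real (Ioi x) =
          1 / mean P * laplaceMoment P 1 u := by
        have h := lintegral_transientDensity_Ioi_of_le hfin hmean hg
          (Real.toNNReal_le_iff_le_coe.2 hu.2)
        rw [Real.coe_toNNReal u hu0.le, hux, sub_sub_cancel] at h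
        rw [lawOfDensity_real hf measurableSet_Ioi, h, ENNReal.toReal_ofReal
          (div_nonneg (laplaceMoment_nonneg 1 u) (NNReal.coe_nonneg _))]
        ring
      dsimp only
      rw [hF]
      refine ((tendsto_laplaceMoment_of_tendsto hν 1 hu0).const_mul (1 / (mean P : ℝ))).congr
        fun i => ?_
      rw [laplaceMoment_one_empiricalMeasure, ← sum_popularity_mul_exp hmean (hsum i)]
      simp only [hTa]
  -- Far back in the list the window is all of `[0, T)`, and the index cutoff `k` makes the expected
  -- proportion of unrequested objects tend to `1 - x`.
  · obtain ⟨k, hk1, hk2⟩ := exists_cutoffs hg hn hv hν ht (c := 1 - x) (by linarith [hx.2])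
      (by linarith [hx.1])
    have hTa : ∀ i, (((((n i : ℕ) : ℝ≥0) * mean P * t : ℝ≥0) : ℝ) - ((0 : ℝ≥0) : ℝ)) =
        ((n i : ℕ) : ℝ) * mean P * t := by
      intro i
      push_cast
      ring
    refine ⟨fun i => 0, fun i => Finset.univ.filter fun j : Fin (n i) => k i ≤ (j : ℕ),
      fun i => zero_le, fun i => Or.inr ⟨rfl, k i, rfl⟩, ?_, ?_⟩
    · refine hk1.congr fun i => ?_
      rw [← Finset.mul_sum]
      simp only [hTa, popularity_mul hmean (hsum i)]
    · have hF : (lawOfDensity (transientDensity P g t) hf : Measure ℝ).real (Ioi x) =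
          1 / mean P * ∫ y in Ioi (0 : ℝ), Θ (1 - x) (laplace P t) (gPlus P t y.toNNReal) := by
        have hnorm : ∀ y ∈ Ioi (0 : ℝ), ‖Θ (1 - x) (laplace P t) (gPlus P t y.toNNReal)‖ ≤
            Real.exp (-(y * t)) := fun y hy =>
          norm_profile_gPlus_le hg P t (by linarith [hx.2]) (by linarith [hx.1]) hy
        rw [lawOfDensity_real hf measurableSet_Ioi,
          lintegral_transientDensity_Ioi hg t hx.1.le hx.2.le, ENNReal.toReal_mul,
          ENNReal.toReal_ofReal (one_div_nonneg.2 (NNReal.coe_nonneg _)),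
          integral_eq_lintegral_of_nonneg_ae]
        · rw [EventuallyLE, ae_restrict_iff' measurableSet_Ioi]
          exact Filter.Eventually.of_forall fun y hy => (hg.bounds _ _ _ (by linarith [hx.2])
            (by linarith [hx.1]) (gPlus_nonneg t _)).1
        · exact (measurable_profile_gPlus hg P t _ _).aestronglyMeasurable
      dsimp only
      rw [hF]
      refine (hk2.const_mul (1 / (mean P : ℝ))).congr fun i => ?_
      rw [← sum_popularity_mul_exp hmean (hsum i)]
      simp only [hTa]

/-- The case `a = 0`, `κ = univ` of the next-request formula: the exact probability is a first
moment of the empirical measure. The order of the weights plays no role. -/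
lemma tendsto_exists_unrequested (hmean : mean P ≠ 0)
    (hN : ∀ m j, IsStandardPoissonProcess (N m j) (Pr m))
    (hind : ∀ m, iIndepFun (fun j ω s => N m j s ω) (Pr m))
    (hsum : ∀ i, ∑ j, v i j = ((n i : ℕ) : ℝ≥0) * mean P)
    (hν : Tendsto (fun i => empiricalMeasure (v i)) l (𝓝 P)) {t : ℝ≥0} (ht : 0 < t) :
    Tendsto (fun i => (Pr (n i)).real {ω | ∃ j,
      IsNextRequested (pathTimes (popularity (v i)) fun j s => N (n i) j s ω)
        (((n i : ℕ) : ℝ≥0) * mean P * t) j ∧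
      j ∉ requestedBefore (pathTimes (popularity (v i)) fun j s => N (n i) j s ω)
        (((n i : ℕ) : ℝ≥0) * mean P * t)}) l (𝓝 (laplaceMoment P 1 t / mean P)) := by
  have hs0 : ∀ i, ∑ j, v i j ≠ 0 := fun i => by
    rw [hsum]
    exact mul_ne_zero (by exact_mod_cast (n i).ne_zero) hmean
  rw [show laplaceMoment P 1 t / mean P = 1 / mean P * laplaceMoment P 1 t by ring]
  refine ((tendsto_laplaceMoment_of_tendsto hν 1 (NNReal.coe_pos.2 ht)).const_mul
    (1 / (mean P : ℝ))).congr fun i => ?_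
  have h := measureReal_exists_isOnlyNextRequested (hN (n i)) (hind (n i))
    (sum_popularity (hs0 i)) (zero_le (a := ((n i : ℕ) : ℝ≥0) * mean P * t)) Finset.univ
  have hcoe : (((((n i : ℕ) : ℝ≥0) * mean P * t : ℝ≥0) : ℝ) - ((0 : ℝ≥0) : ℝ)) =
      ((n i : ℕ) : ℝ) * mean P * t := by
    push_cast
    ring
  rw [hcoe] at h
  rw [laplaceMoment_one_empiricalMeasure, ← sum_popularity_mul_exp hmean (hsum i), ← h]
  refine measureReal_congr ?_
  filter_upwards [ae_exists_isOnlyNextRequested (hN (n i)) (hind (n i)) (sum_popularity (hs0 i))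
    (((n i : ℕ) : ℝ≥0) * mean P * t)] with ω ⟨j, hj⟩
  refine propext ⟨?_, ?_⟩
  · rintro ⟨j', -, h1, h2⟩
    exact ⟨j', h1.1, by rwa [requestedIn_zero] at h2⟩
  · rintro ⟨j', h1, h2⟩
    refine ⟨j', Finset.mem_univ _, ?_, by rwa [requestedIn_zero]⟩
    rwa [hj.2 j' h1]

end Limits

/-! ### Random weights -/

lemma continuous_empiricalMeasure (n : ℕ+) :
    Continuous (empiricalMeasure : (Fin n → ℝ≥0) → ProbabilityMeasure ℝ≥0) := by
  refine continuous_iff_continuousAt.2 fun v =>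
    ProbabilityMeasure.tendsto_iff_forall_integral_tendsto.2 fun f => ?_
  simp only [integral_empiricalMeasure]
  refine Tendsto.const_mul _ (tendsto_finsetSum _ fun j _ => ?_)
  exact (f.continuous.comp (continuous_apply j)).tendsto v

/-- The mean of a vector. -/
noncomputable def average {n : ℕ+} (v : Fin n → ℝ≥0) : ℝ≥0 := (∑ j, v j) / ((n : ℕ) : ℝ≥0)

lemma continuous_average (n : ℕ+) : Continuous (average : (Fin n → ℝ≥0) → ℝ≥0) := by
  unfold average
  fun_prop

/-- Against a `K`-Lipschitz test function the rescaling costs at most `K |c - 1|` times the average,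
and the averages converge. -/
lemma tendsto_empiricalMeasure_mul {ι : Type*} {l : Filter ι} [l.IsCountablyGenerated] {P : ProbabilityMeasure ℝ≥0}
    {n : ι → ℕ+} {v : ∀ i, Fin (n i) → ℝ≥0} {c : ι → ℝ≥0} {μ : ℝ≥0}
    (hν : Tendsto (fun i => empiricalMeasure (v i)) l (𝓝 P))
    (hμ : Tendsto (fun i => average (v i)) l (𝓝 μ)) (hc : Tendsto c l (𝓝 1)) :
    Tendsto (fun i => empiricalMeasure fun j => c i * v i j) l (𝓝 P) := by
  refine tendsto_iff_forall_lipschitz_integral_tendsto.2 fun f hfb ⟨K, hK⟩ => ?_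
  have h1 : Tendsto (fun i => ∫ z, f z ∂(empiricalMeasure (v i) : Measure ℝ≥0)) l
      (𝓝 (∫ z, f z ∂(P : Measure ℝ≥0))) :=
    tendsto_iff_forall_lipschitz_integral_tendsto.1 hν f hfb ⟨K, hK⟩
  have hc' : Tendsto (fun i => (c i : ℝ) - 1) l (𝓝 0) := by
    have := ((NNReal.continuous_coe.tendsto 1).comp hc).sub_const 1
    simpa using this
  have hμ' : Tendsto (fun i => (average (v i) : ℝ)) l (𝓝 μ) := (NNReal.continuous_coe.tendsto μ).comp hμ
  have h2 : Tendsto (fun i => ∫ z, f z ∂(empiricalMeasure (fun j => c i * v i j) : Measure ℝ≥0) -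
      ∫ z, f z ∂(empiricalMeasure (v i) : Measure ℝ≥0)) l (𝓝 0) := by
    refine squeeze_zero_norm (a := fun i => K * (|(c i : ℝ) - 1| * average (v i))) (fun i => ?_) ?_
    · have hi : (0 : ℝ) ≤ ((n i : ℕ) : ℝ)⁻¹ := by positivity
      rw [integral_empiricalMeasure, integral_empiricalMeasure, ← mul_sub, ← Finset.sum_sub_distrib,
        Real.norm_eq_abs, abs_mul, abs_of_nonneg hi]
      have hterm : ∀ j, |f (c i * v i j) - f (v i j)| ≤ K * (|(c i : ℝ) - 1| * v i j) := by
        intro j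
        have := hK.dist_le_mul (c i * v i j) (v i j)
        rw [Real.dist_eq, NNReal.dist_eq] at this
        refine this.trans_eq ?_
        rw [NNReal.coe_mul, ← sub_one_mul, abs_mul, abs_of_nonneg (NNReal.coe_nonneg (v i j))]
      calc ((n i : ℕ) : ℝ)⁻¹ * |∑ j, (f (c i * v i j) - f (v i j))|
          ≤ ((n i : ℕ) : ℝ)⁻¹ * ∑ j, K * (|(c i : ℝ) - 1| * v i j) := by
            refine mul_le_mul_of_nonneg_left ?_ hi
            exact (Finset.abs_sum_le_sum_abs _ _).trans (Finset.sum_le_sum fun j _ => hterm j)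
        _ = K * (|(c i : ℝ) - 1| * average (v i)) := by
            rw [average]
            push_cast
            rw [← Finset.mul_sum, ← Finset.mul_sum]
            ring
    · have := (hc'.abs.mul hμ').const_mul (K : ℝ)
      simpa using this
  have := h2.add h1
  simpa using this

/-! ### From vectors of exact mean to neighbourhoods of the limit. -/

section Scaling

variable {P : ProbabilityMeasure ℝ≥0} {R : ∀ n, (Fin n → ℝ≥0) → Prop}
  {G : ∀ n : ℕ+, (Fin n → ℝ≥0) → ℝ} {L : ℝ}

/-- `G n v` tends to `L` for vectors of mean `mean P` that satisfy `R`, if their empirical measures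
converge to `P`. -/
def TendstoOfMeanEq (P : ProbabilityMeasure ℝ≥0) (R : ∀ n, (Fin n → ℝ≥0) → Prop)
    (G : ∀ n : ℕ+, (Fin n → ℝ≥0) → ℝ) (L : ℝ) : Prop :=
  ∀ (ι : Type) (l : Filter ι) (n : ι → ℕ+) (v : ∀ i, Fin (n i) → ℝ≥0), l.IsCountablyGenerated →
    Tendsto (fun i => (n i : ℕ)) l atTop → (∀ i, R (n i) (v i)) →
    (∀ i, ∑ j, v i j = ((n i : ℕ) : ℝ≥0) * mean P) →
    Tendsto (fun i => empiricalMeasure (v i)) l (𝓝 P) → Tendsto (fun i => G (n i) (v i)) l (𝓝 L)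

/-- All admissible vectors of all lengths are taken as the index set, with the filter pulled back
from size, empirical measure and average. Convergence along this one filter is the desired uniform
statement; it is countably generated, as dominated convergence requires. -/
lemma TendstoOfMeanEq.eventually (hG : TendstoOfMeanEq P R G L) (hmean : mean P ≠ 0)
    (hR : ∀ n v (c : ℝ≥0), R n v → R n fun i => c * v i)
    (hscale : ∀ n v (c : ℝ≥0), c ≠ 0 → G n (fun j => c * v j) = G n v) {ε : ℝ} (hε : 0 < ε) :
    ∃ U ∈ 𝓝 P, ∃ V ∈ 𝓝 (mean P), ∀ᶠ m : ℕ+ in atTop, ∀ v : Fin m → ℝ≥0, R m v →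
      empiricalMeasure v ∈ U → average v ∈ V → |G m v - L| < ε := by
  set I := {x : Σ m : ℕ+, (Fin m → ℝ≥0) // R x.1 x.2 ∧ average x.2 ≠ 0} with hI
  set Φ : I → ℕ+ × ProbabilityMeasure ℝ≥0 × ℝ≥0 :=
    fun x => (x.1.1, empiricalMeasure x.1.2, average x.1.2) with hΦ
  set l : Filter I := comap Φ (atTop ×ˢ 𝓝 P ×ˢ 𝓝 (mean P)) with hl
  have h0 : Tendsto Φ l (atTop ×ˢ 𝓝 P ×ˢ 𝓝 (mean P)) := tendsto_comap
  have hn : Tendsto (fun x : I => (x.1.1 : ℕ)) l atTop :=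
    tendsto_PNat_val_atTop_atTop.comp (tendsto_fst.comp h0)
  have hν : Tendsto (fun x : I => empiricalMeasure x.1.2) l (𝓝 P) :=
    tendsto_fst.comp (tendsto_snd.comp h0)
  have hμ : Tendsto (fun x : I => average x.1.2) l (𝓝 (mean P)) :=
    tendsto_snd.comp (tendsto_snd.comp h0)
  have hc : Tendsto (fun x : I => mean P / average x.1.2) l (𝓝 1) := by
    have := (tendsto_const_nhds (x := mean P)).div hμ hmean
    rwa [div_self hmean] at this
  -- Dividing by the average and multiplying by the limit mean gives exact mean; the factor tends to
  -- `1`, and `G` does not see it.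
  have hlim := hG I l (fun x => x.1.1) (fun x j => mean P / average x.1.2 * x.1.2 j) inferInstance hn
    (fun x => hR _ _ _ x.2.1) (fun x => by
      have hx : average x.1.2 ≠ 0 := x.2.2
      have hm : ((x.1.1 : ℕ) : ℝ≥0) ≠ 0 := by exact_mod_cast x.1.1.ne_zero
      rw [← Finset.mul_sum]
      have : ∑ j, x.1.2 j = ((x.1.1 : ℕ) : ℝ≥0) * average x.1.2 := by
        rw [average]
        field_simp
      rw [this]
      field_simp) (tendsto_empiricalMeasure_mul hν hμ hc)
  have hlim' : Tendsto (fun x : I => G x.1.1 x.1.2) l (𝓝 L) :=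
    hlim.congr fun x => hscale _ _ _ (div_ne_zero hmean x.2.2)
  have hev := hlim'.eventually (Metric.ball_mem_nhds L hε)
  rw [hl, eventually_comap] at hev
  obtain ⟨A, hA, B, hB, hAB⟩ := mem_prod_iff.1 hev
  obtain ⟨U, hU, V, hV, hUV⟩ := mem_prod_iff.1 hB
  -- Removing `0` ensures that the vectors considered belong to the index set.
  refine ⟨U, hU, V ∩ {0}ᶜ, inter_mem hV (isOpen_ne.mem_nhds hmean), ?_⟩
  filter_upwards [hA] with m hm v hv hvU hvV
  have h := hAB (Set.mk_mem_prod hm (hUV (Set.mk_mem_prod hvU hvV.1))) ⟨⟨m, v⟩, hv, hvV.2⟩ rfl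
  exact h

end Scaling

/-- Urysohn: a test function that detects leaving `U`, by which convergence in law to a constant
becomes convergence in probability. -/
lemma exists_separating {X : Type*} [TopologicalSpace X] [T1Space X] [NormalSpace X] {x : X}
    {U : Set X} (hU : U ∈ 𝓝 x) : ∃ f : X →ᵇ ℝ, f x = 0 ∧ (∀ y, 0 ≤ f y) ∧ ∀ y, y ∉ U → 1 ≤ f y := by
  obtain ⟨f, h0, h1, h2⟩ := exists_continuous_zero_one_of_isClosed (isClosed_singleton (x := x))
    (isOpen_interior (s := U)).isClosed_compl
    (Set.disjoint_singleton_left.2 fun h => h (mem_interior_iff_mem_nhds.2 hU))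
  refine ⟨BoundedContinuousFunction.ofNormedAddCommGroup f f.continuous 1 fun y => ?_,
    h0 (Set.mem_singleton x), fun y => (h2 y).1, fun y hy => ?_⟩
  · rw [Real.norm_of_nonneg (h2 y).1]
    exact (h2 y).2
  · exact (h1 (show y ∈ (interior U)ᶜ from fun h => hy (interior_subset h))).ge

section Random

variable {Ω : ℕ+ → Type*} [∀ n, MeasurableSpace (Ω n)] {Pr : ∀ n, Measure (Ω n)}
  [∀ n, IsProbabilityMeasure (Pr n)] {w : ∀ n : ℕ+, Ω n → Fin n → ℝ≥0}
  {P : ProbabilityMeasure ℝ≥0} {R : ∀ n, (Fin n → ℝ≥0) → Prop}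
  {G : ∀ n : ℕ+, (Fin n → ℝ≥0) → ℝ} {L : ℝ}

/-- On good neighbourhoods `G` is within `ε / 2` of `L`; elsewhere the error is bounded and charged
to the two separating functions, whose expectations tend to `0`. Scale invariance removes the random
factor `Z`. -/
lemma TendstoOfMeanEq.tendsto_integral (hG : TendstoOfMeanEq P R G L) (hw : LLN Pr w P)
    (hwm : ∀ n, Measurable (w n)) (hwR : ∀ n : ℕ+, ∀ᵐ ω ∂(Pr n), R n (w n ω))
    (hR : ∀ n v (c : ℝ≥0), R n v → R n fun i => c * v i)
    (hscale : ∀ n v (c : ℝ≥0), c ≠ 0 → G n (fun j => c * v j) = G n v)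
    (hG0 : ∀ n v, 0 ≤ G n v) (hG1 : ∀ n v, G n v ≤ 1) (hGm : ∀ n, Measurable (G n)) :
    Tendsto (fun n => ∫ ω, G n (w n ω) ∂(Pr n)) atTop (𝓝 L) := by
  obtain ⟨Z, hZm, hZ0, hemp, havg⟩ := hw.exists_scaling
  have hvm : ∀ n : ℕ+, Measurable fun ω (i : Fin n) => Z n ω * w n ω i := fun n =>
    measurable_pi_lambda _ fun i => (hZm n).mul ((measurable_pi_apply i).comp (hwm n))
  refine tendsto_iff_norm_sub_tendsto_zero.2 (tendsto_order.2
    ⟨fun a ha => Filter.Eventually.of_forall fun n => ha.trans_le (norm_nonneg _), fun ε hε => ?_⟩)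
  obtain ⟨U, hU, V, hV, hev⟩ := hG.eventually hw.mean_ne_zero hR hscale (half_pos hε)
  obtain ⟨f, hf0, hfnn, hf1⟩ := exists_separating hU
  obtain ⟨h, hh0, hhnn, hh1⟩ := exists_separating hV
  set F : ∀ n : ℕ+, Ω n → ℝ := fun n ω => f (empiricalMeasure fun i => Z n ω * w n ω i) with hF
  set H : ∀ n : ℕ+, Ω n → ℝ := fun n ω => h (average fun i => Z n ω * w n ω i) with hH
  have hFm : ∀ n, Measurable (F n) := fun n =>
    (f.continuous.comp (continuous_empiricalMeasure n)).measurable.comp (hvm n)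
  have hHm : ∀ n, Measurable (H n) := fun n =>
    (h.continuous.comp (continuous_average n)).measurable.comp (hvm n)
  have hFi : ∀ n, Integrable (F n) (Pr n) := fun n =>
    Integrable.of_bound (hFm n).aestronglyMeasurable ‖f‖
      (Filter.Eventually.of_forall fun ω => f.norm_coe_le_norm _)
  have hHi : ∀ n, Integrable (H n) (Pr n) := fun n =>
    Integrable.of_bound (hHm n).aestronglyMeasurable ‖h‖
      (Filter.Eventually.of_forall fun ω => h.norm_coe_le_norm _)
  have hFlim : Tendsto (fun n => ∫ ω, F n ω ∂(Pr n)) atTop (𝓝 0) := hf0 ▸ hemp f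
  have hHlim : Tendsto (fun n => ∫ ω, H n ω ∂(Pr n)) atTop (𝓝 0) := by
    have h1 := (ProbabilityMeasure.tendsto_iff_forall_integral_tendsto.1 havg.tendsto) h
    have h2 : ∫ x, h x ∂((Measure.dirac ()).map fun _ : Unit => mean P) = 0 := by
      rw [Measure.map_dirac' measurable_const, integral_dirac, hh0]
    rw [ProbabilityMeasure.coe_mk, h2] at h1
    refine h1.congr fun n => ?_
    rw [ProbabilityMeasure.coe_mk, integral_map (havg.forall_aemeasurable n)
      h.continuous.aestronglyMeasurable]
    rfl
  -- Bounds `|G - L|` everywhere, since `G` takes values in `[0, 1]`.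
  set C := 1 + |L| with hC
  have hlim : Tendsto (fun n => ε / 2 + C * (∫ ω, F n ω ∂(Pr n) + ∫ ω, H n ω ∂(Pr n))) atTop
      (𝓝 (ε / 2)) := by
    have := ((hFlim.add hHlim).const_mul C).const_add (ε / 2)
    simpa using this
  filter_upwards [hev, hlim.eventually_lt_const (half_lt_self hε)] with n hn1 hn2
  refine lt_of_le_of_lt ?_ hn2
  have hGi : Integrable (fun ω => G n (w n ω)) (Pr n) :=
    Integrable.of_bound ((hGm n).comp (hwm n)).aestronglyMeasurable 1
      (Filter.Eventually.of_forall fun ω => by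
        rw [Real.norm_of_nonneg (hG0 n _)]
        exact hG1 n _)
  have hFH : Integrable (fun ω => C * (F n ω + H n ω)) (Pr n) :=
    ((hFi n).add (hHi n)).const_mul C
  have hpt : ∀ᵐ ω ∂(Pr n), |G n (w n ω) - L| ≤ ε / 2 + C * (F n ω + H n ω) := by
    filter_upwards [hZ0 n, hwR n] with ω hz hr
    have hC0 : 0 ≤ C := by positivity
    by_cases hmem : (empiricalMeasure fun i => Z n ω * w n ω i) ∈ U ∧
        (average fun i => Z n ω * w n ω i) ∈ V
    · have := hn1 _ (hR n _ (Z n ω) hr) hmem.1 hmem.2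
      rw [hscale n _ _ hz.ne'] at this
      have hnn : 0 ≤ C * (F n ω + H n ω) := mul_nonneg hC0 (add_nonneg (hfnn _) (hhnn _))
      linarith
    · have h1 : 1 ≤ F n ω + H n ω := by
        rw [not_and_or] at hmem
        rcases hmem with hmem | hmem
        · have := hf1 _ hmem
          have := hhnn (average fun i => Z n ω * w n ω i)
          simp only [hF, hH]
          linarith
        · have := hh1 _ hmem
          have := hfnn (empiricalMeasure fun i => Z n ω * w n ω i)
          simp only [hF, hH]
          linarith
      have h2 : |G n (w n ω) - L| ≤ C := by
        refine (abs_sub _ _).trans ?_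
        rw [abs_of_nonneg (hG0 n _), hC]
        linarith [hG1 n (w n ω)]
      nlinarith
  calc ‖∫ ω, G n (w n ω) ∂(Pr n) - L‖ = |∫ ω, (G n (w n ω) - L) ∂(Pr n)| := by
        rw [integral_sub hGi (integrable_const _)]
        simp
    _ ≤ ∫ ω, |G n (w n ω) - L| ∂(Pr n) := abs_integral_le_integral_abs
    _ ≤ ∫ ω, (ε / 2 + C * (F n ω + H n ω)) ∂(Pr n) :=
        integral_mono_ae (hGi.sub (integrable_const _)).abs
          ((integrable_const _).add (((hFi n).add (hHi n)).const_mul C)) hpt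
    _ = ε / 2 + C * (∫ ω, F n ω ∂(Pr n) + ∫ ω, H n ω ∂(Pr n)) := by
        rw [integral_add (integrable_const _) hFH, integral_const_mul, integral_add (hFi n) (hHi n)]
        simp

end Random

/-! ### Convergence of the laws -/

lemma popularity_const_mul {n : ℕ} (v : Fin n → ℝ≥0) {c : ℝ≥0} (hc : c ≠ 0) :
    popularity (fun j => c * v j) = popularity v := by
  ext1 i
  rw [popularity, popularity, ← Finset.mul_sum, mul_div_mul_left _ _ hc]

lemma condProb_const_mul {Ω : Type*} [MeasurableSpace Ω] (Pr : Measure Ω) {n : ℕ}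
    (N : Fin n → ℝ≥0 → Ω → ℕ) (D : Set (Fin n → ℕ → ℝ≥0∞)) (v : Fin n → ℝ≥0) {c : ℝ≥0}
    (hc : c ≠ 0) : condProb Pr N D (fun j => c * v j) = condProb Pr N D v := by
  have h : ∀ τ, scaledTimes (fun j => c * v j, τ) = scaledTimes (v, τ) := fun τ => by
    unfold scaledTimes
    rw [popularity_const_mul v hc]
  simp only [condProb, h]

lemma condProb_gt {Ω : Type*} [MeasurableSpace Ω] {Pr : Measure Ω} {n : ℕ}
    {N : Fin n → ℝ≥0 → Ω → ℕ} (hN : ∀ j, IsStandardPoissonProcess (N j) Pr)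
    (v : Fin n → ℝ≥0) (c : ℝ) (T : ℝ≥0) :
    (condProb Pr N {σ | c < costOf T σ} v).toReal =
      Pr.real {ω | c < searchCost 1 (pathTimes (popularity v) fun j s => N j s ω) T} := by
  refine measureReal_congr ?_
  filter_upwards [isCountingPath_ae hN] with ω hω
  refine propext ?_
  have h : searchCost 1 (pathTimes (popularity v) fun j s => N j s ω) T =
    costOf T (scaledTimes (v, passageTimes N ω)) := searchCost_pathTimes hω _ T
  change c < costOf T (scaledTimes (v, passageTimes N ω)) ↔
    c < searchCost 1 (pathTimes (popularity v) fun j s => N j s ω) T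
  rw [h]

lemma measurableSet_costOf_gt (n : ℕ) (c : ℝ) (T : ℝ≥0) :
    MeasurableSet {σ : Fin n → ℕ → ℝ≥0∞ | c < costOf T σ} := by
  have : Measurable fun σ : Fin n → ℕ → ℝ≥0∞ => (costOf T σ : ℝ) :=
    measurable_from_top.comp (measurable_costOf T)
  exact measurableSet_lt measurable_const this

section Random

variable {Ω : ℕ+ → Type*} [∀ n, MeasurableSpace (Ω n)] {Pr : ∀ n, Measure (Ω n)}
  [∀ n, IsProbabilityMeasure (Pr n)] {w : ∀ n : ℕ+, Ω n → Fin n → ℝ≥0}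
  {N : ∀ n : ℕ+, Fin n → ℝ≥0 → Ω n → ℕ} {P : ProbabilityMeasure ℝ≥0}
  {g : ℝ≥0 → ℝ → ℝ} {Θ : ℝ → ℝ → ℝ → ℝ} {R : ∀ n, (Fin n → ℝ≥0) → Prop}

/-- The probability is the mean of the conditional probability given the weights, which is a bounded
measurable function of them invariant under rescaling. -/
lemma tendsto_scaledTimes_mem (hmodel : ∀ n, IsRequestModel (w n) (N n) (Pr n)) (hw : LLN Pr w P)
    (hwR : ∀ n : ℕ+, ∀ᵐ ω ∂(Pr n), R n (w n ω))
    (hR : ∀ n v (c : ℝ≥0), R n v → R n fun i => c * v i)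
    {D : ∀ n : ℕ+, Set (Fin n → ℕ → ℝ≥0∞)} (hD : ∀ n, MeasurableSet (D n)) {L : ℝ}
    (hG : TendstoOfMeanEq P R (fun n v => (condProb (Pr n) (N n) (D n) v).toReal) L) :
    Tendsto (fun n => (Pr n).real {ω | scaledTimes (w n ω, passageTimes (N n) ω) ∈ D n}) atTop
      (𝓝 L) := by
  have hm : ∀ n, Measurable (condProb (Pr n) (N n) (D n)) := fun n =>
    (hmodel n).measurable_condProb (hD n)
  have h := hG.tendsto_integral hw (fun n => (hmodel n).measurable_weights) hwR hR
    (fun n v c hc => by rw [condProb_const_mul _ _ _ _ hc]) (fun n v => ENNReal.toReal_nonneg)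
    (fun n v => ENNReal.toReal_le_of_le_ofReal zero_le_one (by
      rw [ENNReal.ofReal_one]
      exact prob_le_one)) fun n => (hm n).ennreal_toReal
  refine h.congr fun n => ?_
  rw [measureReal_def, (hmodel n).measure_scaledTimes_mem (hD n),
    integral_toReal (f := fun ω => condProb (Pr n) (N n) (D n) (w n ω))
      ((hm n).comp (hmodel n).measurable_weights).aemeasurable]
  exact Filter.Eventually.of_forall fun ω => prob_le_one.trans_lt ENNReal.one_lt_top

lemma tendsto_requestTimes_searchCost_gt (hmodel : ∀ n, IsRequestModel (w n) (N n) (Pr n))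
    (hw : LLN Pr w P) (hwR : ∀ n : ℕ+, ∀ᵐ ω ∂(Pr n), R n (w n ω))
    (hR : ∀ n v (c : ℝ≥0), R n v → R n fun i => c * v i) {t : ℝ≥0} {x L : ℝ}
    (hG : TendstoOfMeanEq P R (fun n v => (Pr n).real {ω | x * ((n : ℕ) : ℝ) <
      searchCost 1 (pathTimes (popularity v) fun j s => N n j s ω)
        (((n : ℕ) : ℝ≥0) * mean P * t)}) L) :
    Tendsto (fun n : ℕ+ => (Pr n).real {ω | x * ((n : ℕ) : ℝ) <
      searchCost 1 (requestTimes (w n) (N n) ω) (((n : ℕ) : ℝ≥0) * mean P * t)}) atTop (𝓝 L) := by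
  have hG' : TendstoOfMeanEq P R (fun n v => (condProb (Pr n) (N n)
      {σ | x * ((n : ℕ) : ℝ) < costOf (((n : ℕ) : ℝ≥0) * mean P * t) σ} v).toReal) L :=
    fun ι l n v hl hn hv hsum hν => (hG ι l n v hl hn hv hsum hν).congr fun i =>
      (condProb_gt (hmodel (n i)).poisson (v i) _ _).symm
  refine (tendsto_scaledTimes_mem hmodel hw hwR hR
    (fun n => measurableSet_costOf_gt n _ _) hG').congr fun n => measureReal_congr ?_
  filter_upwards [(hmodel n).requestTimes_ae_eq] with ω hω
  refine propext ?_
  change x * ((n : ℕ) : ℝ) < costOf _ (scaledTimes (w n ω, passageTimes (N n) ω)) ↔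
    x * ((n : ℕ) : ℝ) < searchCost 1 (requestTimes (w n) (N n) ω) _
  rw [hω.2]

lemma tendsto_searchCostOut_pos (hmodel : ∀ n, IsRequestModel (w n) (N n) (Pr n))
    (hw : LLN Pr w P) (hwR : ∀ n : ℕ+, ∀ᵐ ω ∂(Pr n), R n (w n ω))
    (hR : ∀ n v (c : ℝ≥0), R n v → R n fun i => c * v i) {t : ℝ≥0} (ht : 0 < t) :
    Tendsto (fun n : ℕ+ => (Pr n).real {ω | 0 < searchCostOut 1 (requestTimes (w n) (N n) ω)
      (((n : ℕ) : ℝ≥0) * mean P * t)}) atTop (𝓝 (laplaceMoment P 1 t / mean P)) := by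
  have hG : TendstoOfMeanEq P R (fun n v => (condProb (Pr n) (N n)
      {σ | ∃ i, IsNextRequested (timesOf σ) (((n : ℕ) : ℝ≥0) * mean P * t) i ∧
        i ∉ requestedBefore (timesOf σ) (((n : ℕ) : ℝ≥0) * mean P * t)} v).toReal)
      (laplaceMoment P 1 t / mean P) := by
    intro ι l n v hl hn hv hsum hν
    refine (tendsto_exists_unrequested hw.mean_ne_zero (fun m j => (hmodel m).poisson j)
      (fun m => (hmodel m).indep) hsum hν ht).congr fun i => measureReal_congr ?_
    filter_upwards [(hmodel (n i)).isCountingPath] with ω hω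
    refine propext ?_
    have h : pathTimes (popularity (v i)) (fun j s => N (n i) j s ω) =
      timesOf (scaledTimes (v i, passageTimes (N (n i)) ω)) := pathTimes_eq_timesOf hω _
    change (∃ j, IsNextRequested (pathTimes (popularity (v i)) fun j s => N (n i) j s ω) _ j ∧
      j ∉ requestedBefore (pathTimes (popularity (v i)) fun j s => N (n i) j s ω) _) ↔
      ∃ j, IsNextRequested (timesOf (scaledTimes (v i, passageTimes (N (n i)) ω))) _ j ∧
      j ∉ requestedBefore (timesOf (scaledTimes (v i, passageTimes (N (n i)) ω))) _
    rw [h]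
  refine (tendsto_scaledTimes_mem hmodel hw hwR hR
    (fun n => measurableSet_setOfPred.2 (measurable_exists_out _)) hG).congr
    fun n => measureReal_congr ?_
  filter_upwards [(hmodel n).requestTimes_ae_eq] with ω hω
  refine propext ?_
  change (∃ j, IsNextRequested (timesOf (scaledTimes (w n ω, passageTimes (N n) ω))) _ j ∧
      j ∉ requestedBefore (timesOf (scaledTimes (w n ω, passageTimes (N n) ω))) _) ↔
    0 < searchCostOut 1 (requestTimes (w n) (N n) ω) _
  rw [searchCostOut_pos_iff, hω.1]

lemma real_Ioi_of_neg (hfin : ∫⁻ x, (x : ℝ≥0∞) ∂(P : Measure ℝ≥0) ≠ ∞) (hmean : mean P ≠ 0)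
    (hg : IsProfile P g Θ R) {t : ℝ≥0}
    (hf : ∫⁻ x, ENNReal.ofReal (transientDensity P g t x) = 1) {x : ℝ} (hx : x < 0) :
    (lawOfDensity (transientDensity P g t) hf : Measure ℝ).real (Ioi x) = 1 := by
  have hm : (mean P : ℝ) ≠ 0 := by exact_mod_cast hmean
  have h := lintegral_transientDensity_Ioi_of_le hfin hmean hg (zero_le (a := t))
  rw [NNReal.coe_zero, laplace_zero, sub_self, laplaceMoment_one_zero, div_self hm,
    ENNReal.ofReal_one] at h
  refine le_antisymm measureReal_le_one ?_
  calc (1 : ℝ) = (lawOfDensity (transientDensity P g t) hf : Measure ℝ).real (Ioi 0) := by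
        rw [lawOfDensity_real hf measurableSet_Ioi, h, ENNReal.toReal_one]
    _ ≤ _ := measureReal_mono (Ioi_subset_Ioi hx.le)

lemma real_Ioi_of_one_lt {t : ℝ≥0} (hf : ∫⁻ x, ENNReal.ofReal (transientDensity P g t x) = 1)
    {x : ℝ} (hx : 1 < x) :
    (lawOfDensity (transientDensity P g t) hf : Measure ℝ).real (Ioi x) = 0 := by
  have h0 : 0 ≤ laplace P t := (gPlus_nonneg t 0).trans (gPlus_le_laplace t 0)
  rw [lawOfDensity_real hf measurableSet_Ioi, setLIntegral_congr_fun (g := 0) measurableSet_Ioi]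
  · simp
  · intro y hy
    have hy' : x < y := hy
    have h1 : y ∉ Icc 0 (1 - laplace P t) := fun h => by linarith [h.2]
    have h2 : y ∉ Icc (1 - laplace P t) 1 := fun h => by linarith [h.2]
    simp [transientDensity, h1, h2]

/-- A position never exceeds `n`. -/
lemma tendstoOfMeanEq_of_one_lt (hmean : mean P ≠ 0)
    (hN : ∀ m j, IsStandardPoissonProcess (N m j) (Pr m))
    (hind : ∀ m, iIndepFun (fun j ω s => N m j s ω) (Pr m)) {t : ℝ≥0} {x : ℝ} (hx : 1 < x) :
    TendstoOfMeanEq P R (fun n v => (Pr n).real {ω | x * ((n : ℕ) : ℝ) <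
      searchCost 1 (pathTimes (popularity v) fun j s => N n j s ω)
        (((n : ℕ) : ℝ≥0) * mean P * t)}) 0 := by
  intro ι l n v hl hn hv hsum hν
  refine tendsto_const_nhds.congr fun i => ?_
  have hs0 : ∑ j, v i j ≠ 0 := by
    rw [hsum]
    exact mul_ne_zero (by exact_mod_cast (n i).ne_zero) hmean
  dsimp only
  rw [measureReal_def, measure_eq_zero_iff_ae_notMem.2, ENNReal.toReal_zero]
  filter_upwards [ae_exists_isOnlyNextRequested (hN (n i)) (hind (n i)) (sum_popularity hs0)
    (((n i : ℕ) : ℝ≥0) * mean P * t)] with ω ⟨j, hj⟩ h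
  have h' : x * ((n i : ℕ) : ℝ) < searchCost 1 (pathTimes (popularity (v i))
    fun j s => N (n i) j s ω) (((n i : ℕ) : ℝ≥0) * mean P * t) := h
  rw [hj.searchCost_eq 1] at h'
  have h1 : (position 1 (pathTimes (popularity (v i)) fun j s => N (n i) j s ω)
    (((n i : ℕ) : ℝ≥0) * mean P * t) j : ℝ) ≤ ((n i : ℕ) : ℝ) := by
    exact_mod_cast ((isRanking_position _ _ _).2 j).2
  have h2 : (0 : ℝ) < ((n i : ℕ) : ℝ) := by exact_mod_cast (n i).pos
  nlinarith

/-- Half-open intervals with end points outside a countable set form a π-system containing small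
neighbourhoods of every point, which determines weak convergence. -/
lemma tendsto_of_tendsto_Ioi {μ : ℕ+ → ProbabilityMeasure ℝ} {ν : ProbabilityMeasure ℝ}
    {B : Set ℝ} (hB : B.Countable) (h : ∀ x ∉ B,
      Tendsto (fun n => (μ n : Measure ℝ).real (Ioi x)) atTop (𝓝 ((ν : Measure ℝ).real (Ioi x)))) :
    Tendsto μ atTop (𝓝 ν) := by
  have hd : Dense Bᶜ := hB.dense_compl ℝ
  refine (isPiSystem_Ioc_mem Bᶜ Bᶜ).tendsto_probabilityMeasure_of_tendsto_of_mem ?_ ?_ ?_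
  · rintro s ⟨a, -, b, -, -, rfl⟩
    exact measurableSet_Ioc
  · intro u hu x hx
    obtain ⟨ε, hε, hball⟩ := Metric.isOpen_iff.1 hu x hx
    obtain ⟨a, ha, ha1, ha2⟩ := hd.exists_between (show x - ε < x by linarith)
    obtain ⟨b, hb, hb1, hb2⟩ := hd.exists_between (show x < x + ε by linarith)
    refine ⟨Ioc a b, ⟨a, ha, b, hb, ha2.trans hb1, rfl⟩, Ioc_mem_nhds ha2 hb1, fun y hy => ?_⟩
    refine hball ?_
    rw [Metric.mem_ball, Real.dist_eq, abs_lt]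
    constructor <;> linarith [hy.1, hy.2]
  · rintro s ⟨a, ha, b, hb, hab, rfl⟩
    have hsub : ∀ Q : ProbabilityMeasure ℝ, ((Q (Ioc a b) : ℝ≥0) : ℝ) =
        (Q : Measure ℝ).real (Ioi a) - (Q : Measure ℝ).real (Ioi b) := by
      intro Q
      have hset : Ioc a b = Ioi a \ Ioi b := by
        ext y
        simp
      rw [← measureReal_sdiff (Ioi_subset_Ioi hab.le) measurableSet_Ioi, ← hset]
      rfl
    rw [← NNReal.tendsto_coe]
    simp only [hsub]
    exact (h a ha).sub (h b hb)

lemma tendstoInDistribution_searchCost (hmodel : ∀ n, IsRequestModel (w n) (N n) (Pr n))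
    (hw : LLN Pr w P) (hg : IsProfile P g Θ R) (hwR : ∀ n : ℕ+, ∀ᵐ ω ∂(Pr n), R n (w n ω))
    {t : ℝ≥0} (ht : 0 < t) (hf : ∫⁻ x, ENNReal.ofReal (transientDensity P g t x) = 1) :
    TendstoInDistribution
      (fun (n : ℕ+) ω => (searchCost 1 (requestTimes (w n) (N n) ω)
        (((n : ℕ) : ℝ≥0) * mean P * t) : ℝ) / ((n : ℕ) : ℝ))
      atTop (id : ℝ → ℝ) Pr (lawOfDensity (transientDensity P g t) hf : Measure ℝ) := by
  have hae : ∀ n : ℕ+, AEMeasurable (fun ω => (searchCost 1 (requestTimes (w n) (N n) ω)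
      (((n : ℕ) : ℝ≥0) * mean P * t) : ℝ) / ((n : ℕ) : ℝ)) (Pr n) := fun n =>
    (measurable_from_top.comp_aemeasurable
      ((hmodel n).aemeasurable_searchCost (((n : ℕ) : ℝ≥0) * mean P * t))).div_const _
  refine ⟨hae, aemeasurable_id, ?_⟩
  -- The ends of the support and the transition point are not treated separately: three points may
  -- be ignored.
  refine tendsto_of_tendsto_Ioi (B := {0, 1 - laplace P t, 1}) (Set.toFinite _).countable
    fun x hx => ?_
  simp only [Set.mem_insert_iff, Set.mem_singleton_iff, not_or] at hx
  simp only [ProbabilityMeasure.coe_mk, Measure.map_id]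
  have hlim : Tendsto (fun n : ℕ+ => (Pr n).real {ω | x * ((n : ℕ) : ℝ) <
      searchCost 1 (requestTimes (w n) (N n) ω) (((n : ℕ) : ℝ≥0) * mean P * t)}) atTop
      (𝓝 ((lawOfDensity (transientDensity P g t) hf : Measure ℝ).real (Ioi x))) := by
    rcases lt_or_gt_of_ne hx.1 with h0 | h0
    · rw [real_Ioi_of_neg hw.mean_finite hw.mean_ne_zero hg hf h0]
      refine tendsto_const_nhds.congr fun n => ?_
      have hn : (0 : ℝ) < ((n : ℕ) : ℝ) := by exact_mod_cast n.pos
      rw [Set.eq_univ_of_forall (s := {ω | x * ((n : ℕ) : ℝ) < _}) fun ω =>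
        (mul_neg_of_neg_of_pos h0 hn).trans_le (Nat.cast_nonneg _), probReal_univ]
    · refine tendsto_requestTimes_searchCost_gt hmodel hw hwR hg.smul ?_
      rcases lt_or_gt_of_ne hx.2.2 with h1 | h1
      · intro ι l n v hl hn hv hsum hν
        refine tendsto_searchCost_gt hw.mean_finite hw.mean_ne_zero hg
          (fun m j => (hmodel m).poisson j) (fun m => (hmodel m).indep) hn hv hsum hν ht hf ?_
        rcases lt_or_gt_of_ne hx.2.1 with h2 | h2
        · exact Or.inl ⟨h0, h2⟩
        · exact Or.inr ⟨h2, h1⟩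
      · rw [real_Ioi_of_one_lt hf h1]
        exact tendstoOfMeanEq_of_one_lt hw.mean_ne_zero (fun m j => (hmodel m).poisson j)
          (fun m => (hmodel m).indep) h1
  refine hlim.congr fun n => ?_
  have hn : (0 : ℝ) < ((n : ℕ) : ℝ) := by exact_mod_cast n.pos
  rw [measureReal_def, measureReal_def, Measure.map_apply_of_aemeasurable (hae n) measurableSet_Ioi]
  congr 2
  ext ω
  exact (lt_div_iff₀ hn).symm

end Random

lemma hasDensity_lawOfDensity {f : ℝ → ℝ} (hf : ∫⁻ x, ENNReal.ofReal (f x) = 1)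
    (hm : AEMeasurable f volume) (h0 : ∀ᵐ x, 0 ≤ f x) : HasDensity (lawOfDensity f hf) f :=
  ⟨hm, h0, rfl⟩

/-- The densities agree below `1 - φ(t)`, so only the masses beyond it matter. -/
lemma tvDist_lawOfDensity_le {P : ProbabilityMeasure ℝ≥0} {g : ℝ≥0 → ℝ → ℝ} {t : ℝ≥0}
    (hf : ∫⁻ x, ENNReal.ofReal (transientDensity P g t x) = 1)
    (hf' : ∫⁻ x, ENNReal.ofReal (stationaryDensity P x) = 1) :
    tvDist (lawOfDensity _ hf) (lawOfDensity _ hf') ≤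
      ENNReal.ofReal ((lawOfDensity _ hf : Measure ℝ).real (Ioi (1 - laplace P t)) +
        (lawOfDensity _ hf' : Measure ℝ).real (Ioi (1 - laplace P t))) := by
  rw [← compl_Iic]
  refine tvDist_le measurableSet_Iic fun s hs => ?_
  rw [lawOfDensity_real hf (hs.inter measurableSet_Iic),
    lawOfDensity_real hf' (hs.inter measurableSet_Iic)]
  congr 1
  rw [← lintegral_indicator (hs.inter measurableSet_Iic),
    ← lintegral_indicator (hs.inter measurableSet_Iic)]
  refine lintegral_congr_ae ?_
  filter_upwards [Measure.ae_ne volume (1 - laplace P t)] with x hx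
  by_cases h : x ∈ s ∩ Iic (1 - laplace P t)
  · rw [Set.indicator_of_mem h, Set.indicator_of_mem h,
      transientDensity_eq_stationaryDensity P g (lt_of_le_of_ne h.2 hx)]
  · rw [Set.indicator_of_notMem h, Set.indicator_of_notMem h]

end MtF

theorem mainTheorem5 {Ω : ℕ+ → Type*} [∀ n, MeasurableSpace (Ω n)]
    (Pr : ∀ n, Measure (Ω n)) [∀ n, IsProbabilityMeasure (Pr n)]
    (w : ∀ n : ℕ+, Ω n → Fin n → ℝ≥0) (N : ∀ n : ℕ+, Fin n → ℝ≥0 → Ω n → ℕ)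
    (hmodel : ∀ n, MtF.IsRequestModel (w n) (N n) (Pr n))
    (P : ProbabilityMeasure ℝ≥0) (g : ℝ≥0 → ℝ → ℝ)
    (hP : (MtF.LLNMinus Pr w P ∧ g = MtF.gTildeMinus P) ∨
      (MtF.LLNPlus Pr w P ∧ g = MtF.gTildePlus P)) :
    -- `Q t` is the law of `S(t)`, and `Q'` is the law of `S^(∞)`
    ∃ (Q : ℝ≥0 → ProbabilityMeasure ℝ) (Q' : ProbabilityMeasure ℝ),
      (∀ t, MtF.HasDensity (Q t) (MtF.transientDensity P g t)) ∧
      MtF.HasDensity Q' (MtF.stationaryDensity P) ∧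
      (∀ t : ℝ≥0, 0 < t →
        TendstoInDistribution
          (fun (n : ℕ+) ω => (MtF.searchCost 1 (MtF.requestTimes (w n) (N n) ω)
            (((n : ℕ) : ℝ≥0) * MtF.mean P * t) : ℝ) / ((n : ℕ) : ℝ))
          atTop (id : ℝ → ℝ) Pr (Q t : Measure ℝ)) ∧
      (∀ t : ℝ≥0, 0 < t →
        Tendsto
          (fun n : ℕ+ => (Pr n).real {ω | 0 < MtF.searchCostOut 1 (MtF.requestTimes (w n) (N n) ω)
            (((n : ℕ) : ℝ≥0) * MtF.mean P * t)})
          atTop (𝓝 ((Q t : Measure ℝ).real (Ioi (1 - MtF.laplace P t)))) ∧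
        (Q t : Measure ℝ).real (Ioi (1 - MtF.laplace P t)) =
          (Q' : Measure ℝ).real (Ioi (1 - MtF.laplace P t)) ∧
        (Q' : Measure ℝ).real (Ioi (1 - MtF.laplace P t)) =
          |MtF.laplaceDeriv P t| / (MtF.mean P : ℝ)) ∧
      (∀ t : ℝ≥0, MtF.tvDist (Q t) Q' ≤
        ENNReal.ofReal (2 * (|MtF.laplaceDeriv P t| / (MtF.mean P : ℝ)))) := by
  -- From here on the two orderings are no longer distinguished.
  obtain ⟨Θ, R, hw, hg, hwR⟩ : ∃ (Θ : ℝ → ℝ → ℝ → ℝ) (R : ∀ n, (Fin n → ℝ≥0) → Prop),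
      MtF.LLN Pr w P ∧ MtF.IsProfile P g Θ R ∧ ∀ n : ℕ+, ∀ᵐ ω ∂(Pr n), R n (w n ω) := by
    rcases hP with ⟨⟨hw, hwR⟩, rfl⟩ | ⟨⟨hw, hwR⟩, rfl⟩
    · exact ⟨_, _, hw, MtF.isProfile_gTildeMinus P, hwR⟩
    · exact ⟨_, _, hw, MtF.isProfile_gTildePlus P, hwR⟩
  have hfin := hw.mean_finite
  have hmean := hw.mean_ne_zero
  have hf := MtF.lintegral_transientDensity hfin hmean hg
  have hf' := MtF.lintegral_stationaryDensity hfin hmean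
  have hφ : ∀ t : ℝ≥0, |MtF.laplaceDeriv P t| / (MtF.mean P : ℝ) =
      MtF.laplaceMoment P 1 t / MtF.mean P := fun t => by
    rw [MtF.laplaceDeriv_eq hfin (NNReal.coe_nonneg t), abs_neg,
      abs_of_nonneg (MtF.laplaceMoment_nonneg 1 t)]
  have hnn : ∀ t : ℝ≥0, 0 ≤ MtF.laplaceMoment P 1 t / MtF.mean P := fun t =>
    div_nonneg (MtF.laplaceMoment_nonneg 1 t) (NNReal.coe_nonneg _)
  have hQ : ∀ t : ℝ≥0, (MtF.lawOfDensity _ (hf t) : Measure ℝ).real (Ioi (1 - MtF.laplace P t)) =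
      |MtF.laplaceDeriv P t| / (MtF.mean P : ℝ) := fun t => by
    rw [hφ, MtF.lawOfDensity_real _ measurableSet_Ioi,
      MtF.lintegral_transientDensity_Ioi_self hfin hg, ENNReal.toReal_ofReal (hnn t)]
  have hQ' : ∀ t : ℝ≥0, (MtF.lawOfDensity _ hf' : Measure ℝ).real (Ioi (1 - MtF.laplace P t)) =
      |MtF.laplaceDeriv P t| / (MtF.mean P : ℝ) := fun t => by
    rw [hφ, MtF.lawOfDensity_real _ measurableSet_Ioi,
      MtF.lintegral_stationaryDensity_Ioi hfin hmean (NNReal.coe_nonneg t),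
      ENNReal.toReal_ofReal (hnn t)]
  refine ⟨fun t => MtF.lawOfDensity _ (hf t), MtF.lawOfDensity _ hf', fun t => ?_, ?_,
    fun t ht => MtF.tendstoInDistribution_searchCost hmodel hw hg hwR ht (hf t),
    fun t ht => ⟨?_, (hQ t).trans (hQ' t).symm, hQ' t⟩, fun t => ?_⟩
  · exact MtF.hasDensity_lawOfDensity _ (MtF.aemeasurable_transientDensity hfin hmean hg t)
      (MtF.transientDensity_nonneg_ae hfin hmean hg t)
  · exact MtF.hasDensity_lawOfDensity _ (MtF.aemeasurable_stationaryDensity hfin hmean)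
      (MtF.stationaryDensity_nonneg_ae hfin hmean)
  · rw [hQ, hφ]
    exact MtF.tendsto_searchCostOut_pos hmodel hw hwR hg.smul ht
  · refine (MtF.tvDist_lawOfDensity_le (hf t) hf').trans_eq ?_
    rw [hQ, hQ', two_mul]
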